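/- Let $d\ge 1$ and let $\Omega$ be the space of simple, locally finite point configurations $\eta$ in $\mathbb R^d$ (identified with their supports), with the $\sigma$-algebra generated by the counts $N_\Lambda(\eta)=|\eta\cap\Lambda|$, $\Lambda\subset\mathbb R^d$ bounded Borel. Write $\eta_\Lambda=\eta\cap\Lambda$ and, for a probability measure $\mu$ on $\Omega$, let $\mu_\Lambda$ be the law of $\eta_\Lambda$ under $\mu$. Let $\pi_\Lambda$ be the Poisson point process of intensity $1$ in $\Lambda$, and $\Lambda_n=[-n/2,n/2)^d$. **Interaction.** Let $H$ be a measurable real-valued function on the finite subsets of $\mathbb R^d$ such that $H_\Lambda(\eta)=\lim_{n}\big(H(\eta_{\Lambda_n})-H(\eta_{\Lambda_n\setminus\Lambda})\big)$ exists in $\mathbb R$ for all bounded Borel $\Lambda$ and all $\eta\in\Omega$. Put $h(x,\eta)=\lim_{n}\big(H(\eta_{\Lambda_n}\cup\{x\})-H(\eta_{\Lambda_n})\big)$ and $b(x,\eta)=e^{-h(x,\eta)}$. Assume that (i) for each $n$, $H(\{x_1,\dots,x_n\})$ is continuous in $(x_1,\dots,x_n)$ on the set of $n$-tuples of distinct points;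 (ii) $h$ is bounded; (iii) there is $R>0$ with $H_\Lambda(\eta)=H_\Lambda(\eta_{\{x:\,\mathrm{dist}(x,\Lambda)\le R\}})$ for all bounded Borel $\Lambda$ and all $\eta$. **Gibbs measure.** Let $\nu$ be a translation-invariant probability measure on $\Omega$ that satisfies the DLR equations: for all bounded Borel $\Lambda$ and measurable $f\ge 0$, $$\int f\,d\nu=\int\nu(d\omega)\,\frac{1}{Z_\Lambda(\omega)}\int\pi_\Lambda(d\eta)\,e^{-H_\Lambda(\eta_\Lambda\omega_{\Lambda^c})}f(\eta_\Lambda\omega_{\Lambda^c}),\qquad Z_\Lambda(\omega)=\int e^{-H_\Lambda(\eta_\Lambda\omega_{\Lambda^c})}\,\pi_\Lambda(d\eta).$$ **Dynamics.** Let $$(\mathscr L f)(\eta)=\int_{\mathbb R^d}b(x,\eta)\big(f(\eta\cup\{x\})-f(\eta)\big)\,dx+\sum_{x\in\eta}\big(f(\eta\setminus\{x\})-f(\eta)\big),$$ and let $(T_t)_{t\ge0}$ be the transition semigroup of the associated birth-and-death process: for each $\omega\in\Omega$, $T_t(\omega,\cdot)$ is the law at time $t$ of a process $X^{(\omega)}$,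 càdlàg for the vague topology on $\Omega$, with $X^{(\omega)}_0=\omega$, that solves the martingale problem for $\mathscr L$ on the bounded, local, measurable functions. Write $\mu T_t=\int\mu(d\omega)\,T_t(\omega,\cdot)$. **Entropy.** Let $I_\Lambda(\mu|\nu)=\int\log\frac{d\mu_\Lambda}{d\nu_\Lambda}\,d\mu_\Lambda$ if $\mu_\Lambda\ll\nu_\Lambda$, and $I_\Lambda(\mu|\nu)=\infty$ otherwise. **Claim.** Let $\mu$ be a regular probability measure on $\Omega$: it is translation invariant and for each bounded Borel $\Lambda$ the density $d\mu_\Lambda/d\pi_\Lambda$ exists and there are $c,z\in(0,\infty)$, which may depend on $\Lambda$, with $c^{-1}z^{-N_\Lambda}\le d\mu_\Lambda/d\pi_\Lambda\le c\,z^{N_\Lambda}$ $\pi_\Lambda$-a.e. Then, for each bounded Borel $\Lambda\subset\mathbb R^d$: $\mu_\Lambda$ and $\nu_\Lambda$ are mutually absolutely continuous; $\mathscr L\log\frac{d\mu_\Lambda}{d\nu_\Lambda}$ (the generator applied to $\eta\mapsto\log\frac{d\mu_\Lambda}{d\nu_\Lambda}(\eta_\Lambda)$) is well defined $\mu$-a.e.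 and $\mu$-integrable; $I_\Lambda(\mu T_t|\nu)$ is finite for all sufficiently small $t\ge0$; and $t\mapsto I_\Lambda(\mu T_t|\nu)$ is (right-)differentiable at $t=0$ with $$\frac{d}{dt}\Big|_{t=0}I_\Lambda(\mu T_t|\nu)=\mu\Big[\mathscr L\log\frac{d\mu_\Lambda}{d\nu_\Lambda}\Big].$$ -/

import Mathlib

open MeasureTheory ProbabilityTheory Filter Topology
open scoped NNReal ENNReal

namespace BirthDeath

/-- The positional space `ℝ^d` with its Euclidean norm, Borel σ-algebra and Lebesgue measure. -/
abbrev E (d : ℕ) : Type := EuclideanSpace ℝ (Fin d)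

/-- The space `Ω` of simple, locally finite point configurations in `ℝ^d`; a configuration is
identified with its support. -/
@[ext]
structure Config (d : ℕ) where
  carrier : Set (E d)
  finite_inter : ∀ B : Set (E d), Bornology.IsBounded B → (carrier ∩ B).Finite

variable {d : ℕ}

namespace Config

/-- The number of points `N_Λ(η) = |η ∩ Λ|`. -/
noncomputable def count (Λ : Set (E d)) (η : Config d) : ℕ := (η.carrier ∩ Λ).ncard

/-- The σ-algebra generated by the counting variables `N_Λ`, `Λ` bounded Borel. -/
noncomputable instance instMeasurableSpace : MeasurableSpace (Config d) :=
  ⨆ (Λ : Set (E d)) (_ : Bornology.IsBounded Λ) (_ : MeasurableSet Λ),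
    MeasurableSpace.comap (count Λ) ⊤

/-- The vague topology: the coarsest one for which `η ↦ ∑_{x ∈ η} φ x` is continuous for each
continuous compactly supported `φ : ℝ^d → ℝ`. -/
noncomputable instance instTopologicalSpace : TopologicalSpace (Config d) :=
  ⨅ φ : CompactlySupportedContinuousMap (E d) ℝ,
    TopologicalSpace.induced (fun η : Config d => ∑' x : η.carrier, φ x.1) inferInstance

/-- The restriction `η_Λ = η ∩ Λ`. -/
def restrict (Λ : Set (E d)) (η : Config d) : Config d where
  carrier := η.carrier ∩ Λ
  finite_inter B hB := (η.finite_inter B hB).subset fun _ h => ⟨h.1.1, h.2⟩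

/-- The configuration `η + δ_x`. -/
def add (η : Config d) (x : E d) : Config d where
  carrier := insert x η.carrier
  finite_inter B hB := ((η.finite_inter B hB).insert x).subset fun _ h =>
    h.1.elim (fun e => Or.inl e) (fun e => Or.inr ⟨e, h.2⟩)

/-- The configuration `η - δ_x`. -/
def remove (η : Config d) (x : E d) : Config d where
  carrier := η.carrier \ {x}
  finite_inter B hB := (η.finite_inter B hB).subset fun _ h => ⟨h.1.1, h.2⟩

/-- The configuration `η_Λ ω_{Λᶜ}`, equal to `η` inside `Λ` and to `ω` outside. -/
def glue (Λ : Set (E d)) (η ω : Config d) : Config d where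
  carrier := (η.carrier ∩ Λ) ∪ (ω.carrier \ Λ)
  finite_inter B hB := ((η.finite_inter B hB).union (ω.finite_inter B hB)).subset fun _ h =>
    h.1.elim (fun e => Or.inl ⟨e.1, h.2⟩) (fun e => Or.inr ⟨e.1, h.2⟩)

/-- The translation `θ_x`, which moves each point `y` to `y - x`. -/
def translate (x : E d) (η : Config d) : Config d where
  carrier := {y | y + x ∈ η.carrier}
  finite_inter B hB := by
    obtain ⟨r, hr⟩ := hB.subset_closedBall (0 : E d)
    refine ((η.finite_inter (Metric.closedBall x r) Metric.isBounded_closedBall).image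
      (fun y => y - x)).subset ?_
    rintro y ⟨hy, hyB⟩
    refine ⟨y + x, ⟨hy, ?_⟩, by simp⟩
    have := hr hyB
    simpa [dist_eq_norm] using this

/-- A finite set of points, as a configuration. -/
def ofFinite (s : Set (E d)) (hs : s.Finite) : Config d where
  carrier := s
  finite_inter _ _ := hs.subset Set.inter_subset_left

/-- The finitely many points of `η` in a bounded set. -/
noncomputable def points (η : Config d) {B : Set (E d)} (hB : Bornology.IsBounded B) :
    Finset (E d) :=
  (η.finite_inter B hB).toFinset

end Config

/-- The marginal `μ_Λ`, i.e. the law of `η_Λ` under `μ`. -/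
noncomputable def marginal (μ : Measure (Config d)) (Λ : Set (E d)) : Measure (Config d) :=
  μ.map (Config.restrict Λ)

/-- The Poisson point process `π_Λ` of intensity `1` in a bounded Borel set `Λ`:
`e^{-|Λ|} ∑_n (1 / n!) ∫_{Λ^n} 1{ {x_1, …, x_n} ∈ · } dx_1 ⋯ dx_n`. -/
noncomputable def poisson (Λ : Set (E d)) : Measure (Config d) :=
  ENNReal.ofReal (Real.exp (-(volume Λ).toReal)) •
    Measure.sum fun n : ℕ => ((n.factorial : ℝ≥0∞)⁻¹) •
      (Measure.pi fun _ : Fin n => (volume : Measure (E d)).restrict Λ).map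
        (fun x => Config.ofFinite (Set.range x) (Set.finite_range x))

/-- Translation invariance of a point process. -/
def IsTranslationInvariant (μ : Measure (Config d)) : Prop :=
  ∀ x : E d, μ.map (Config.translate x) = μ

/-- Regular measures: translation invariant, and for each bounded Borel `Λ` the density
`dμ_Λ/dπ_Λ` exists and lies between `c⁻¹ z^{-N_Λ}` and `c z^{N_Λ}` for some `c, z ∈ (0, ∞)`
that may depend on `Λ`. -/
def IsRegular (μ : Measure (Config d)) : Prop :=
  IsTranslationInvariant μ ∧
  ∀ Λ : Set (E d), Bornology.IsBounded Λ → MeasurableSet Λ →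
    marginal μ Λ ≪ poisson Λ ∧
    ∃ z c : ℝ, 0 < z ∧ 0 < c ∧ ∀ᵐ η ∂(poisson Λ),
      ENNReal.ofReal (c⁻¹ * (z ^ Config.count Λ η)⁻¹) ≤ (marginal μ Λ).rnDeriv (poisson Λ) η ∧
      (marginal μ Λ).rnDeriv (poisson Λ) η ≤ ENNReal.ofReal (c * z ^ Config.count Λ η)

/-- The box `Λ_n = [-n/2, n/2)^d`. -/
def box (d n : ℕ) : Set (E d) := {x | ∀ i, -((n : ℝ) / 2) ≤ x i ∧ x i < (n : ℝ) / 2}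

theorem isBounded_box (d n : ℕ) : Bornology.IsBounded (box d n) := by
  refine isBounded_iff_forall_norm_le.2 ⟨Real.sqrt (∑ _i : Fin d, ((n : ℝ) / 2) ^ 2), ?_⟩
  intro x hx
  rw [EuclideanSpace.norm_eq]
  refine Real.sqrt_le_sqrt (Finset.sum_le_sum fun i _ => ?_)
  rw [Real.norm_eq_abs]
  exact pow_le_pow_left₀ (abs_nonneg _) (abs_le.2 ⟨(hx i).1, (hx i).2.le⟩) 2

/-- `H(η_{Λ_n}) - H(η_{Λ_n \ Λ})`. -/
noncomputable def condEnergyApprox (H : Finset (E d) → ℝ) (Λ : Set (E d)) (η : Config d) (n : ℕ) :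
    ℝ :=
  H (η.points (isBounded_box d n)) -
    H (η.points ((isBounded_box d n).subset (Set.sdiff_subset (t := Λ))))

/-- The conditional energy `H_Λ(η) = lim_n (H(η_{Λ_n}) - H(η_{Λ_n \ Λ}))`. -/
noncomputable def condEnergy (H : Finset (E d) → ℝ) (Λ : Set (E d)) (η : Config d) : ℝ :=
  limUnder atTop (condEnergyApprox H Λ η)

open Classical in
/-- The conditional energy of a point, `h(x, η) = lim_n (H(η_{Λ_n} + δ_x) - H(η_{Λ_n}))`. -/
noncomputable def pointEnergy (H : Finset (E d) → ℝ) (x : E d) (η : Config d) : ℝ :=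
  limUnder atTop fun n : ℕ =>
    H (insert x (η.points (isBounded_box d n))) - H (η.points (isBounded_box d n))

/-- The birth rate `b(x, η) = e^{-h(x, η)}`. -/
noncomputable def birthRate (H : Finset (E d) → ℝ) (x : E d) (η : Config d) : ℝ :=
  Real.exp (-pointEnergy H x η)

/-- The standing assumptions on the energy functional `H` on finite configurations. -/
structure IsAdmissible (H : Finset (E d) → ℝ) : Prop where
  /-- `H` is measurable. -/
  measurable : ∀ (B : Set (E d)) (hB : Bornology.IsBounded B), MeasurableSet B →
    Measurable fun η : Config d => H (η.points hB)
  /-- The conditional energies are well defined. -/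
  exists_limit : ∀ Λ : Set (E d), Bornology.IsBounded Λ → MeasurableSet Λ → ∀ η : Config d,
    ∃ l : ℝ, Tendsto (condEnergyApprox H Λ η) atTop (𝓝 l)
  /-- Continuity: for each `n`, `H` depends continuously on the positions of `n` distinct
  points. -/
  continuous : ∀ n : ℕ, ContinuousOn
    (fun x : Fin n → E d => H (Set.finite_range x).toFinset) {x | Function.Injective x}
  /-- The interaction is bounded from above and below. -/
  bounded : ∃ C : ℝ, ∀ (x : E d) (η : Config d), |pointEnergy H x η| ≤ C
  /-- The interaction has finite range. -/
  finite_range : ∃ R : ℝ, 0 < R ∧ ∀ Λ : Set (E d), Bornology.IsBounded Λ → MeasurableSet Λ →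
    ∀ η : Config d, condEnergy H Λ η = condEnergy H Λ (η.restrict (Metric.cthickening R Λ))

/-- The Boltzmann weight `e^{-H_Λ(η_Λ ω_{Λᶜ})}`. -/
noncomputable def gibbsWeight (H : Finset (E d) → ℝ) (Λ : Set (E d)) (ω η : Config d) : ℝ≥0∞ :=
  ENNReal.ofReal (Real.exp (-condEnergy H Λ (Config.glue Λ η ω)))

/-- The partition function `Z_Λ(ω)`. -/
noncomputable def partitionFunction (H : Finset (E d) → ℝ) (Λ : Set (E d)) (ω : Config d) :
    ℝ≥0∞ :=
  ∫⁻ η, gibbsWeight H Λ ω η ∂(poisson Λ)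

/-- The finite-volume Gibbs point process in `Λ` with boundary condition `ω`. -/
noncomputable def finiteGibbs (H : Finset (E d) → ℝ) (Λ : Set (E d)) (ω : Config d) :
    Measure (Config d) :=
  (partitionFunction H Λ ω)⁻¹ • (poisson Λ).withDensity (gibbsWeight H Λ ω)

/-- Translation-invariant infinite-volume Gibbs point processes: probability measures that
satisfy the DLR equations. -/
structure IsGibbs (H : Finset (E d) → ℝ) (ν : Measure (Config d)) : Prop where
  isProbabilityMeasure : IsProbabilityMeasure ν
  translationInvariant : IsTranslationInvariant ν
  dlr : ∀ Λ : Set (E d), Bornology.IsBounded Λ → MeasurableSet Λ →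
    ∀ f : Config d → ℝ≥0∞, Measurable f →
      ∫⁻ ω, f ω ∂ν = ∫⁻ ω, ∫⁻ η, f (Config.glue Λ η ω) ∂(finiteGibbs H Λ ω) ∂ν

/-- The integrand of the birth part of the generator. -/
noncomputable def birthTerm (b : E d → Config d → ℝ) (f : Config d → ℝ) (η : Config d)
    (x : E d) : ℝ :=
  b x η * (f (η.add x) - f η)

/-- The formal generator
`(𝓛 f)(η) = ∫ b(x, η) (f(η + δ_x) - f(η)) dx + ∑_{x ∈ η} (f(η - δ_x) - f(η))`. -/
noncomputable def generator (b : E d → Config d → ℝ) (f : Config d → ℝ) (η : Config d) : ℝ :=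
  (∫ x, birthTerm b f η x) + ∑' x : η.carrier, (f (η.remove x.1) - f η)

/-- Bounded, local, measurable functions on `Ω`. -/
structure IsBoundedLocal (f : Config d → ℝ) : Prop where
  measurable : Measurable f
  bounded : ∃ C : ℝ, ∀ η, |f η| ≤ C
  isLocal : ∃ Λ : Set (E d), Bornology.IsBounded Λ ∧ MeasurableSet Λ ∧
    ∀ η, f (η.restrict Λ) = f η

/-- `X` is a càdlàg solution, on the probability space `(S, P)`, of the martingale problem for the
generator with birth rate `b` and initial configuration `ω`. -/
structure SolvesMartingaleProblem (b : E d → Config d → ℝ) (ω : Config d)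
    {S : Type} [mS : MeasurableSpace S] (P : Measure S) (X : ℝ≥0 → S → Config d) : Prop where
  initial : ∀ᵐ s ∂P, X 0 s = ω
  rightContinuous : ∀ (s : S) (t : ℝ≥0), ContinuousWithinAt (fun u => X u s) (Set.Ici t) t
  leftLimits : ∀ (s : S) (t : ℝ≥0), ∃ η : Config d, Tendsto (fun u => X u s) (𝓝[<] t) (𝓝 η)
  martingale : ∃ 𝓕 : Filtration ℝ≥0 mS, (∀ t, Measurable[𝓕 t] (X t)) ∧
    ∀ f : Config d → ℝ, IsBoundedLocal f →
      Martingale (fun (t : ℝ≥0) (s : S) =>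
        f (X t s) - ∫ u in (0 : ℝ)..t, generator b f (X u.toNNReal s)) 𝓕 P

/-- `(T_t)` is the transition semigroup of the birth-and-death process with birth rate `b` and
unit death rate: `T_t(ω, ·)` is the law of `X_t^{(ω)}`, where `X^{(ω)}` is a solution of the
martingale problem for the generator that starts in `ω`. -/
structure IsBirthDeathSemigroup (b : E d → Config d → ℝ)
    (T : ℝ≥0 → Kernel (Config d) (Config d)) : Prop where
  semigroup : ∀ s t : ℝ≥0, T (s + t) = T t ∘ₖ T s
  law : ∀ ω : Config d, ∃ (S : Type) (_ : MeasurableSpace S) (P : Measure S)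
    (X : ℝ≥0 → S → Config d), IsProbabilityMeasure P ∧ SolvesMartingaleProblem b ω P X ∧
      ∀ t, T t ω = P.map (X t)

/-- The evolved measure `μ T_t`, for real `t ≥ 0`. -/
noncomputable def evolve (μ : Measure (Config d)) (T : ℝ≥0 → Kernel (Config d) (Config d))
    (t : ℝ) : Measure (Config d) :=
  μ.bind (T t.toNNReal)

/-- The local relative entropy `I_Λ(μ | ν) = I(μ_Λ | ν_Λ)`. -/
noncomputable def localEntropy (Λ : Set (E d)) (μ ν : Measure (Config d)) : ℝ≥0∞ :=
  InformationTheory.klDiv (marginal μ Λ) (marginal ν Λ)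

/-- The `Λ`-local function `η ↦ log (dμ_Λ/dν_Λ)(η_Λ)`. -/
noncomputable def logDensity (Λ : Set (E d)) (μ ν : Measure (Config d)) (η : Config d) : ℝ :=
  Real.log ((marginal μ Λ).rnDeriv (marginal ν Λ) (η.restrict Λ)).toReal

end BirthDeath

/-! Write μ_t for μ T_t. The chain rule for relative entropy splits I_Λ(μ_t | ν) into I_Λ(μ_t | μ)
plus the μ_t-expectation of log dμ_Λ/dν_Λ. The first summand compares two measures that are close,
so it is O(t²). The second is the expectation of a fixed Λ-local function, so by Dynkin's formula
its derivative at 0 is the μ-expectation of the generator applied to it. Both parts come with a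
quadratic error (`exists_abs_toReal_localEntropy_sub_le`).

First summand. Since x log x - x + 1 ≤ (x - 1)², it suffices that the density r of the Λ-marginal of
μ_t with respect to μ_Λ satisfies |r - 1| ≤ t g y^{N_Λ} (`klDiv_le_lintegral_sq`). The marginal does
not evolve autonomously, because birth rates in Λ depend on points outside. The generator is
therefore replaced by a positive operator K (`domOp`) in which the birth rate is the constant bound
c. K dominates the generator and maps Λ-local functions to Λ-local functions. Iterating Dynkin's
formula for the indicator of a local event B bounds T_u K 1_B by ∑ ε^k/k! K^{k+1} 1_B for u ≤ ε.
After integration against μ, the Mecke formula for the Poisson process moves K from 1_B to the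
weight z^{N_Λ} (`dualOp`), where k applications cost k! times geometric factors. The k! is cancelled
by ε^k/k!, and the sum converges for small ε (`lintegral_domSeries_le`, `marginal_bind_le_add`).
This uses that μ_Λ is comparable with the Poisson process up to factors a z^{N_Λ}. For ν_Λ the same
comparison follows from boundedness of the point energy.

Second summand. By comparability, log dμ_Λ/dν_Λ is at most A 2^{N_Λ} in absolute value off a null
set. Exponential moments of the number of points at most double for a short time
(`lintegral_pow_count_le`). Dynkin's formula is applied twice: to the function on Λ, and to its
generator on the R-neighbourhood of Λ, where the generator is local. This yields the second-order
estimate (`enorm_integral_sub_sub_generator_le`). The exceptional null set is harmless, as adding or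
removing a point of a typical configuration does not lead into it (`ae_generator_eq`). -/

namespace BirthDeath

variable {d : ℕ}

/-! ### Measurability of operations on configurations -/

namespace Config

theorem measurable_count {Λ : Set (E d)} (hΛ : Bornology.IsBounded Λ) (hm : MeasurableSet Λ) :
    Measurable (count Λ) := by
  have h : MeasurableSpace.comap (count Λ) ⊤ ≤ (instMeasurableSpace : MeasurableSpace (Config d)) :=
    le_iSup₂_of_le Λ hΛ (le_iSup_of_le hm le_rfl)
  exact (comap_measurable (count Λ)).mono h le_rfl

theorem measurable_of_count {α : Type*} [MeasurableSpace α] {f : α → Config d}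
    (h : ∀ Λ : Set (E d), Bornology.IsBounded Λ → MeasurableSet Λ →
      Measurable fun a => count Λ (f a)) : Measurable f := by
  rw [measurable_iff_comap_le, instMeasurableSpace]
  simp only [MeasurableSpace.comap_iSup, MeasurableSpace.comap_comp, iSup_le_iff]
  intro Λ hΛ hm
  exact (h Λ hΛ hm).comap_le

@[simp]
theorem mem_points {η : Config d} {B : Set (E d)} {hB : Bornology.IsBounded B} {x : E d} :
    x ∈ η.points hB ↔ x ∈ η.carrier ∧ x ∈ B := by
  simp [points]

theorem card_points (η : Config d) {B : Set (E d)} (hB : Bornology.IsBounded B) :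
    (η.points hB).card = η.count B := by
  rw [count, Set.ncard_eq_toFinset_card _ (η.finite_inter B hB)]
  rfl

@[simp]
theorem carrier_restrict (Λ : Set (E d)) (η : Config d) :
    (η.restrict Λ).carrier = η.carrier ∩ Λ := rfl

@[simp]
theorem carrier_add (η : Config d) (x : E d) : (η.add x).carrier = insert x η.carrier := rfl

@[simp]
theorem carrier_remove (η : Config d) (x : E d) : (η.remove x).carrier = η.carrier \ {x} := rfl

theorem count_restrict (B Λ : Set (E d)) (η : Config d) :
    count B (η.restrict Λ) = count (Λ ∩ B) η := by
  simp [count, Set.inter_assoc]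

theorem measurable_restrict {Λ : Set (E d)} (hm : MeasurableSet Λ) :
    Measurable (restrict Λ : Config d → Config d) := by
  refine measurable_of_count fun B hB hBm => ?_
  simp_rw [count_restrict]
  exact measurable_count (hB.subset Set.inter_subset_right) (hm.inter hBm)

@[simp]
theorem restrict_restrict (Λ Λ' : Set (E d)) (η : Config d) :
    (η.restrict Λ).restrict Λ' = η.restrict (Λ ∩ Λ') := by
  ext x; simp [and_assoc]

theorem add_of_mem {η : Config d} {x : E d} (h : x ∈ η.carrier) : η.add x = η := by
  ext y; simp only [carrier_add, Set.mem_insert_iff, or_iff_right_iff_imp]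
  rintro rfl; exact h

theorem restrict_add_of_mem {Λ : Set (E d)} {x : E d} (hx : x ∈ Λ) (η : Config d) :
    (η.add x).restrict Λ = (η.restrict Λ).add x := by
  ext y; simp only [carrier_restrict, carrier_add, Set.mem_inter_iff, Set.mem_insert_iff]
  constructor
  · rintro ⟨h | h, h'⟩ <;> tauto
  · rintro (rfl | h) <;> tauto

theorem restrict_add_of_notMem {Λ : Set (E d)} {x : E d} (hx : x ∉ Λ) (η : Config d) :
    (η.add x).restrict Λ = η.restrict Λ := by
  ext y; simp only [carrier_restrict, carrier_add, Set.mem_inter_iff, Set.mem_insert_iff]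
  constructor
  · rintro ⟨rfl | h, h'⟩ <;> tauto
  · tauto

theorem restrict_remove (Λ : Set (E d)) (x : E d) (η : Config d) :
    (η.remove x).restrict Λ = (η.restrict Λ).remove x := by
  ext y; simp; tauto

theorem restrict_remove_of_notMem {Λ : Set (E d)} {x : E d} (hx : x ∉ Λ) (η : Config d) :
    (η.remove x).restrict Λ = η.restrict Λ := by
  ext y; simp only [carrier_restrict, carrier_remove, Set.mem_inter_iff, Set.mem_sdiff,
    Set.mem_singleton_iff]
  constructor
  · tauto
  · rintro ⟨h, h'⟩; exact ⟨⟨h, by rintro rfl; exact hx h'⟩, h'⟩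

theorem points_restrict {Λ : Set (E d)} (hΛ : Bornology.IsBounded Λ) (η : Config d) :
    (η.restrict Λ).points hΛ = η.points hΛ := by
  ext x; simp

/-- A locally finite set is closed, so a point outside it has a neighbourhood free of it. Using only
balls with centres in a countable dense set and radii 1/(k+1) expresses membership by countably many
counts, which gives joint measurability of the relation x ∈ η. -/
theorem mem_carrier_iff_forall_ball {η : Config d} {x : E d} :
    x ∈ η.carrier ↔ ∀ k : ℕ, ∃ q : ℕ, dist x (TopologicalSpace.denseSeq (E d) q) < 1 / (k + 1) ∧
      0 < η.count (Metric.ball (TopologicalSpace.denseSeq (E d) q) (1 / (k + 1))) := by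
  have hpos : ∀ (η : Config d) (B : Set (E d)), Bornology.IsBounded B →
      (0 < η.count B ↔ (η.carrier ∩ B).Nonempty) := fun η B hB => by
    rw [count, Set.ncard_pos (η.finite_inter B hB)]
  constructor
  · intro hx k
    obtain ⟨q, hq⟩ := (TopologicalSpace.denseRange_denseSeq (E d)).exists_dist_lt x
      (Nat.one_div_pos_of_nat (α := ℝ) (n := k))
    exact ⟨q, hq, (hpos _ _ Metric.isBounded_ball).2 ⟨x, hx, hq⟩⟩
  · intro h
    by_contra hx
    have hfin : (η.carrier ∩ Metric.ball x 2).Finite := η.finite_inter _ Metric.isBounded_ball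
    have hopen : (η.carrier ∩ Metric.ball x 2)ᶜ ∈ 𝓝 x :=
      hfin.isClosed.isOpen_compl.mem_nhds fun h => hx h.1
    obtain ⟨ε, hε, hball⟩ := Metric.mem_nhds_iff.1 hopen
    -- A ball of radius 1/(k+1) whose centre is within 1/(k+1) of x lies within 2/(k+1) of x, hence
    -- the half. The cap 2 keeps it in the bounded window where η is finite.
    obtain ⟨k, hk⟩ := exists_nat_one_div_lt (half_pos (lt_min hε (zero_lt_two (α := ℝ))))
    obtain ⟨q, hq, hc⟩ := h k
    obtain ⟨y, hy, hyq⟩ := (hpos _ _ Metric.isBounded_ball).1 hc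
    have hyx : dist y x < min ε 2 := by
      have h1 := dist_triangle y (TopologicalSpace.denseSeq (E d) q) x
      rw [dist_comm (TopologicalSpace.denseSeq (E d) q) x] at h1
      have h2 : dist y (TopologicalSpace.denseSeq (E d) q) < 1 / ((k : ℝ) + 1) := hyq
      linarith
    exact hball (Metric.mem_ball.2 (hyx.trans_le (min_le_left _ _)))
      ⟨hy, hyx.trans_le (min_le_right _ _)⟩

theorem measurableSet_mem_carrier :
    MeasurableSet {p : Config d × E d | p.2 ∈ p.1.carrier} := by
  simp_rw [mem_carrier_iff_forall_ball, Set.ofPred_forall, Set.ofPred_exists, Set.ofPred_and]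
  refine MeasurableSet.iInter fun k => MeasurableSet.iUnion fun q => MeasurableSet.inter ?_ ?_
  · exact measurableSet_lt (by fun_prop) measurable_const
  · have := (measurable_count (d := d) Metric.isBounded_ball
      (Metric.isOpen_ball (x := TopologicalSpace.denseSeq (E d) q)
        (ε := 1 / ((k : ℝ) + 1))).measurableSet).comp
      (measurable_fst : Measurable (Prod.fst : Config d × E d → Config d))
    exact measurableSet_lt measurable_const this

open Classical in
theorem count_add {B : Set (E d)} (hB : Bornology.IsBounded B) (η : Config d) (x : E d) :
    count B (η.add x) = count B η + if x ∈ B ∧ x ∉ η.carrier then 1 else 0 := by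
  have hf := η.finite_inter B hB
  split_ifs with h
  · rw [count, carrier_add, Set.insert_inter_of_mem h.1,
      Set.ncard_insert_of_notMem (fun h' => h.2 h'.1) hf, count]
  · by_cases hx : x ∈ η.carrier
    · rw [add_of_mem hx, add_zero]
    · rw [count, carrier_add, Set.insert_inter_of_notMem (by tauto), count, add_zero]

open Classical in
theorem count_remove {B : Set (E d)} (hB : Bornology.IsBounded B) (η : Config d) (x : E d) :
    count B (η.remove x) = count B η - if x ∈ B ∧ x ∈ η.carrier then 1 else 0 := by
  have hf := η.finite_inter B hB
  have h0 : (η.carrier \ {x}) ∩ B = (η.carrier ∩ B) \ {x} := by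
    ext y; simp; tauto
  rw [count, carrier_remove, h0]
  split_ifs with h
  · rw [Set.ncard_sdiff_singleton_of_mem (show x ∈ η.carrier ∩ B from ⟨h.2, h.1⟩), count]
  · rw [Set.sdiff_singleton_eq_self (fun h' : x ∈ η.carrier ∩ B => h ⟨h'.2, h'.1⟩), count,
      Nat.sub_zero]

theorem measurable_add : Measurable fun p : Config d × E d => p.1.add p.2 := by
  classical
  refine measurable_of_count fun B hB hBm => ?_
  simp_rw [count_add hB]
  refine ((measurable_count hB hBm).comp measurable_fst).add ?_
  refine Measurable.ite ?_ measurable_const measurable_const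
  exact (measurable_snd hBm).inter measurableSet_mem_carrier.compl

theorem measurable_remove : Measurable fun p : Config d × E d => p.1.remove p.2 := by
  classical
  refine measurable_of_count fun B hB hBm => ?_
  simp_rw [count_remove hB]
  refine ((measurable_count hB hBm).comp measurable_fst).sub ?_
  refine Measurable.ite ?_ measurable_const measurable_const
  exact (measurable_snd hBm).inter measurableSet_mem_carrier

/-- The finite configuration formed by the entries of a tuple. -/
def ofTuple {n : ℕ} (x : Fin n → E d) : Config d :=
  ofFinite (Set.range x) (Set.finite_range x)

@[simp]
theorem carrier_ofTuple {n : ℕ} (x : Fin n → E d) : (ofTuple x).carrier = Set.range x := rfl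

theorem ofTuple_succ {n : ℕ} (x : Fin (n + 1) → E d) :
    ofTuple x = (ofTuple (fun i : Fin n => x i.succ)).add (x 0) := by
  ext y
  simp only [carrier_ofTuple, carrier_add, Set.mem_range, Set.mem_insert_iff, Fin.exists_fin_succ]
  tauto

theorem measurable_ofTuple : ∀ n : ℕ, Measurable (ofTuple : (Fin n → E d) → Config d)
  | 0 => measurable_of_countable _
  | n + 1 => by
    simp_rw [funext ofTuple_succ]
    exact measurable_add.comp (((measurable_ofTuple n).comp (by fun_prop)).prodMk (by fun_prop))

/-- The counting measure on the points of a configuration that lie in a bounded set. -/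
noncomputable def pointMeasure {Λ : Set (E d)} (hΛ : Bornology.IsBounded Λ) (η : Config d) :
    Measure (E d) :=
  ∑ x ∈ η.points hΛ, Measure.dirac x

theorem pointMeasure_apply {Λ : Set (E d)} (hΛ : Bornology.IsBounded Λ) (η : Config d)
    {s : Set (E d)} (hs : MeasurableSet s) :
    pointMeasure hΛ η s = (count (Λ ∩ s) η : ℝ≥0∞) := by
  classical
  rw [pointMeasure, Measure.finsetSum_apply]
  simp_rw [Measure.dirac_apply' _ hs, Set.indicator_apply, Pi.one_apply]
  rw [Finset.sum_ite, Finset.sum_const_zero, add_zero, Finset.sum_const, nsmul_one,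
    ← card_points η (hΛ.subset Set.inter_subset_left)]
  congr 2
  ext x; simp [and_assoc]

theorem lintegral_pointMeasure {Λ : Set (E d)} (hΛ : Bornology.IsBounded Λ) (η : Config d)
    (f : E d → ℝ≥0∞) : ∫⁻ x, f x ∂(pointMeasure hΛ η) = ∑ x ∈ η.points hΛ, f x := by
  rw [pointMeasure, lintegral_finsetSum_measure]
  simp

theorem integral_pointMeasure {Λ : Set (E d)} (hΛ : Bornology.IsBounded Λ) (η : Config d)
    (f : E d → ℝ) : ∫ x, f x ∂(pointMeasure hΛ η) = ∑ x ∈ η.points hΛ, f x := by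
  rw [pointMeasure, integral_finsetSum_measure fun _ _ => integrable_dirac (by simp)]
  simp

/-- The kernel that maps a configuration to the counting measure on its points in `Λ`. -/
noncomputable def pointKernel {Λ : Set (E d)} (hΛ : Bornology.IsBounded Λ)
    (hm : MeasurableSet Λ) : Kernel (Config d) (E d) where
  toFun := pointMeasure hΛ
  measurable' := by
    refine Measure.measurable_of_measurable_coe _ fun s hs => ?_
    simp_rw [pointMeasure_apply hΛ _ hs]
    exact (measurable_from_top (f := fun n : ℕ => (n : ℝ≥0∞))).comp
      (measurable_count (hΛ.subset Set.inter_subset_left) (hm.inter hs))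

/-- The number of points in Λ is finite but not uniformly bounded, so the kernel is cut into its
restrictions to the events N_Λ = n. -/
instance isSFiniteKernel_pointKernel {Λ : Set (E d)} (hΛ : Bornology.IsBounded Λ)
    (hm : MeasurableSet Λ) : IsSFiniteKernel (pointKernel hΛ hm) := by
  classical
  have hs : ∀ n : ℕ, MeasurableSet {η : Config d | count Λ η = n} := fun n =>
    measurable_count hΛ hm (measurableSet_singleton n)
  refine ⟨⟨fun n => Kernel.piecewise (hs n) (pointKernel hΛ hm) 0, fun n => ⟨⟨n, by simp, ?_⟩⟩, ?_⟩⟩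
  · intro η
    rw [Kernel.piecewise_apply]
    split_ifs with h
    · change pointMeasure hΛ η Set.univ ≤ _
      rw [pointMeasure_apply hΛ η .univ, Set.inter_univ, show count Λ η = n from h]
    · simp
  · ext η s hsm
    rw [Kernel.sum_apply' _ _ hsm, tsum_eq_single (count Λ η)]
    · simp [Kernel.piecewise_apply]
    · intro n hn
      rw [Kernel.piecewise_apply, if_neg (show η ∉ {η | count Λ η = n} from fun h => hn h.symm)]
      simp

theorem measurable_sum_points {Λ : Set (E d)} (hΛ : Bornology.IsBounded Λ) (hm : MeasurableSet Λ)
    {f : Config d → E d → ℝ≥0∞} (hf : Measurable (Function.uncurry f)) :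
    Measurable fun η => ∑ x ∈ η.points hΛ, f η x := by
  simp_rw [← lintegral_pointMeasure hΛ]
  exact Measurable.lintegral_kernel_prod_right (κ := pointKernel hΛ hm) hf

theorem measurable_sum_points_real {Λ : Set (E d)} (hΛ : Bornology.IsBounded Λ)
    (hm : MeasurableSet Λ) {f : Config d → E d → ℝ} (hf : Measurable (Function.uncurry f)) :
    Measurable fun η => ∑ x ∈ η.points hΛ, f η x := by
  simp_rw [← integral_pointMeasure hΛ]
  exact (StronglyMeasurable.integral_kernel_prod_right (κ := pointKernel hΛ hm)
    hf.stronglyMeasurable).measurable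

end Config

/-! ### Integration against the Poisson process -/

open Config

/-- Lebesgue measure on `Λ^n`. -/
noncomputable def tupleMeasure (Λ : Set (E d)) (n : ℕ) : Measure (Fin n → E d) :=
  Measure.pi fun _ : Fin n => (volume : Measure (E d)).restrict Λ

instance sigmaFinite_tupleMeasure (Λ : Set (E d)) (n : ℕ) : SigmaFinite (tupleMeasure Λ n) := by
  unfold tupleMeasure; infer_instance

theorem tupleMeasure_univ (Λ : Set (E d)) (n : ℕ) :
    tupleMeasure Λ n Set.univ = volume Λ ^ n := by
  simp [tupleMeasure, Measure.pi_univ]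

theorem measurePreserving_succAbove (Λ : Set (E d)) {n : ℕ} (i : Fin (n + 1)) :
    MeasurePreserving (MeasurableEquiv.piFinSuccAbove (fun _ => E d) i) (tupleMeasure Λ (n + 1))
      (((volume : Measure (E d)).restrict Λ).prod (tupleMeasure Λ n)) :=
  measurePreserving_piFinSuccAbove (fun _ : Fin (n + 1) => (volume : Measure (E d)).restrict Λ) i

theorem lintegral_tupleMeasure_succ (Λ : Set (E d)) {n : ℕ} (i : Fin (n + 1))
    {f : E d × (Fin n → E d) → ℝ≥0∞} (hf : Measurable f) :
    ∫⁻ x, f (x i, fun j => x (i.succAbove j)) ∂(tupleMeasure Λ (n + 1)) =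
      ∫⁻ y, (∫⁻ a in Λ, f (a, y)) ∂(tupleMeasure Λ n) := by
  rw [← lintegral_prod_symm' _ hf, ← (measurePreserving_succAbove Λ i).lintegral_comp hf]
  rfl

theorem ae_mem_tupleMeasure {Λ : Set (E d)} (hm : MeasurableSet Λ) (n : ℕ) :
    ∀ᵐ x ∂(tupleMeasure Λ n), ∀ i, x i ∈ Λ := by
  rw [ae_all_iff]
  intro i
  exact (Measure.quasiMeasurePreserving_eval
    (fun _ : Fin n => (volume : Measure (E d)).restrict Λ) i).ae (ae_restrict_mem hm)

theorem ae_ne_tupleMeasure [NullSingletonClass (volume : Measure (E d))] (Λ : Set (E d)) {n : ℕ}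
    (i : Fin (n + 1)) :
    ∀ᵐ x ∂(tupleMeasure Λ (n + 1)), ∀ j, x i ≠ x (i.succAbove j) := by
  rw [ae_all_iff]
  intro j
  have hms : MeasurableSet {p : E d × (Fin n → E d) | p.1 = p.2 j} :=
    measurableSet_eq_fun (by fun_prop) (by fun_prop)
  have h := lintegral_tupleMeasure_succ Λ i ((measurable_const (a := (1 : ℝ≥0∞))).indicator hms)
  have h0 : ∀ y : Fin n → E d, ∫⁻ a in Λ, {p : E d × (Fin n → E d) | p.1 = p.2 j}.indicator
      (fun _ => (1 : ℝ≥0∞)) (a, y) = 0 := by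
    intro y
    have : ∀ a, {p : E d × (Fin n → E d) | p.1 = p.2 j}.indicator (fun _ => (1 : ℝ≥0∞)) (a, y) =
        ({y j} : Set (E d)).indicator 1 a := by
      intro a; simp [Set.indicator_apply]
    simp_rw [this]
    rw [lintegral_indicator_one (measurableSet_singleton _)]
    exact measure_singleton _
  simp_rw [h0, lintegral_zero] at h
  have hcomp : Measurable fun x : Fin (n + 1) → E d => (x i, fun j => x (i.succAbove j)) := by
    fun_prop
  have h' := (lintegral_eq_zero_iff
    (((measurable_const (a := (1 : ℝ≥0∞))).indicator hms).comp hcomp)).1 h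
  filter_upwards [h'] with x hx hxe
  simp [hxe] at hx

/-- Diagonals are null because Lebesgue measure has no atoms. Hence on the n-th layer of the Poisson
process the number of points is almost surely n. -/
theorem ae_injective_tupleMeasure [NullSingletonClass (volume : Measure (E d))] (Λ : Set (E d)) (n : ℕ) :
    ∀ᵐ x ∂(tupleMeasure Λ n), Function.Injective x := by
  cases n with
  | zero => exact Eventually.of_forall fun x => Function.injective_of_subsingleton x
  | succ n =>
    have : ∀ᵐ x ∂(tupleMeasure Λ (n + 1)), ∀ i : Fin (n + 1), ∀ j, x i ≠ x (i.succAbove j) :=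
      ae_all_iff.2 fun i => ae_ne_tupleMeasure Λ i
    filter_upwards [this] with x hx i k hik
    by_contra hne
    obtain ⟨j, rfl⟩ := Fin.exists_succAbove_eq (Ne.symm hne)
    exact hx i j hik

theorem count_ofTuple {Λ : Set (E d)} {n : ℕ} {x : Fin n → E d} (hx : Function.Injective x)
    (hxΛ : ∀ i, x i ∈ Λ) : count Λ (ofTuple x) = n := by
  rw [count, carrier_ofTuple, Set.inter_eq_left.2 (Set.range_subset_iff.2 hxΛ),
    ← Set.image_univ, Set.ncard_image_of_injective _ hx, Set.ncard_univ, Nat.card_fin]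

theorem remove_ofTuple {n : ℕ} {x : Fin (n + 1) → E d} (hx : Function.Injective x)
    (i : Fin (n + 1)) : (ofTuple x).remove (x i) = ofTuple fun j => x (i.succAbove j) := by
  ext y
  simp only [carrier_remove, carrier_ofTuple, Set.mem_sdiff, Set.mem_range, Set.mem_singleton_iff]
  constructor
  · rintro ⟨⟨k, rfl⟩, hk⟩
    obtain ⟨j, rfl⟩ := Fin.exists_succAbove_eq (fun h : k = i => hk (h ▸ rfl))
    exact ⟨j, rfl⟩
  · rintro ⟨j, rfl⟩
    exact ⟨⟨_, rfl⟩, fun h => Fin.succAbove_ne i j (hx h)⟩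

theorem sum_points_ofTuple {Λ : Set (E d)} (hΛ : Bornology.IsBounded Λ) {n : ℕ} {x : Fin n → E d}
    (hx : Function.Injective x) (hxΛ : ∀ i, x i ∈ Λ) (f : E d → ℝ≥0∞) :
    ∑ y ∈ (ofTuple x).points hΛ, f y = ∑ i, f (x i) := by
  classical
  have : (ofTuple x).points hΛ = Finset.univ.image x := by
    ext y; simp only [mem_points, carrier_ofTuple, Set.mem_range, Finset.mem_image,
      Finset.mem_univ, true_and, and_iff_left_iff_imp]
    rintro ⟨i, rfl⟩; exact hxΛ i
  rw [this, Finset.sum_image fun a _ b _ h => hx h]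

/-- The normalizing constant `e^{-|Λ|}` of the Poisson process. -/
noncomputable def poissonConst (Λ : Set (E d)) : ℝ≥0∞ :=
  ENNReal.ofReal (Real.exp (-(volume Λ).toReal))

theorem poissonConst_pos (Λ : Set (E d)) : 0 < poissonConst Λ :=
  ENNReal.ofReal_pos.2 (Real.exp_pos _)

theorem poissonConst_ne_top (Λ : Set (E d)) : poissonConst Λ ≠ ∞ := ENNReal.ofReal_ne_top

theorem lintegral_poisson (Λ : Set (E d)) {F : Config d → ℝ≥0∞} (hF : Measurable F) :
    ∫⁻ η, F η ∂(poisson Λ) = poissonConst Λ *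
      ∑' n : ℕ, ((n.factorial : ℝ≥0∞)⁻¹ * ∫⁻ x, F (ofTuple x) ∂(tupleMeasure Λ n)) := by
  rw [poisson, lintegral_smul_measure, lintegral_sum_measure]
  simp_rw [lintegral_smul_measure, smul_eq_mul]
  congr 2
  ext n
  congr 1
  exact lintegral_map hF (measurable_ofTuple n)

theorem lintegral_poisson_mul_count [NullSingletonClass (volume : Measure (E d))] {Λ : Set (E d)}
    (hΛ : Bornology.IsBounded Λ) (hm : MeasurableSet Λ) (W : ℕ → ℝ≥0∞) {F : Config d → ℝ≥0∞}
    (hF : Measurable F) :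
    ∫⁻ η, W (count Λ η) * F η ∂(poisson Λ) = poissonConst Λ *
      ∑' n : ℕ, ((n.factorial : ℝ≥0∞)⁻¹ * (W n * ∫⁻ x, F (ofTuple x) ∂(tupleMeasure Λ n))) := by
  have hW : Measurable fun η : Config d => W (count Λ η) :=
    (measurable_from_top (f := W)).comp (measurable_count hΛ hm)
  rw [lintegral_poisson Λ (F := fun η => W (count Λ η) * F η) (hW.mul hF)]
  congr 2
  ext n
  congr 1
  rw [← lintegral_const_mul (f := fun x => F (ofTuple x)) _ (hF.comp (measurable_ofTuple n))]
  refine lintegral_congr_ae ?_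
  filter_upwards [ae_injective_tupleMeasure Λ n, ae_mem_tupleMeasure hm n] with x hx hxΛ
  rw [count_ofTuple hx hxΛ]

theorem measurable_weight {Λ : Set (E d)} (hΛ : Bornology.IsBounded Λ) (hm : MeasurableSet Λ)
    (W : ℕ → ℝ≥0∞) : Measurable fun η : Config d => W (count Λ η) :=
  (measurable_from_top (f := W)).comp (measurable_count hΛ hm)

theorem lintegral_poisson_count [NullSingletonClass (volume : Measure (E d))] {Λ : Set (E d)}
    (hΛ : Bornology.IsBounded Λ) (hm : MeasurableSet Λ) (W : ℕ → ℝ≥0∞) :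
    ∫⁻ η, W (count Λ η) ∂(poisson Λ) = poissonConst Λ *
      ∑' n : ℕ, ((n.factorial : ℝ≥0∞)⁻¹ * (W n * volume Λ ^ n)) := by
  have := lintegral_poisson_mul_count hΛ hm W (F := fun _ => 1) measurable_const
  simpa [tupleMeasure_univ] using this

theorem lintegral_poisson_pow_count_lt_top [NullSingletonClass (volume : Measure (E d))] {Λ : Set (E d)}
    (hΛ : Bornology.IsBounded Λ) (hm : MeasurableSet Λ) (y : ℝ≥0) :
    ∫⁻ η, (y : ℝ≥0∞) ^ count Λ η ∂(poisson Λ) < ∞ := by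
  rw [lintegral_poisson_count hΛ hm fun n => (y : ℝ≥0∞) ^ n]
  refine ENNReal.mul_lt_top (poissonConst_ne_top Λ).lt_top ?_
  lift volume Λ to ℝ≥0 using hΛ.measure_lt_top.ne with v
  have hs : Summable fun n : ℕ => ((n.factorial : ℝ≥0)⁻¹ * (y ^ n * v ^ n)) := by
    rw [← NNReal.summable_coe]
    refine (Real.summable_pow_div_factorial ((y : ℝ) * v)).congr fun n => ?_
    push_cast; rw [mul_pow]; ring
  have := ENNReal.tsum_coe_ne_top_iff_summable.2 hs
  refine lt_of_le_of_lt (le_of_eq ?_) this.lt_top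
  refine tsum_congr fun n => ?_
  rw [ENNReal.coe_mul, ENNReal.coe_inv (by positivity)]
  push_cast; rfl

theorem isFiniteMeasure_poisson [NullSingletonClass (volume : Measure (E d))] {Λ : Set (E d)}
    (hΛ : Bornology.IsBounded Λ) (hm : MeasurableSet Λ) : IsFiniteMeasure (poisson Λ) := by
  constructor
  simpa using lintegral_poisson_pow_count_lt_top hΛ hm 1

/-- Mecke formula: a Lebesgue point added to an n-tuple makes an (n+1)-tuple, and the ratio
(n+1)!/n! of the normalisations is the number of points of the new configuration. At N_Λ = 0 the
truncated index `0 - 1` is harmless because of the factor N_Λ. -/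
theorem lintegral_poisson_birth [NullSingletonClass (volume : Measure (E d))] {Λ : Set (E d)}
    (hΛ : Bornology.IsBounded Λ) (hm : MeasurableSet Λ) (W : ℕ → ℝ≥0∞) {F : Config d → ℝ≥0∞}
    (hF : Measurable F) :
    ∫⁻ η, W (count Λ η) * (∫⁻ x in Λ, F (η.add x)) ∂(poisson Λ) =
      ∫⁻ η, (count Λ η * W (count Λ η - 1)) * F η ∂(poisson Λ) := by
  have hG : Measurable fun η : Config d => ∫⁻ x in Λ, F (η.add x) :=
    (hF.comp measurable_add).lintegral_prod_right'
  rw [lintegral_poisson_mul_count hΛ hm W hG,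
    lintegral_poisson_mul_count hΛ hm (fun n => n * W (n - 1)) hF]
  congr 1
  rw [tsum_eq_zero_add' ENNReal.summable (f := fun n : ℕ => ((n.factorial : ℝ≥0∞)⁻¹ *
    ((n * W (n - 1)) * ∫⁻ x, F (ofTuple x) ∂(tupleMeasure Λ n))))]
  simp only [Nat.cast_zero, zero_mul, mul_zero, zero_add]
  refine tsum_congr fun n => ?_
  have h1 : ∫⁻ y, (∫⁻ a in Λ, F ((ofTuple y).add a)) ∂(tupleMeasure Λ n) =
      ∫⁻ x, F (ofTuple x) ∂(tupleMeasure Λ (n + 1)) := by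
    have hm' : Measurable fun p : E d × (Fin n → E d) => F ((ofTuple p.2).add p.1) :=
      hF.comp (measurable_add.comp (((measurable_ofTuple n).comp measurable_snd).prodMk
        measurable_fst))
    rw [← lintegral_tupleMeasure_succ Λ 0 hm']
    simp_rw [Fin.succAbove_zero, ← ofTuple_succ]
  rw [h1, Nat.add_sub_cancel, Nat.factorial_succ]
  have hn : ((n + 1 : ℕ) : ℝ≥0∞) ≠ 0 := by simp
  rw [Nat.cast_mul, ENNReal.mul_inv (Or.inl hn) (Or.inl (ENNReal.natCast_ne_top _))]
  calc _ = (((n + 1 : ℕ) : ℝ≥0∞)⁻¹ * ((n + 1 : ℕ) : ℝ≥0∞)) * ((n.factorial : ℝ≥0∞)⁻¹ *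
        (W n * ∫⁻ x, F (ofTuple x) ∂(tupleMeasure Λ (n + 1)))) := by
        rw [ENNReal.inv_mul_cancel hn (ENNReal.natCast_ne_top _), one_mul]
    _ = _ := by ring

/-- Mecke formula read backwards: the removed coordinate integrates out to the volume of Λ, and the
n+1 choices of the removed point cancel against the factorial. -/
theorem lintegral_poisson_death [NullSingletonClass (volume : Measure (E d))] {Λ : Set (E d)}
    (hΛ : Bornology.IsBounded Λ) (hm : MeasurableSet Λ) (W : ℕ → ℝ≥0∞) {F : Config d → ℝ≥0∞}
    (hF : Measurable F) :
    ∫⁻ η, W (count Λ η) * ∑ x ∈ η.points hΛ, F (η.remove x) ∂(poisson Λ) =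
      ∫⁻ η, (volume Λ * W (count Λ η + 1)) * F η ∂(poisson Λ) := by
  have hG : Measurable fun η : Config d => ∑ x ∈ η.points hΛ, F (η.remove x) :=
    measurable_sum_points hΛ hm (hF.comp measurable_remove)
  rw [lintegral_poisson_mul_count hΛ hm W hG,
    lintegral_poisson_mul_count hΛ hm (fun n => volume Λ * W (n + 1)) hF]
  congr 1
  rw [tsum_eq_zero_add' ENNReal.summable]
  have h0 : ∀ x : Fin 0 → E d, ∑ y ∈ (ofTuple x).points hΛ, F ((ofTuple x).remove y) = 0 := by
    intro x
    rw [sum_points_ofTuple hΛ (Function.injective_of_subsingleton x) fun i => i.elim0]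
    simp
  simp only [h0, lintegral_zero, mul_zero, zero_add]
  refine tsum_congr fun n => ?_
  have h1 : ∫⁻ x, ∑ y ∈ (ofTuple x).points hΛ, F ((ofTuple x).remove y)
      ∂(tupleMeasure Λ (n + 1)) =
      (n + 1 : ℕ) * (volume Λ * ∫⁻ x, F (ofTuple x) ∂(tupleMeasure Λ n)) := by
    have h2 : ∫⁻ x, ∑ y ∈ (ofTuple x).points hΛ, F ((ofTuple x).remove y)
        ∂(tupleMeasure Λ (n + 1)) =
        ∫⁻ x, ∑ i : Fin (n + 1), F (ofTuple fun j => x (i.succAbove j))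
          ∂(tupleMeasure Λ (n + 1)) := by
      refine lintegral_congr_ae ?_
      filter_upwards [ae_injective_tupleMeasure Λ (n + 1), ae_mem_tupleMeasure hm (n + 1)]
        with x hx hxΛ
      rw [sum_points_ofTuple hΛ hx hxΛ]
      exact Finset.sum_congr rfl fun i _ => by rw [remove_ofTuple hx]
    rw [h2, lintegral_finsetSum]
    · have h3 : ∀ i : Fin (n + 1), ∫⁻ x, F (ofTuple fun j => x (i.succAbove j))
          ∂(tupleMeasure Λ (n + 1)) = volume Λ * ∫⁻ x, F (ofTuple x) ∂(tupleMeasure Λ n) := by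
        intro i
        have := lintegral_tupleMeasure_succ Λ i (f := fun p => F (ofTuple p.2))
          (hF.comp ((measurable_ofTuple n).comp measurable_snd))
        simp only at this
        rw [this]
        simp_rw [lintegral_const, Measure.restrict_apply_univ, mul_comm _ (volume Λ)]
        rw [lintegral_const_mul (f := fun x => F (ofTuple x)) _
          (hF.comp (measurable_ofTuple n))]
      rw [Finset.sum_congr rfl fun i _ => h3 i]
      simp
    · intro i _
      exact hF.comp ((measurable_ofTuple n).comp (by fun_prop))
  rw [h1, Nat.factorial_succ]
  have hn : ((n + 1 : ℕ) : ℝ≥0∞) ≠ 0 := by simp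
  rw [Nat.cast_mul, ENNReal.mul_inv (Or.inl hn) (Or.inl (ENNReal.natCast_ne_top _))]
  calc _ = (((n + 1 : ℕ) : ℝ≥0∞)⁻¹ * ((n + 1 : ℕ) : ℝ≥0∞)) * ((n.factorial : ℝ≥0∞)⁻¹ *
        (W (n + 1) * (volume Λ * ∫⁻ x, F (ofTuple x) ∂(tupleMeasure Λ n)))) := by ring
    _ = _ := by rw [ENNReal.inv_mul_cancel hn (ENNReal.natCast_ne_top _), one_mul]; ring

/-! ### The dominating operator, its adjoint, and the growth of their iterates -/

/-- A positive operator that dominates the generator: each rate is replaced by an upper bound and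
gains and losses are added up. -/
noncomputable def domOp (c : ℝ≥0) {Λ : Set (E d)} (hΛ : Bornology.IsBounded Λ)
    (F : Config d → ℝ≥0∞) (η : Config d) : ℝ≥0∞ :=
  c * (∫⁻ x in Λ, F (η.add x)) + ∑ x ∈ η.points hΛ, F (η.remove x) +
    (c * volume Λ + count Λ η) * F η

/-- The adjoint of `domOp` with respect to the Poisson process, on functions of the number of
points. -/
noncomputable def dualOp (c : ℝ≥0) (v : ℝ≥0∞) (W : ℕ → ℝ≥0∞) (n : ℕ) : ℝ≥0∞ :=
  c * (n * W (n - 1)) + v * W (n + 1) + (c * v + n) * W n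

section domOp

variable (c : ℝ≥0) {Λ : Set (E d)} (hΛ : Bornology.IsBounded Λ)

theorem measurable_domOp (hm : MeasurableSet Λ) {F : Config d → ℝ≥0∞} (hF : Measurable F) :
    Measurable (domOp c hΛ F) := by
  unfold domOp
  have h1 : Measurable fun η : Config d => ∫⁻ x in Λ, F (η.add x) :=
    (hF.comp measurable_add).lintegral_prod_right'
  have h2 : Measurable fun η : Config d => ∑ x ∈ η.points hΛ, F (η.remove x) :=
    measurable_sum_points hΛ hm (hF.comp measurable_remove)
  have h3 : Measurable fun η : Config d => (count Λ η : ℝ≥0∞) :=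
    measurable_weight hΛ hm fun n => (n : ℝ≥0∞)
  fun_prop

theorem measurable_domOp_iterate (hm : MeasurableSet Λ) {F : Config d → ℝ≥0∞} (hF : Measurable F)
    (k : ℕ) : Measurable ((domOp c hΛ)^[k] F) := by
  induction k with
  | zero => exact hF
  | succ k ih =>
    rw [Function.iterate_succ_apply']
    exact measurable_domOp c hΛ hm ih

theorem domOp_mono {F G : Config d → ℝ≥0∞} (h : F ≤ G) : domOp c hΛ F ≤ domOp c hΛ G := by
  intro η
  unfold domOp
  gcongr with x y hy
  · exact h _
  · exact h _
  · exact h _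

theorem domOp_iterate_mono {F G : Config d → ℝ≥0∞} (h : F ≤ G) (k : ℕ) :
    (domOp c hΛ)^[k] F ≤ (domOp c hΛ)^[k] G :=
  (show Monotone (domOp c hΛ) from fun _ _ => domOp_mono c hΛ).iterate k h

/-- This is the reason for replacing the birth rate by a constant: the true rate at a point of Λ
depends on points outside Λ, so the generator would enlarge the region of dependence at each
iteration. -/
theorem domOp_restrict (hm : MeasurableSet Λ) {F : Config d → ℝ≥0∞}
    (hF : ∀ η, F (η.restrict Λ) = F η) (η : Config d) :
    domOp c hΛ F (η.restrict Λ) = domOp c hΛ F η := by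
  unfold domOp
  congr 1
  · congr 1
    · congr 1
      refine setLIntegral_congr_fun hm fun x hx => ?_
      rw [← restrict_add_of_mem hx, hF]
    · rw [points_restrict]
      exact Finset.sum_congr rfl fun x _ => by rw [← restrict_remove, hF]
  · rw [hF, count_restrict, Set.inter_self]

theorem domOp_iterate_restrict (hm : MeasurableSet Λ) {F : Config d → ℝ≥0∞}
    (hF : ∀ η, F (η.restrict Λ) = F η) (k : ℕ) (η : Config d) :
    (domOp c hΛ)^[k] F (η.restrict Λ) = (domOp c hΛ)^[k] F η := by
  induction k generalizing η with
  | zero => exact hF η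
  | succ k ih =>
    simp_rw [Function.iterate_succ_apply']
    exact domOp_restrict c hΛ hm ih η

/-- The birth term turns into a death term for the weight, and conversely, by the two Mecke
formulas; the loss terms are multiplications. -/
theorem lintegral_poisson_domOp [NullSingletonClass (volume : Measure (E d))]
    (hm : MeasurableSet Λ) (W : ℕ → ℝ≥0∞) {F : Config d → ℝ≥0∞} (hF : Measurable F) :
    ∫⁻ η, W (count Λ η) * domOp c hΛ F η ∂(poisson Λ) =
      ∫⁻ η, dualOp c (volume Λ) W (count Λ η) * F η ∂(poisson Λ) := by
  have h1 : Measurable fun η : Config d => ∫⁻ x in Λ, F (η.add x) :=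
    (hF.comp measurable_add).lintegral_prod_right'
  have h2 : Measurable fun η : Config d => ∑ x ∈ η.points hΛ, F (η.remove x) :=
    measurable_sum_points hΛ hm (hF.comp measurable_remove)
  have hw : ∀ W : ℕ → ℝ≥0∞, Measurable fun η : Config d => W (count Λ η) :=
    measurable_weight hΛ hm
  have e1 := lintegral_poisson_birth hΛ hm W hF
  have e2 := lintegral_poisson_death hΛ hm W hF
  have s1 : ∀ η : Config d, W (count Λ η) * domOp c hΛ F η =
      c * (W (count Λ η) * ∫⁻ x in Λ, F (η.add x)) +
      W (count Λ η) * ∑ x ∈ η.points hΛ, F (η.remove x) +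
      ((c * volume Λ + count Λ η) * W (count Λ η)) * F η := by
    intro η; unfold domOp; ring
  have s2 : ∀ η : Config d, dualOp c (volume Λ) W (count Λ η) * F η =
      c * ((count Λ η * W (count Λ η - 1)) * F η) + (volume Λ * W (count Λ η + 1)) * F η +
      ((c * volume Λ + count Λ η) * W (count Λ η)) * F η := by
    intro η; unfold dualOp; ring
  have m1 : Measurable fun η : Config d => W (count Λ η) * ∫⁻ x in Λ, F (η.add x) :=
    (hw W).mul h1
  have m2 : Measurable fun η : Config d =>
      W (count Λ η) * ∑ x ∈ η.points hΛ, F (η.remove x) := (hw W).mul h2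
  have m1' : Measurable fun η : Config d => (count Λ η * W (count Λ η - 1)) * F η :=
    (hw fun n => n * W (n - 1)).mul hF
  have m2' : Measurable fun η : Config d => (volume Λ * W (count Λ η + 1)) * F η :=
    (hw fun n => volume Λ * W (n + 1)).mul hF
  have m3 : Measurable fun η : Config d => ((c * volume Λ + count Λ η) * W (count Λ η)) * F η :=
    (hw fun n => (c * volume Λ + n) * W n).mul hF
  simp_rw [s1, s2]
  rw [lintegral_add_right _ m3, lintegral_add_right _ m3,
    lintegral_add_right _ m2, lintegral_add_right _ m2', lintegral_const_mul _ m1,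
    lintegral_const_mul _ m1', ← e1, ← e2]

theorem lintegral_poisson_domOp_iterate [NullSingletonClass (volume : Measure (E d))]
    (hm : MeasurableSet Λ) (W : ℕ → ℝ≥0∞) {F : Config d → ℝ≥0∞} (hF : Measurable F) (k : ℕ) :
    ∫⁻ η, W (count Λ η) * (domOp c hΛ)^[k] F η ∂(poisson Λ) =
      ∫⁻ η, (dualOp c (volume Λ))^[k] W (count Λ η) * F η ∂(poisson Λ) := by
  induction k generalizing W with
  | zero => rfl
  | succ k ih =>
    rw [Function.iterate_succ_apply', lintegral_poisson_domOp c hΛ hm W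
      (measurable_domOp_iterate c hΛ hm hF k), ih, ← Function.iterate_succ_apply]

theorem domOp_weight_le {W : ℕ → ℝ≥0∞} (hW : Monotone W) (η : Config d) :
    domOp c hΛ (fun η => W (count Λ η)) η ≤
      c * volume Λ * W (count Λ η + 1) + (c * volume Λ + 2 * count Λ η) * W (count Λ η) := by
  have h1 : (∫⁻ x in Λ, W (count Λ (η.add x))) ≤ volume Λ * W (count Λ η + 1) := by
    calc _ ≤ ∫⁻ x in Λ, W (count Λ η + 1) := by
          refine lintegral_mono fun x => hW ?_
          rw [count_add hΛ]
          split_ifs <;> omega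
      _ = _ := by simp [mul_comm]
  have h2 : ∑ x ∈ η.points hΛ, W (count Λ (η.remove x)) ≤ count Λ η * W (count Λ η) := by
    rw [← card_points η hΛ, ← nsmul_eq_mul]
    refine Finset.sum_le_card_nsmul _ _ _ fun x _ => hW ?_
    rw [count_remove hΛ, card_points]
    exact Nat.sub_le _ _
  calc _ ≤ c * (volume Λ * W (count Λ η + 1)) + count Λ η * W (count Λ η) +
        (c * volume Λ + count Λ η) * W (count Λ η) := by
        unfold domOp; gcongr
    _ = _ := by ring

theorem domOp_pow_count_le {A y : ℝ≥0} (hy : 1 ≤ y) (η : Config d) :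
    domOp c hΛ (fun η => A * (y : ℝ≥0∞) ^ count Λ η) η ≤
      (A * (c * volume Λ * (y + 1) + 2)) * (2 * y : ℝ≥0∞) ^ count Λ η := by
  have hy' : (1 : ℝ≥0∞) ≤ y := by exact_mod_cast hy
  have hW : Monotone fun n : ℕ => A * (y : ℝ≥0∞) ^ n := fun m n h => by
    simp only; gcongr
  refine (domOp_weight_le c hΛ hW η).trans ?_
  generalize count Λ η = n
  -- The factor N_Λ from the death rate is absorbed by 2^{N_Λ}, which is why the base doubles.
  have h1 : (1 : ℝ≥0∞) ≤ 2 ^ n := one_le_pow₀ (by norm_num)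
  have h2 : (n : ℝ≥0∞) ≤ 2 ^ n := by exact_mod_cast (Nat.lt_two_pow_self (n := n)).le
  rw [mul_pow]
  calc _ = (A * (c * volume Λ * (y + 1) * 1 + 2 * n)) * (y : ℝ≥0∞) ^ n := by ring
    _ ≤ (A * (c * volume Λ * (y + 1) * 2 ^ n + 2 * 2 ^ n)) * (y : ℝ≥0∞) ^ n := by gcongr
    _ = _ := by ring

end domOp

/-- A constant that governs the growth of the iterates of `domOp` and `dualOp`. -/
noncomputable def growthConst (c : ℝ≥0) (v : ℝ≥0∞) : ℝ≥0∞ := 2 * c * v + c + v + 2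

/-- The rising factorial (n+1)⋯(n+k) is stable under the operations in the operators: the shift to
n+1, multiplication by a constant, and multiplication by n. Each raises k by at most one. -/
theorem ascFactorial_le_succ (n k : ℕ) :
    (n + 2).ascFactorial k ≤ (n + 1).ascFactorial (k + 1) ∧
    (n + 1).ascFactorial k ≤ (n + 1).ascFactorial (k + 1) ∧
    n * (n + 1).ascFactorial k ≤ (n + 1).ascFactorial (k + 1) := by
  have h : (n + 1).ascFactorial (k + 1) = (n + 1 + k) * (n + 1).ascFactorial k :=
    Nat.ascFactorial_succ
  have h' : (n + 1).ascFactorial (k + 1) = (n + 1) * (n + 2).ascFactorial k := by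
    rw [h]; exact (Nat.succ_ascFactorial (n + 1) k).symm
  refine ⟨?_, ?_, ?_⟩
  · rw [h']; exact Nat.le_mul_of_pos_left _ (by omega)
  · rw [h]; exact Nat.le_mul_of_pos_left _ (by omega)
  · rw [h]; exact Nat.mul_le_mul (by omega) le_rfl

theorem ascFactorial_le_factorial_mul_two_pow (n k : ℕ) :
    (n + 1).ascFactorial k ≤ k.factorial * 2 ^ (n + k) := by
  rw [Nat.ascFactorial_eq_factorial_mul_choose]
  exact Nat.mul_le_mul le_rfl (Nat.choose_le_two_pow _ _)

theorem dualOp_mono (c : ℝ≥0) (v : ℝ≥0∞) {W W' : ℕ → ℝ≥0∞} (h : W ≤ W') :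
    dualOp c v W ≤ dualOp c v W' := by
  intro n
  unfold dualOp
  gcongr <;> exact h _

/-- One application costs a constant, a factor of order n + k and at most one more factor z. The
rising factorial is at most k! 2^{n+k}, so division by k! leaves a geometric sequence in k. -/
theorem dualOp_iterate_pow_le (c : ℝ≥0) (v : ℝ≥0∞) {z : ℝ≥0} (hz : 1 ≤ z) (k n : ℕ) :
    (dualOp c v)^[k] (fun n => (z : ℝ≥0∞) ^ n) n ≤
      growthConst c v ^ k * (n + 1).ascFactorial k * (z : ℝ≥0∞) ^ (n + k) := by
  have hz' : (1 : ℝ≥0∞) ≤ z := by exact_mod_cast hz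
  induction k generalizing n with
  | zero => simp
  | succ k ih =>
    rw [Function.iterate_succ_apply']
    refine (dualOp_mono c v ih n).trans ?_
    obtain ⟨h1, h2, h3⟩ := ascFactorial_le_succ n k
    have h0 : n * (n - 1 + 1).ascFactorial k ≤ (n + 1).ascFactorial (k + 1) :=
      (Nat.mul_le_mul le_rfl (Nat.ascFactorial_le k (by omega))).trans h3
    set a := growthConst c v with ha
    set B : ℝ≥0∞ := (((n + 1).ascFactorial (k + 1) : ℕ) : ℝ≥0∞) with hB
    have h0' : (n : ℝ≥0∞) * ((n - 1 + 1).ascFactorial k : ℕ) ≤ B := by rw [hB]; exact_mod_cast h0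
    have h1' : (((n + 2).ascFactorial k : ℕ) : ℝ≥0∞) ≤ B := by rw [hB]; exact_mod_cast h1
    have h2' : (((n + 1).ascFactorial k : ℕ) : ℝ≥0∞) ≤ B := by rw [hB]; exact_mod_cast h2
    have h3' : (n : ℝ≥0∞) * ((n + 1).ascFactorial k : ℕ) ≤ B := by rw [hB]; exact_mod_cast h3
    have p0 : (z : ℝ≥0∞) ^ (n - 1 + k) ≤ (z : ℝ≥0∞) ^ (n + (k + 1)) :=
      pow_le_pow_right₀ hz' (by omega)
    have p1 : (z : ℝ≥0∞) ^ (n + 1 + k) = (z : ℝ≥0∞) ^ (n + (k + 1)) := by congr 1; omega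
    have p2 : (z : ℝ≥0∞) ^ (n + k) ≤ (z : ℝ≥0∞) ^ (n + (k + 1)) :=
      pow_le_pow_right₀ hz' (by omega)
    set Z := (z : ℝ≥0∞) ^ (n + (k + 1))
    unfold dualOp
    calc _ = a ^ k * (c * (n * ((n - 1 + 1).ascFactorial k : ℕ)) * (z : ℝ≥0∞) ^ (n - 1 + k) +
          v * ((n + 2).ascFactorial k : ℕ) * (z : ℝ≥0∞) ^ (n + 1 + k) +
          (c * v * ((n + 1).ascFactorial k : ℕ) + n * ((n + 1).ascFactorial k : ℕ)) *
            (z : ℝ≥0∞) ^ (n + k)) := by ring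
      _ ≤ a ^ k * (c * B * Z + v * B * Z + (c * v * B + B) * Z) := by
          rw [p1]; gcongr
      _ = a ^ k * (c + v + c * v + 1) * B * Z := by ring
      _ ≤ a ^ k * a * B * Z := by
          gcongr
          rw [ha, growthConst]
          calc (c : ℝ≥0∞) + v + c * v + 1 ≤ (c + v + c * v + 1) + (c * v + 1) := le_self_add
            _ = _ := by ring
      _ = _ := by ring

theorem domOp_iterate_one_le (c : ℝ≥0) {Λ : Set (E d)} (hΛ : Bornology.IsBounded Λ) (k : ℕ)
    (η : Config d) :
    (domOp c hΛ)^[k] (fun _ => 1) η ≤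
      growthConst c (volume Λ) ^ k * (k.factorial * 2 ^ k) * 2 ^ count Λ η := by
  -- The induction is run with the rising factorial, which is stable under the operator; the cruder
  -- bound k! 2^{n+k} is used only at the end.
  have key : ∀ k η, (domOp c hΛ)^[k] (fun _ => 1) η ≤
      growthConst c (volume Λ) ^ k * ((count Λ η + 1).ascFactorial k : ℕ) := by
    intro k
    induction k with
    | zero => simp
    | succ k ih =>
      intro η
      rw [Function.iterate_succ_apply']
      refine (domOp_mono c hΛ ih η).trans ?_
      have hmono : Monotone fun n : ℕ =>
          growthConst c (volume Λ) ^ k * ((n + 1).ascFactorial k : ℕ) := by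
        intro m n h
        simp only
        gcongr
      refine (domOp_weight_le c hΛ hmono η).trans ?_
      obtain ⟨h1, h2, h3⟩ := ascFactorial_le_succ (count Λ η) k
      generalize count Λ η = n at *
      set a := growthConst c (volume Λ) with ha
      set B : ℝ≥0∞ := (((n + 1).ascFactorial (k + 1) : ℕ) : ℝ≥0∞) with hB
      have h1' : (((n + 2).ascFactorial k : ℕ) : ℝ≥0∞) ≤ B := by rw [hB]; exact_mod_cast h1
      have h2' : (((n + 1).ascFactorial k : ℕ) : ℝ≥0∞) ≤ B := by rw [hB]; exact_mod_cast h2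
      have h3' : (n : ℝ≥0∞) * ((n + 1).ascFactorial k : ℕ) ≤ B := by rw [hB]; exact_mod_cast h3
      calc _ = a ^ k * (c * volume Λ * ((n + 2).ascFactorial k : ℕ) +
            c * volume Λ * ((n + 1).ascFactorial k : ℕ) +
            2 * (n * ((n + 1).ascFactorial k : ℕ))) := by ring
        _ ≤ a ^ k * (c * volume Λ * B + c * volume Λ * B + 2 * B) := by gcongr
        _ = a ^ k * (2 * c * volume Λ + 2) * B := by ring
        _ ≤ a ^ k * a * B := by
            gcongr
            rw [ha, growthConst]
            calc 2 * (c : ℝ≥0∞) * volume Λ + 2 ≤ (2 * c * volume Λ + 2) + (c + volume Λ) :=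
                  le_self_add
              _ = _ := by ring
        _ = _ := by ring
  refine (key k η).trans ?_
  rw [mul_assoc]
  gcongr
  have := ascFactorial_le_factorial_mul_two_pow (count Λ η) k
  calc (((count Λ η + 1).ascFactorial k : ℕ) : ℝ≥0∞)
      ≤ ((k.factorial * 2 ^ (count Λ η + k) : ℕ) : ℝ≥0∞) := by exact_mod_cast this
    _ = _ := by push_cast; ring

/-! ### Point energies, birth rates and conditional energies -/

theorem measurableSet_box (d n : ℕ) : MeasurableSet (box d n) := by
  unfold box
  simp_rw [Set.ofPred_forall, Set.ofPred_and]
  refine MeasurableSet.iInter fun i => MeasurableSet.inter ?_ ?_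
  · exact measurableSet_le measurable_const (by fun_prop)
  · exact measurableSet_lt (by fun_prop) measurable_const

theorem eventually_mem_box (x : E d) : ∀ᶠ n : ℕ in atTop, x ∈ box d n := by
  have h : Tendsto (fun n : ℕ => (n : ℝ) / 2) atTop atTop :=
    tendsto_natCast_atTop_atTop.atTop_div_const (by norm_num)
  filter_upwards [h.eventually_gt_atTop ‖x‖] with n hn i
  have hi : |x i| ≤ ‖x‖ := by simpa using PiLp.norm_apply_le x i
  have := abs_le.1 hi
  constructor <;> linarith

section Energy

variable {H : Finset (E d) → ℝ}

open Classical in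
theorem points_add_of_mem {B : Set (E d)} (hB : Bornology.IsBounded B) {x : E d} (hx : x ∈ B)
    (η : Config d) : (η.add x).points hB = insert x (η.points hB) := by
  ext y
  simp only [mem_points, carrier_add, Set.mem_insert_iff, Finset.mem_insert]
  constructor
  · tauto
  · rintro (rfl | h) <;> tauto

theorem points_add_sdiff_singleton {B : Set (E d)} (hB : Bornology.IsBounded B)
    {x : E d} (hB' : Bornology.IsBounded (B \ {x})) {η : Config d} (hx : x ∉ η.carrier) :
    (η.add x).points hB' = η.points hB := by
  ext y
  simp only [mem_points, carrier_add, Set.mem_insert_iff, Set.mem_sdiff, Set.mem_singleton_iff]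
  constructor
  · tauto
  · rintro ⟨h, h'⟩
    exact ⟨Or.inr h, h', by rintro rfl; exact hx h⟩

open Classical in
theorem condEnergyApprox_singleton_eventuallyEq {x : E d} {η : Config d} (hx : x ∉ η.carrier) :
    condEnergyApprox H {x} (η.add x) =ᶠ[atTop] fun n =>
      H (insert x (η.points (isBounded_box d n))) - H (η.points (isBounded_box d n)) := by
  filter_upwards [eventually_mem_box x] with n hn
  rw [condEnergyApprox, points_add_of_mem _ hn, points_add_sdiff_singleton _ _ hx]

open Classical in
theorem energyDiff_eventuallyEq_zero {x : E d} {η : Config d} (hx : x ∈ η.carrier) :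
    (fun n => H (insert x (η.points (isBounded_box d n))) - H (η.points (isBounded_box d n)))
      =ᶠ[atTop] fun _ => 0 := by
  filter_upwards [eventually_mem_box x] with n hn
  rw [Finset.insert_eq_of_mem (by simp [hx, hn]), sub_self]

theorem pointEnergy_of_mem {x : E d} {η : Config d} (hx : x ∈ η.carrier) :
    pointEnergy H x η = 0 :=
  (tendsto_const_nhds.congr' (energyDiff_eventuallyEq_zero hx).symm).limUnder_eq

/-- Reduces the point energy to the conditional energy of the singleton {x}, from which existence of
the limit and finite range are inherited. For x already in η the energy differences vanish instead.
-/
theorem pointEnergy_of_notMem (hH : IsAdmissible H) {x : E d} {η : Config d}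
    (hx : x ∉ η.carrier) : pointEnergy H x η = condEnergy H {x} (η.add x) := by
  obtain ⟨l, hl⟩ := hH.exists_limit {x} Bornology.isBounded_singleton (measurableSet_singleton x)
    (η.add x)
  rw [condEnergy, hl.limUnder_eq]
  exact (hl.congr' (condEnergyApprox_singleton_eventuallyEq hx)).limUnder_eq

open Classical in
theorem tendsto_pointEnergy (hH : IsAdmissible H) (x : E d) (η : Config d) :
    Tendsto (fun n =>
      H (insert x (η.points (isBounded_box d n))) - H (η.points (isBounded_box d n))) atTop
      (𝓝 (pointEnergy H x η)) := by
  by_cases hx : x ∈ η.carrier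
  · rw [pointEnergy_of_mem hx]
    exact tendsto_const_nhds.congr' (energyDiff_eventuallyEq_zero hx).symm
  · obtain ⟨l, hl⟩ := hH.exists_limit {x} Bornology.isBounded_singleton
      (measurableSet_singleton x) (η.add x)
    have := hl.congr' (condEnergyApprox_singleton_eventuallyEq hx)
    rwa [pointEnergy, this.limUnder_eq]

theorem measurable_pointEnergy (hH : IsAdmissible H) :
    Measurable fun p : Config d × E d => pointEnergy H p.2 p.1 := by
  refine measurable_of_tendsto_metrizable (f := fun (n : ℕ) (p : Config d × E d) =>
    H ((p.1.add p.2).points (isBounded_box d n)) - H (p.1.points (isBounded_box d n))) ?_ ?_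
  · intro n
    have hm := hH.measurable _ (isBounded_box d n) (measurableSet_box d n)
    exact (hm.comp measurable_add).sub (hm.comp measurable_fst)
  · rw [tendsto_pi_nhds]
    rintro ⟨η, x⟩
    refine (tendsto_pointEnergy hH x η).congr' ?_
    filter_upwards [eventually_mem_box x] with n hn
    rw [points_add_of_mem _ hn]

theorem measurable_birthRate (hH : IsAdmissible H) :
    Measurable fun p : Config d × E d => birthRate H p.2 p.1 :=
  (measurable_pointEnergy hH).neg.exp

theorem birthRate_pos (x : E d) (η : Config d) : 0 < birthRate H x η := Real.exp_pos _

theorem exists_birthRate_le (hH : IsAdmissible H) :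
    ∃ c : ℝ≥0, ∀ x (η : Config d), birthRate H x η ≤ c := by
  obtain ⟨C, hC⟩ := hH.bounded
  refine ⟨⟨Real.exp C, (Real.exp_pos _).le⟩, fun x η => ?_⟩
  exact Real.exp_le_exp.2 (by linarith [neg_abs_le (pointEnergy H x η), hC x η])

theorem exists_birthRate_restrict (hH : IsAdmissible H) :
    ∃ R : ℝ, 0 < R ∧ ∀ (Λ : Set (E d)) (x : E d), x ∈ Λ → ∀ η : Config d,
      birthRate H x (η.restrict (Metric.cthickening R Λ)) = birthRate H x η := by
  obtain ⟨R, hR, h⟩ := hH.finite_range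
  have key : ∀ (x : E d) (η : Config d),
      pointEnergy H x (η.restrict (Metric.cthickening R {x})) = pointEnergy H x η := by
    intro x η
    have hx' : x ∈ Metric.cthickening R {x} := Metric.self_subset_cthickening _ rfl
    by_cases hx : x ∈ η.carrier
    · rw [pointEnergy_of_mem hx, pointEnergy_of_mem]
      exact ⟨hx, hx'⟩
    · have hx'' : x ∉ (η.restrict (Metric.cthickening R {x})).carrier := fun h' => hx h'.1
      rw [pointEnergy_of_notMem hH hx, pointEnergy_of_notMem hH hx'',
        h {x} Bornology.isBounded_singleton (measurableSet_singleton x) (η.add x),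
        restrict_add_of_mem hx']
  refine ⟨R, hR, fun Λ x hx η => ?_⟩
  have hsub : Metric.cthickening R {x} ⊆ Metric.cthickening R Λ :=
    Metric.cthickening_subset_of_subset R (Set.singleton_subset_iff.2 hx)
  -- The R-neighbourhood of x lies in that of Λ, so both sides reduce to the restriction of η to the
  -- smaller one.
  rw [birthRate, ← key, restrict_restrict, Set.inter_eq_right.2 hsub, key, birthRate]

open Classical in
-- Telescoping: the points of s are added one at a time, and each addition contributes a point
-- energy, at most C in absolute value. The filter discards points that the n-th box does not yet
-- contain.
theorem exists_tendsto_energy_add (hH : IsAdmissible H) {C : ℝ}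
    (hC : ∀ (x : E d) (η : Config d), |pointEnergy H x η| ≤ C) (s : Finset (E d)) :
    ∀ ζ : Config d, (∀ x ∈ s, x ∉ ζ.carrier) → ∃ l : ℝ, |l| ≤ C * s.card ∧
      Tendsto (fun n => H (s.filter (· ∈ box d n) ∪ ζ.points (isBounded_box d n)) -
        H (ζ.points (isBounded_box d n))) atTop (𝓝 l) := by
  induction s using Finset.induction_on with
  | empty =>
    intro ζ _
    exact ⟨0, by simp, by simp⟩
  | insert a s ha ih =>
    intro ζ hζ
    obtain ⟨l, hl, ht⟩ := ih (ζ.add a) (fun x hx hx' => by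
      rcases hx' with rfl | hx'
      · exact ha hx
      · exact hζ x (Finset.mem_insert_of_mem hx) hx')
    refine ⟨l + pointEnergy H a ζ, ?_, ?_⟩
    · rw [Finset.card_insert_of_notMem ha]
      push_cast
      calc _ ≤ |l| + |pointEnergy H a ζ| := abs_add_le _ _
        _ ≤ C * s.card + C := add_le_add hl (hC _ _)
        _ = _ := by ring
    · refine (ht.add (tendsto_pointEnergy hH a ζ)).congr' ?_
      filter_upwards [eventually_mem_box a] with n hn
      rw [points_add_of_mem _ hn, Finset.filter_insert, if_pos hn, Finset.union_insert,
        Finset.insert_union]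
      ring

/-- The points in Λ are added successively to the configuration outside Λ, at a cost of at most C
each. -/
theorem abs_condEnergy_le (hH : IsAdmissible H) {C : ℝ}
    (hC : ∀ (x : E d) (η : Config d), |pointEnergy H x η| ≤ C) {Λ : Set (E d)}
    (hΛ : Bornology.IsBounded Λ) (η : Config d) :
    |condEnergy H Λ η| ≤ C * count Λ η := by
  classical
  obtain ⟨l, hl, ht⟩ := exists_tendsto_energy_add hH hC (η.points hΛ) (η.restrict Λᶜ)
    (fun x hx hx' => hx'.2 (mem_points.1 hx).2)
  rw [card_points] at hl
  have : condEnergy H Λ η = l := by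
    refine Tendsto.limUnder_eq (ht.congr fun n => ?_)
    rw [condEnergyApprox]
    congr 2
    · ext y
      simp only [Finset.mem_union, Finset.mem_filter, mem_points, carrier_restrict,
        Set.mem_inter_iff, Set.mem_compl_iff]
      tauto
    · ext y
      simp only [mem_points, carrier_restrict, Set.mem_inter_iff, Set.mem_compl_iff, Set.mem_sdiff]
      tauto
  rwa [this]

theorem count_glue (Λ : Set (E d)) (η ω : Config d) : count Λ (glue Λ η ω) = count Λ η := by
  rw [count, count]
  congr 1
  ext x
  simp only [glue, Set.mem_inter_iff, Set.mem_union, Set.mem_sdiff]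
  tauto

theorem restrict_glue (Λ : Set (E d)) (η ω : Config d) :
    (glue Λ η ω).restrict Λ = η.restrict Λ := by
  ext x
  simp only [glue, carrier_restrict, Set.mem_inter_iff, Set.mem_union, Set.mem_sdiff]
  tauto

end Energy

/-! ### Comparison of regular and Gibbs measures with the Poisson process -/

section Gibbs

variable {H : Finset (E d) → ℝ}

/-- Two-sided comparison of a measure with a Poisson process in `Λ`, with densities
`a z^{N_Λ}` and `(a z^{N_Λ})⁻¹`, tested on functions. -/
structure IsPoissonComparable (Λ : Set (E d)) (m : Measure (Config d)) (a z : ℝ≥0) : Prop where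
  one_le_const : 1 ≤ a
  one_le_base : 1 ≤ z
  le : ∀ F : Config d → ℝ≥0∞, Measurable F →
    ∫⁻ η, F η ∂m ≤ ∫⁻ η, (a * (z : ℝ≥0∞) ^ count Λ η) * F η ∂(poisson Λ)
  ge : ∀ F : Config d → ℝ≥0∞, Measurable F →
    ∫⁻ η, F η ∂(poisson Λ) ≤ ∫⁻ η, (a * (z : ℝ≥0∞) ^ count Λ η) * F η ∂m

theorem lintegral_poisson_restrict {Λ : Set (E d)} (hm : MeasurableSet Λ)
    {F : Config d → ℝ≥0∞} (hF : Measurable F) :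
    ∫⁻ η, F (η.restrict Λ) ∂(poisson Λ) = ∫⁻ η, F η ∂(poisson Λ) := by
  rw [lintegral_poisson Λ (F := fun η => F (η.restrict Λ)) (hF.comp (measurable_restrict hm)),
    lintegral_poisson Λ hF]
  congr 2
  ext n
  congr 1
  refine lintegral_congr_ae ?_
  filter_upwards [ae_mem_tupleMeasure hm n] with x hx
  congr 1
  ext y
  simp only [carrier_restrict, carrier_ofTuple, Set.mem_inter_iff, Set.mem_range,
    and_iff_left_iff_imp]
  rintro ⟨i, rfl⟩
  exact hx i

theorem lintegral_marginal {Λ : Set (E d)} (hm : MeasurableSet Λ) (μ : Measure (Config d))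
    {F : Config d → ℝ≥0∞} (hF : Measurable F) :
    ∫⁻ η, F η ∂(marginal μ Λ) = ∫⁻ η, F (η.restrict Λ) ∂μ :=
  lintegral_map hF (measurable_restrict hm)

theorem IsRegular.exists_isPoissonComparable [NullSingletonClass (volume : Measure (E d))]
    {μ : Measure (Config d)} [IsProbabilityMeasure μ] (hμ : IsRegular μ) {Λ : Set (E d)}
    (hΛ : Bornology.IsBounded Λ) (hm : MeasurableSet Λ) :
    ∃ a z : ℝ≥0, IsPoissonComparable Λ (marginal μ Λ) a z := by
  have := isFiniteMeasure_poisson hΛ hm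
  have : IsFiniteMeasure (marginal μ Λ) := by unfold marginal; infer_instance
  obtain ⟨hac, z, c, hz, hc, hb⟩ := hμ.2 Λ hΛ hm
  lift z to ℝ≥0 using hz.le
  lift c to ℝ≥0 using hc.le
  have hz0 : z ≠ 0 := by rintro rfl; simp at hz
  have hc0 : c ≠ 0 := by rintro rfl; simp at hc
  have hw : Measurable fun η : Config d => ((max c 1 : ℝ≥0) : ℝ≥0∞) *
      ((max z 1 : ℝ≥0) : ℝ≥0∞) ^ count Λ η :=
    measurable_weight hΛ hm fun n => ((max c 1 : ℝ≥0) : ℝ≥0∞) * ((max z 1 : ℝ≥0) : ℝ≥0∞) ^ n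
  have hle : ∀ n : ℕ, ENNReal.ofReal (c * z ^ n) ≤
      ((max c 1 : ℝ≥0) : ℝ≥0∞) * ((max z 1 : ℝ≥0) : ℝ≥0∞) ^ n := by
    intro n
    rw [show ((c : ℝ) * z ^ n) = ((c * z ^ n : ℝ≥0) : ℝ) by push_cast; rfl,
      ENNReal.ofReal_coe_nnreal]
    push_cast
    gcongr
    · exact_mod_cast le_max_left c 1
    · exact_mod_cast le_max_left z 1
  have hinv : ∀ n : ℕ, ENNReal.ofReal ((c : ℝ)⁻¹ * ((z : ℝ) ^ n)⁻¹) = (ENNReal.ofReal (c * z ^ n))⁻¹ := by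
    intro n
    rw [← mul_inv, ENNReal.ofReal_inv_of_pos (by positivity)]
  refine ⟨max c 1, max z 1, le_max_right _ _, le_max_right _ _, fun F hF => ?_, fun F hF => ?_⟩
  · rw [← lintegral_rnDeriv_mul hac hF.aemeasurable]
    refine lintegral_mono_ae ?_
    filter_upwards [hb] with η hη
    gcongr
    exact hη.2.trans (hle _)
  · have hwF : Measurable fun η : Config d => (((max c 1 : ℝ≥0) : ℝ≥0∞) *
        ((max z 1 : ℝ≥0) : ℝ≥0∞) ^ count Λ η) * F η := hw.mul hF
    rw [← lintegral_rnDeriv_mul hac hwF.aemeasurable]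
    refine lintegral_mono_ae ?_
    filter_upwards [hb] with η hη
    have h1 : 1 ≤ (marginal μ Λ).rnDeriv (poisson Λ) η *
        (((max c 1 : ℝ≥0) : ℝ≥0∞) * ((max z 1 : ℝ≥0) : ℝ≥0∞) ^ count Λ η) := by
      have hpos : ENNReal.ofReal (c * z ^ count Λ η) ≠ 0 := by
        rw [Ne, ENNReal.ofReal_eq_zero, not_le]; positivity
      calc (1 : ℝ≥0∞) = (ENNReal.ofReal (c * z ^ count Λ η))⁻¹ *
            ENNReal.ofReal (c * z ^ count Λ η) :=
            (ENNReal.inv_mul_cancel hpos ENNReal.ofReal_ne_top).symm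
        _ ≤ _ := by
            gcongr
            · rw [← hinv]; exact hη.1
            · exact hle _
    calc F η = 1 * F η := (one_mul _).symm
      _ ≤ _ := by
          rw [← mul_assoc]
          gcongr

/-- With z = e^C the Boltzmann weight lies between z^{-N_Λ} and z^{N_Λ}. These bounds and the
resulting ones on the partition function do not depend on the boundary condition, so they survive
averaging in the DLR equation. -/
theorem IsGibbs.exists_isPoissonComparable [NullSingletonClass (volume : Measure (E d))]
    (hH : IsAdmissible H) {ν : Measure (Config d)} (hν : IsGibbs H ν) {Λ : Set (E d)}
    (hΛ : Bornology.IsBounded Λ) (hm : MeasurableSet Λ) :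
    ∃ a z : ℝ≥0, IsPoissonComparable Λ (marginal ν Λ) a z := by
  have := hν.isProbabilityMeasure
  have := isFiniteMeasure_poisson hΛ hm
  obtain ⟨C, hC⟩ := hH.bounded
  have hC0 : 0 ≤ C := (abs_nonneg _).trans (hC 0 (ofFinite ∅ Set.finite_empty))
  set z : ℝ≥0 := ⟨Real.exp C, (Real.exp_pos _).le⟩ with hz
  have hz1 : 1 ≤ z := by
    rw [← NNReal.coe_le_coe]; exact Real.one_le_exp hC0
  have hzpow : ∀ n : ℕ, (z : ℝ≥0∞) ^ n = ENNReal.ofReal (Real.exp (C * n)) := by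
    intro n
    rw [mul_comm, Real.exp_nat_mul, ENNReal.ofReal_pow (Real.exp_pos _).le]
    congr 1
    rw [ENNReal.ofReal, hz]
    congr 1
    exact (Real.toNNReal_of_nonneg (Real.exp_pos _).le).symm
  have hzne : ∀ n : ℕ, (z : ℝ≥0∞) ^ n ≠ 0 := fun n =>
    pow_ne_zero _ (ENNReal.coe_ne_zero.2 (one_pos.trans_le hz1).ne')
  have hzt : ∀ n : ℕ, (z : ℝ≥0∞) ^ n ≠ ∞ := fun n => ENNReal.pow_ne_top ENNReal.coe_ne_top
  have hE : ∀ ω η, |condEnergy H Λ (glue Λ η ω)| ≤ C * count Λ η := fun ω η => by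
    rw [← count_glue Λ η ω]; exact abs_condEnergy_le hH hC hΛ _
  have hwle : ∀ ω, gibbsWeight H Λ ω ≤ fun η => (z : ℝ≥0∞) ^ count Λ η := by
    intro ω η
    simp only
    rw [hzpow]
    exact ENNReal.ofReal_le_ofReal (Real.exp_le_exp.2 (by linarith [(abs_le.1 (hE ω η)).1]))
  have hwge : ∀ ω, (fun η => ((z : ℝ≥0∞) ^ count Λ η)⁻¹) ≤ gibbsWeight H Λ ω := by
    intro ω η
    simp only
    rw [hzpow, ← ENNReal.ofReal_inv_of_pos (Real.exp_pos _), ← Real.exp_neg]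
    exact ENNReal.ofReal_le_ofReal (Real.exp_le_exp.2 (by linarith [(abs_le.1 (hE ω η)).2]))
  set ZM : ℝ≥0∞ := ∫⁻ η, (z : ℝ≥0∞) ^ count Λ η ∂(poisson Λ) with hZM
  have hZMt : ZM ≠ ∞ := (lintegral_poisson_pow_count_lt_top hΛ hm z).ne
  have hZle : ∀ ω, partitionFunction H Λ ω ≤ ZM := fun ω => lintegral_mono (hwle ω)
  -- The empty configuration alone contributes e^{-|Λ|}.
  have hZge : ∀ ω, poissonConst Λ ≤ partitionFunction H Λ ω := by
    intro ω
    refine le_trans ?_ (lintegral_mono (hwge ω))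
    rw [lintegral_poisson_count hΛ hm fun n => ((z : ℝ≥0∞) ^ n)⁻¹]
    calc poissonConst Λ = poissonConst Λ * 1 := (mul_one _).symm
      _ ≤ _ := by
        gcongr
        refine le_trans ?_ (ENNReal.le_tsum 0)
        simp
  have hwm : Measurable fun η : Config d => (z : ℝ≥0∞) ^ count Λ η :=
    measurable_weight hΛ hm fun n => (z : ℝ≥0∞) ^ n
  have hdlr : ∀ F : Config d → ℝ≥0∞, Measurable F → ∫⁻ η, F η ∂(marginal ν Λ) =
      ∫⁻ ω, (partitionFunction H Λ ω)⁻¹ * ∫⁻ η, F (η.restrict Λ)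
        ∂((poisson Λ).withDensity (gibbsWeight H Λ ω)) ∂ν := by
    intro F hF
    rw [lintegral_marginal hm ν hF, hν.dlr Λ hΛ hm (fun η => F (η.restrict Λ))
      (hF.comp (measurable_restrict hm))]
    refine lintegral_congr fun ω => ?_
    rw [finiteGibbs, lintegral_smul_measure]
    simp_rw [restrict_glue, smul_eq_mul]
  have hcr : ∀ η : Config d, count Λ (η.restrict Λ) = count Λ η := fun η => by
    rw [count_restrict, Set.inter_self]
  have hpc := poissonConst_pos Λ
  have hpct : (poissonConst Λ)⁻¹ ≠ ∞ := ENNReal.inv_ne_top.2 hpc.ne'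
  set a : ℝ≥0 := max 1 (max (poissonConst Λ)⁻¹.toNNReal ZM.toNNReal) with ha
  have ha1 : (poissonConst Λ)⁻¹ ≤ a := by
    rw [← ENNReal.coe_toNNReal hpct]
    exact_mod_cast (le_max_left _ _).trans (le_max_right _ _)
  have ha2 : ZM ≤ a := by
    rw [← ENNReal.coe_toNNReal hZMt]
    exact_mod_cast (le_max_right _ _).trans (le_max_right _ _)
  refine ⟨a, z, le_max_left _ _, hz1, fun F hF => ?_, fun F hF => ?_⟩
  · have hFr : Measurable fun η : Config d => F (η.restrict Λ) := hF.comp (measurable_restrict hm)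
    have hwF : Measurable fun η : Config d => (z : ℝ≥0∞) ^ count Λ η * F η := hwm.mul hF
    rw [hdlr F hF]
    calc _ ≤ ∫⁻ ω, a * ∫⁻ η, (z : ℝ≥0∞) ^ count Λ η * F η ∂(poisson Λ) ∂ν := by
          refine lintegral_mono fun ω => ?_
          refine mul_le_mul' ((ENNReal.inv_le_inv.2 (hZge ω)).trans ha1) ?_
          -- The comparison is made between measures with densities, so that only the majorant
          -- z^{N_Λ}, not the Boltzmann weight, needs to be measurable in η.
          · calc _ ≤ ∫⁻ η, F (η.restrict Λ)
                  ∂((poisson Λ).withDensity fun η => (z : ℝ≥0∞) ^ count Λ η) :=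
                  lintegral_mono' (withDensity_mono (Eventually.of_forall (hwle ω))) le_rfl
              _ = ∫⁻ η, (z : ℝ≥0∞) ^ count Λ η * F (η.restrict Λ) ∂(poisson Λ) :=
                  lintegral_withDensity_eq_lintegral_mul _ hwm hFr
              _ = _ := by
                  rw [← lintegral_poisson_restrict hm hwF]
                  simp [hcr]
      _ = a * ∫⁻ η, (z : ℝ≥0∞) ^ count Λ η * F η ∂(poisson Λ) := by simp
      _ = _ := by
          rw [← lintegral_const_mul _ hwF]
          simp [mul_assoc]
  · have hG : Measurable fun η : Config d => (a * (z : ℝ≥0∞) ^ count Λ η) * F η :=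
      (hwm.const_mul _).mul hF
    rw [hdlr _ hG]
    calc ∫⁻ η, F η ∂(poisson Λ) = ∫⁻ _ω, ∫⁻ η, F η ∂(poisson Λ) ∂ν := by simp
      _ ≤ _ := by
          refine lintegral_mono fun ω => ?_
          calc ∫⁻ η, F η ∂(poisson Λ)
              ≤ ((partitionFunction H Λ ω)⁻¹ * a) * ∫⁻ η, F η ∂(poisson Λ) := by
                have h1 : 1 ≤ (partitionFunction H Λ ω)⁻¹ * a := by
                  have hZ0 : partitionFunction H Λ ω ≠ 0 := (hpc.trans_le (hZge ω)).ne'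
                  have hZt : partitionFunction H Λ ω ≠ ∞ := ((hZle ω).trans_lt hZMt.lt_top).ne
                  rw [← ENNReal.inv_mul_cancel hZ0 hZt]
                  gcongr
                  exact (hZle ω).trans ha2
                calc _ = 1 * ∫⁻ η, F η ∂(poisson Λ) := (one_mul _).symm
                  _ ≤ _ := by gcongr
            _ = (partitionFunction H Λ ω)⁻¹ * (a * ∫⁻ η, F (η.restrict Λ) ∂(poisson Λ)) := by
                rw [lintegral_poisson_restrict hm hF, mul_assoc]
            _ = (partitionFunction H Λ ω)⁻¹ * ∫⁻ η, (a * (z : ℝ≥0∞) ^ count Λ η) * F (η.restrict Λ)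
                ∂((poisson Λ).withDensity fun η => ((z : ℝ≥0∞) ^ count Λ η)⁻¹) := by
                have hFr : Measurable fun η : Config d => F (η.restrict Λ) :=
                  hF.comp (measurable_restrict hm)
                have hG' : Measurable fun η : Config d =>
                    (a * (z : ℝ≥0∞) ^ count Λ η) * F (η.restrict Λ) := (hwm.const_mul _).mul hFr
                have hwi : Measurable fun η : Config d => ((z : ℝ≥0∞) ^ count Λ η)⁻¹ := hwm.inv
                rw [lintegral_withDensity_eq_lintegral_mul _ hwi hG',
                  ← lintegral_const_mul _ hFr]
                congr 1
                refine lintegral_congr fun η => ?_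
                rw [Pi.mul_apply]
                calc _ = (((z : ℝ≥0∞) ^ count Λ η)⁻¹ * (z : ℝ≥0∞) ^ count Λ η) *
                      (a * F (η.restrict Λ)) := by
                      rw [ENNReal.inv_mul_cancel (hzne _) (hzt _), one_mul]
                  _ = _ := by ring
            _ ≤ _ := by
                refine mul_le_mul' le_rfl ?_
                simp_rw [hcr]
                exact lintegral_mono' (withDensity_mono (Eventually.of_forall (hwge ω))) le_rfl

end Gibbs

theorem tsum_carrier_eq_sum_points {Λ : Set (E d)} (hΛ : Bornology.IsBounded Λ) (η : Config d)
    {f : E d → ℝ} (hf : ∀ x ∉ Λ, f x = 0) :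
    ∑' x : η.carrier, f x.1 = ∑ x ∈ η.points hΛ, f x := by
  classical
  rw [tsum_subtype η.carrier f, tsum_eq_sum (s := η.points hΛ)]
  · exact Finset.sum_congr rfl fun x hx => Set.indicator_of_mem (mem_points.1 hx).1 f
  · intro x hx
    by_cases hxη : x ∈ η.carrier
    · rw [Set.indicator_of_mem hxη, hf]
      exact fun h => hx (mem_points.2 ⟨hxη, h⟩)
    · exact Set.indicator_of_notMem hxη f

theorem measurable_of_natCast {α : Type*} [MeasurableSpace α] {f : α → ℕ}
    (hf : Measurable fun a => (f a : ℝ≥0∞)) : Measurable f := by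
  refine measurable_to_countable' fun n => ?_
  have : f ⁻¹' {n} = (fun a => (f a : ℝ≥0∞)) ⁻¹' {(n : ℝ≥0∞)} := by
    ext a; simp
  rw [this]
  exact hf (measurableSet_singleton _)

/-! ### Joint measurability of càdlàg paths -/

section MartingaleProblem

theorem exists_compactlySupported_tendsto_indicator [Nontrivial (E d)] {U : Set (E d)}
    (hU : IsOpen U) (hUb : Bornology.IsBounded U) :
    ∃ φ : ℕ → CompactlySupportedContinuousMap (E d) ℝ, (∀ k, ∀ x ∉ U, φ k x = 0) ∧
      ∀ x ∈ U, Tendsto (fun k => φ k x) atTop (𝓝 1) := by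
  -- The distance to the empty set is 0 by convention, so the functions min(1, k dist(x, Uᶜ))
  -- converge to the indicator only if Uᶜ is nonempty. A bounded U is not the whole space because
  -- the space is nontrivial.
  have hne : Uᶜ.Nonempty := by
    rw [Set.nonempty_compl]
    rintro rfl
    exact NormedSpace.unbounded_univ ℝ (E d) hUb
  have hz : ∀ (k : ℕ), ∀ x ∉ U, min 1 ((k : ℝ) * Metric.infDist x Uᶜ) = 0 := by
    intro k x hx
    rw [Metric.infDist_zero_of_mem (show x ∈ Uᶜ from hx)]
    simp
  refine ⟨fun k => ⟨⟨fun x => min 1 ((k : ℝ) * Metric.infDist x Uᶜ), ?_⟩, ?_⟩, hz, ?_⟩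
  · have := Metric.continuous_infDist_pt (Uᶜ : Set (E d))
    fun_prop
  · exact HasCompactSupport.intro hUb.isCompact_closure fun x hx =>
      hz k x fun h => hx (subset_closure h)
  · intro x hx
    have hpos : 0 < Metric.infDist x Uᶜ :=
      (hU.isClosed_compl.notMem_iff_infDist_pos hne).1 (by simpa using hx)
    refine tendsto_const_nhds.congr' ?_
    have := (tendsto_natCast_atTop_atTop (R := ℝ)).atTop_mul_const hpos
    filter_upwards [this.eventually_ge_atTop 1] with k hk
    exact (min_eq_left hk).symm

/-- Links the vague topology to the σ-algebra of the counts: indicators of bounded open sets are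
limits of test functions, and open sets form a π-system that generates the Borel sets. Restriction
to a large ball makes the point measures finite, as this argument requires. -/
theorem measurable_of_tsum_compactlySupported [Nontrivial (E d)] {α : Type*} [MeasurableSpace α]
    {Y : α → Config d}
    (h : ∀ φ : CompactlySupportedContinuousMap (E d) ℝ,
      Measurable fun a => ∑' x : (Y a).carrier, φ x.1) : Measurable Y := by
  have hopen : ∀ U : Set (E d), IsOpen U → Bornology.IsBounded U →
      Measurable fun a => (count U (Y a) : ℝ≥0∞) := by
    intro U hU hUb
    obtain ⟨φ, hφ0, hφ1⟩ := exists_compactlySupported_tendsto_indicator hU hUb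
    have hr : Measurable fun a => (count U (Y a) : ℝ) := by
      refine measurable_of_tendsto_metrizable (fun k => h (φ k)) ?_
      rw [tendsto_pi_nhds]
      intro a
      simp_rw [tsum_carrier_eq_sum_points hUb (Y a) (hφ0 _)]
      have : (count U (Y a) : ℝ) = ∑ x ∈ (Y a).points hUb, 1 := by simp [card_points]
      rw [this]
      exact tendsto_finsetSum _ fun x hx => hφ1 x (mem_points.1 hx).2
    have := hr.ennreal_ofReal
    simpa using this
  refine measurable_of_count fun B hB hBm => measurable_of_natCast ?_
  obtain ⟨r, hr⟩ := hB.subset_ball (0 : E d)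
  have hbb : Bornology.IsBounded (Metric.ball (0 : E d) r) := Metric.isBounded_ball
  have : ∀ a, IsFiniteMeasure (pointMeasure hbb (Y a)) := fun a => ⟨by
    rw [pointMeasure_apply hbb _ .univ]; exact ENNReal.natCast_lt_top _⟩
  have hmeas : Measurable fun a => pointMeasure hbb (Y a) := by
    refine Measurable.measure_of_isPiSystem (S := {s | IsOpen s})
      (BorelSpace.measurable_eq) isPiSystem_isOpen (fun s hs => ?_) ?_
    · simp_rw [pointMeasure_apply hbb _ (IsOpen.measurableSet hs)]
      exact hopen _ (Metric.isOpen_ball.inter hs) (hbb.subset Set.inter_subset_left)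
    · simp_rw [pointMeasure_apply hbb _ MeasurableSet.univ, Set.inter_univ]
      exact hopen _ Metric.isOpen_ball hbb
  have := Measure.measurable_measure.1 hmeas B hBm
  simpa only [pointMeasure_apply hbb _ hBm, Set.inter_eq_right.2 hr] using this

theorem continuous_tsum_compactlySupported (φ : CompactlySupportedContinuousMap (E d) ℝ) :
    Continuous fun η : Config d => ∑' x : η.carrier, φ x.1 :=
  continuous_iInf_dom continuous_induced_dom

theorem measurable_tsum_compactlySupported (φ : CompactlySupportedContinuousMap (E d) ℝ) :
    Measurable fun η : Config d => ∑' x : η.carrier, φ x.1 := by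
  have hb : Bornology.IsBounded (tsupport φ) := φ.hasCompactSupport.isCompact.isBounded
  have : ∀ η : Config d, ∑' x : η.carrier, φ x.1 = ∑ x ∈ η.points hb, φ x := fun η =>
    tsum_carrier_eq_sum_points hb η fun x hx => image_eq_zero_of_notMem_tsupport hx
  simp_rw [this]
  exact measurable_sum_points_real hb (isClosed_tsupport φ).measurableSet
    (f := fun _ x => φ x) (φ.continuous.measurable.comp measurable_snd)

/-- Time is rounded to a grid of mesh 1/(k+1), to the grid point strictly after u. The rounded
process is jointly measurable and converges by right continuity. -/
theorem measurable_uncurry_real_of_rightContinuous {S : Type*} [MeasurableSpace S]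
    {Z : ℝ≥0 → S → ℝ} (hZ : ∀ t, Measurable (Z t))
    (hr : ∀ s t, ContinuousWithinAt (fun u => Z u s) (Set.Ici t) t) :
    Measurable fun p : ℝ≥0 × S => Z p.1 p.2 := by
  obtain ⟨N, hNm, hN1, hN2⟩ : ∃ N : ℕ → ℝ≥0 → ℕ, (∀ k, Measurable (N k)) ∧
      (∀ k u, (k + 1) * u < (N k u : ℝ≥0) + 1) ∧ ∀ k u, (N k u : ℝ≥0) ≤ (k + 1) * u :=
    ⟨fun k u => ⌊(k + 1 : ℝ≥0) * u⌋₊, fun k => Nat.measurable_floor.comp (by fun_prop),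
      fun k u => Nat.lt_floor_add_one _, fun k u => Nat.floor_le zero_le⟩
  have hgt : ∀ u, Tendsto (fun k : ℕ => ((N k u : ℝ≥0) + 1) / (k + 1)) atTop (𝓝[≥] u) := by
    intro u
    have hle : ∀ k : ℕ, u ≤ ((N k u : ℝ≥0) + 1) / (k + 1) := fun k => by
      rw [le_div_iff₀ (by positivity), mul_comm]
      exact (hN1 k u).le
    refine tendsto_nhdsWithin_iff.2 ⟨?_, Eventually.of_forall hle⟩
    have hu : ∀ k : ℕ, ((N k u : ℝ≥0) + 1) / (k + 1) ≤ u + 1 / (k + 1) := fun k => by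
      have h1 := hN2 k u
      have h2 : (u + 1 / (k + 1)) * ((k : ℝ≥0) + 1) = (k + 1) * u + 1 := by
        field_simp
      rw [div_le_iff₀ (by positivity), h2]
      gcongr
    have h0 : Tendsto (fun k : ℕ => u + 1 / ((k : ℝ≥0) + 1)) atTop (𝓝 (u + 0)) :=
      tendsto_const_nhds.add tendsto_one_div_add_atTop_nhds_zero_nat
    rw [add_zero] at h0
    exact tendsto_of_tendsto_of_tendsto_of_le_of_le tendsto_const_nhds h0 hle hu
  refine measurable_of_tendsto_metrizable (f := fun (k : ℕ) (p : ℝ≥0 × S) =>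
    Z ((N k p.1 + 1) / (k + 1)) p.2) (fun k => ?_) ?_
  · have h1 : Measurable fun q : ℕ × S => Z ((q.1 + 1) / (k + 1) : ℝ≥0) q.2 :=
      measurable_from_prod_countable_right fun n => hZ ((n + 1) / (k + 1))
    have h2 : Measurable fun p : ℝ≥0 × S => (N k p.1, p.2) :=
      ((hNm k).comp measurable_fst).prodMk measurable_snd
    have h3 := Measurable.comp h1 h2
    simp only [Function.comp_def] at h3
    exact h3
  · rw [tendsto_pi_nhds]
    intro p
    have := (hr p.2 p.1).tendsto.comp (hgt p.1)
    simp only [Function.comp_def] at this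
    exact this

theorem measurable_uncurry_of_rightContinuous [Nontrivial (E d)] {S : Type*} [MeasurableSpace S]
    {X : ℝ≥0 → S → Config d} (hX : ∀ t, Measurable (X t))
    (hr : ∀ s t, ContinuousWithinAt (fun u => X u s) (Set.Ici t) t) :
    Measurable fun p : ℝ≥0 × S => X p.1 p.2 :=
  measurable_of_tsum_compactlySupported fun φ =>
    measurable_uncurry_real_of_rightContinuous
      (Z := fun t s => ∑' x : (X t s).carrier, φ x.1)
      (fun t => (measurable_tsum_compactlySupported φ).comp (hX t))
      (fun s t => (continuous_tsum_compactlySupported φ).continuousAt.comp_continuousWithinAt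
        (hr s t))

end MartingaleProblem

/-! ### The generator on local functions -/

section Generator

variable {b : E d → Config d → ℝ} {Λ : Set (E d)}

theorem local_add_of_notMem {F : Config d → ℝ} (hF : ∀ η, F (η.restrict Λ) = F η) {x : E d}
    (hx : x ∉ Λ) (η : Config d) : F (η.add x) = F η := by
  rw [← hF, restrict_add_of_notMem hx, hF]

theorem local_remove_of_notMem {F : Config d → ℝ} (hF : ∀ η, F (η.restrict Λ) = F η) {x : E d}
    (hx : x ∉ Λ) (η : Config d) : F (η.remove x) = F η := by
  rw [← hF, restrict_remove_of_notMem hx, hF]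

theorem generator_eq (hΛ : Bornology.IsBounded Λ) {F : Config d → ℝ}
    (hF : ∀ η, F (η.restrict Λ) = F η) (η : Config d) :
    generator b F η = (∫ x in Λ, b x η * (F (η.add x) - F η)) +
      ∑ x ∈ η.points hΛ, (F (η.remove x) - F η) := by
  rw [generator, tsum_carrier_eq_sum_points hΛ η (f := fun x => F (η.remove x) - F η)
    fun x hx => by rw [local_remove_of_notMem hF hx, sub_self]]
  congr 1
  refine (setIntegral_eq_integral_of_forall_compl_eq_zero fun x hx => ?_).symm
  rw [birthTerm, local_add_of_notMem hF hx, sub_self, mul_zero]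

theorem measurable_generator (hbm : Measurable fun p : Config d × E d => b p.2 p.1)
    (hΛ : Bornology.IsBounded Λ) (hm : MeasurableSet Λ) {F : Config d → ℝ} (hFm : Measurable F)
    (hF : ∀ η, F (η.restrict Λ) = F η) : Measurable (generator b F) := by
  simp_rw [funext (generator_eq (b := b) hΛ hF)]
  have h1 : Measurable fun p : Config d × E d => b p.2 p.1 * (F (p.1.add p.2) - F p.1) :=
    hbm.mul ((hFm.comp measurable_add).sub (hFm.comp measurable_fst))
  refine Measurable.add ?_ ?_
  · exact (h1.stronglyMeasurable.integral_prod_right' (ν := volume.restrict Λ)).measurable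
  · exact measurable_sum_points_real hΛ hm
      ((hFm.comp measurable_remove).sub (hFm.comp measurable_fst))

theorem enorm_generator_le (hΛ : Bornology.IsBounded Λ) {c : ℝ≥0} (hb0 : ∀ x η, 0 ≤ b x η)
    (hbc : ∀ x η, b x η ≤ c) {F : Config d → ℝ} (hFm : Measurable F)
    (hF : ∀ η, F (η.restrict Λ) = F η) (η : Config d) :
    ‖generator b F η‖ₑ ≤ domOp c hΛ (fun η => ‖F η‖ₑ) η := by
  have hbe : ∀ x η, ‖b x η‖ₑ ≤ (c : ℝ≥0∞) := by
    intro x η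
    rw [Real.enorm_eq_ofReal (hb0 x η)]
    exact ENNReal.ofReal_le_of_le_toReal (by simpa using hbc x η)
  have hsub : ∀ u v : ℝ, ‖u - v‖ₑ ≤ ‖u‖ₑ + ‖v‖ₑ := fun u v => enorm_sub_le
  rw [generator_eq hΛ hF]
  have hadd : Measurable fun x => ‖F (η.add x)‖ₑ :=
    (hFm.comp (Config.measurable_add.comp measurable_prodMk_left)).enorm
  have h1 : ‖∫ x in Λ, b x η * (F (η.add x) - F η)‖ₑ ≤
      c * (∫⁻ x in Λ, ‖F (η.add x)‖ₑ) + c * volume Λ * ‖F η‖ₑ := by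
    refine (enorm_integral_le_lintegral_enorm _).trans ?_
    calc _ ≤ ∫⁻ x in Λ, (c * ‖F (η.add x)‖ₑ + c * ‖F η‖ₑ) := by
          refine lintegral_mono fun x => ?_
          rw [enorm_mul, ← mul_add]
          exact mul_le_mul' (hbe _ _) (hsub _ _)
      _ = _ := by
          rw [lintegral_add_right _ measurable_const, lintegral_const_mul _ hadd,
            lintegral_const, Measure.restrict_apply_univ]
          ring
  have h2 : ‖∑ x ∈ η.points hΛ, (F (η.remove x) - F η)‖ₑ ≤
      ∑ x ∈ η.points hΛ, ‖F (η.remove x)‖ₑ + count Λ η * ‖F η‖ₑ := by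
    refine (enorm_sum_le _ _).trans ?_
    calc _ ≤ ∑ x ∈ η.points hΛ, (‖F (η.remove x)‖ₑ + ‖F η‖ₑ) :=
          Finset.sum_le_sum fun x _ => hsub _ _
      _ = _ := by
          rw [Finset.sum_add_distrib, Finset.sum_const, card_points, nsmul_eq_mul]
  calc _ ≤ _ := enorm_add_le _ _
    _ ≤ _ := add_le_add h1 h2
    _ = _ := by unfold domOp; ring

end Generator

/-! ### Dynkin's formula -/

section Dynkin

variable {b : E d → Config d → ℝ}
  {T : ℝ≥0 → Kernel (Config d) (Config d)}

theorem IsBirthDeathSemigroup.isProbabilityMeasure (hT : IsBirthDeathSemigroup b T) (t : ℝ≥0) (ω : Config d) :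
    IsProbabilityMeasure (T t ω) := by
  obtain ⟨S, _, P, X, hP, hX, hlaw⟩ := hT.law ω
  obtain ⟨𝓕, hm, -⟩ := hX.martingale
  rw [hlaw t]
  exact Measure.isProbabilityMeasure_map ((hm t).mono (𝓕.le t) le_rfl).aemeasurable

/-- A martingale has constant expectation; the finiteness assumption and joint measurability of the
path justify Fubini's theorem for the time integral. -/
theorem IsBirthDeathSemigroup.dynkin [Nontrivial (E d)] (hT : IsBirthDeathSemigroup b T)
    (ω : Config d) {F : Config d → ℝ} (hF : IsBoundedLocal F)
    (hG : Measurable (generator b F)) (t : ℝ≥0)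
    (hfin : ∫⁻ u in Set.Ioc (0 : ℝ) t, ∫⁻ η, ‖generator b F η‖ₑ ∂(T u.toNNReal ω) ≠ ∞) :
    IntervalIntegrable (fun u : ℝ => ∫ η, generator b F η ∂(T u.toNNReal ω)) volume 0 t ∧
    ∫ η, F η ∂(T t ω) - F ω = ∫ u in (0 : ℝ)..t, ∫ η, generator b F η ∂(T u.toNNReal ω) := by
  obtain ⟨S, _, P, X, hP, hX, hlaw⟩ := hT.law ω
  obtain ⟨𝓕, hm, hmart⟩ := hX.martingale
  have hXm : ∀ t, Measurable (X t) := fun t => (hm t).mono (𝓕.le t) le_rfl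
  have hj := measurable_uncurry_of_rightContinuous hXm hX.rightContinuous
  have hc : Measurable fun p : ℝ × S => X p.1.toNNReal p.2 :=
    hj.comp ((measurable_real_toNNReal.comp measurable_fst).prodMk measurable_snd)
  have hint : Integrable (fun p : ℝ × S => generator b F (X p.1.toNNReal p.2))
      ((volume.restrict (Set.Ioc (0 : ℝ) t)).prod P) := by
    have hGc : Measurable fun p : ℝ × S => generator b F (X p.1.toNNReal p.2) := hG.comp hc
    refine ⟨hGc.aestronglyMeasurable, ?_⟩
    rw [hasFiniteIntegral_iff_enorm, lintegral_prod _ hGc.enorm.aemeasurable]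
    refine lt_of_eq_of_lt ?_ hfin.lt_top
    refine lintegral_congr fun u => ?_
    rw [hlaw, lintegral_map hG.enorm (hXm _)]
  have hmap : ∀ u : ℝ, ∫ η, generator b F η ∂(T u.toNNReal ω) =
      ∫ s, generator b F (X u.toNNReal s) ∂P := fun u => by
    rw [hlaw, integral_map (hXm _).aemeasurable hG.aestronglyMeasurable]
  simp_rw [hmap]
  refine ⟨(intervalIntegrable_iff_integrableOn_Ioc_of_le t.2).2 hint.integral_prod_left, ?_⟩
  obtain ⟨C, hC⟩ := hF.bounded
  have hFint : ∀ u, Integrable (fun s => F (X u s)) P := fun u =>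
    Integrable.of_bound (hF.measurable.comp (hXm u)).aestronglyMeasurable C
      (Eventually.of_forall fun s => hC _)
  have hM := (hmart F hF).setIntegral_eq (zero_le (a := t)) MeasurableSet.univ
  simp only [Measure.restrict_univ, NNReal.coe_zero, intervalIntegral.integral_same,
    sub_zero] at hM
  have h0 : ∫ s, F (X 0 s) ∂P = F ω := by
    rw [integral_congr_ae (g := fun _ => F ω) (by filter_upwards [hX.initial] with s hs; rw [hs])]
    simp
  rw [h0] at hM
  have hGint : Integrable (fun s => ∫ u in (0 : ℝ)..t, generator b F (X u.toNNReal s)) P := by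
    simp only [intervalIntegral.integral_of_le t.coe_nonneg]
    exact hint.integral_prod_right
  rw [integral_sub (hFint t) hGint] at hM
  rw [hlaw, integral_map (hXm t).aemeasurable hF.measurable.aestronglyMeasurable, hM]
  rw [sub_sub_cancel]
  simp only [intervalIntegral.integral_of_le t.coe_nonneg]
  exact (integral_integral_swap hint).symm

end Dynkin

/-- Birth rates that are jointly measurable, nonnegative and bounded by `c`. -/
structure IsBoundedRate (b : E d → Config d → ℝ) (c : ℝ≥0) : Prop where
  measurable : Measurable fun p : Config d × E d => b p.2 p.1
  nonneg : ∀ x η, 0 ≤ b x η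
  le : ∀ x η, b x η ≤ c

/-- The function `F` on configurations depends on the points in `Λ` only. -/
def IsLocalOn {α : Type*} (Λ : Set (E d)) (F : Config d → α) : Prop :=
  ∀ η, F (η.restrict Λ) = F η

/-! ### First consequences of Dynkin's formula, and exponential moments -/

section Estimates

variable {b : E d → Config d → ℝ} {c : ℝ≥0} {T : ℝ≥0 → Kernel (Config d) (Config d)}
  {Λ : Set (E d)}

theorem isBoundedLocal_of_isLocalOn (hΛ : Bornology.IsBounded Λ) (hm : MeasurableSet Λ)
    {F : Config d → ℝ} (hFm : Measurable F) (hFb : ∃ C : ℝ, ∀ η, |F η| ≤ C)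
    (hF : IsLocalOn Λ F) : IsBoundedLocal F :=
  ⟨hFm, hFb, Λ, hΛ, hm, hF⟩

theorem enorm_integral_sub_le [Nontrivial (E d)] (hT : IsBirthDeathSemigroup b T)
    (hb : IsBoundedRate b c) (hΛ : Bornology.IsBounded Λ) (hm : MeasurableSet Λ)
    {F : Config d → ℝ} (hFm : Measurable F) (hFb : ∃ C : ℝ, ∀ η, |F η| ≤ C) (hF : IsLocalOn Λ F)
    (ω : Config d) (t : ℝ≥0) :
    ‖∫ η, F η ∂(T t ω) - F ω‖ₑ ≤
      ∫⁻ u in Set.Ioc (0 : ℝ) t, ∫⁻ η, domOp c hΛ (fun η => ‖F η‖ₑ) η ∂(T u.toNNReal ω) := by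
  have hle : ∫⁻ u in Set.Ioc (0 : ℝ) t, ∫⁻ η, ‖generator b F η‖ₑ ∂(T u.toNNReal ω) ≤
      ∫⁻ u in Set.Ioc (0 : ℝ) t, ∫⁻ η, domOp c hΛ (fun η => ‖F η‖ₑ) η ∂(T u.toNNReal ω) :=
    lintegral_mono fun u => lintegral_mono fun η => enorm_generator_le hΛ hb.nonneg hb.le hFm hF η
  refine le_trans ?_ hle
  -- If this integral is infinite the bound is trivial; otherwise Dynkin's formula applies. Hence no
  -- integrability assumption on F is needed.
  by_cases hfin : ∫⁻ u in Set.Ioc (0 : ℝ) t, ∫⁻ η, ‖generator b F η‖ₑ ∂(T u.toNNReal ω) = ∞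
  · rw [hfin]; exact le_top
  · rw [(hT.dynkin ω (isBoundedLocal_of_isLocalOn hΛ hm hFm hFb hF)
      (measurable_generator hb.measurable hΛ hm hFm hF) t hfin).2,
      intervalIntegral.integral_of_le t.coe_nonneg]
    refine (enorm_integral_le_lintegral_enorm _).trans ?_
    exact lintegral_mono fun u => enorm_integral_le_lintegral_enorm _

theorem lintegral_eq_iSup_min {α : Type*} [MeasurableSpace α] (m : Measure α) {G : α → ℝ≥0∞}
    (hG : Measurable G) : ∫⁻ a, G a ∂m = ⨆ n : ℕ, ∫⁻ a, min (G a) n ∂m := by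
  rw [← lintegral_iSup (fun n => hG.min measurable_const)
    (fun i j hij a => min_le_min le_rfl (by exact_mod_cast hij))]
  refine lintegral_congr fun a => ?_
  change G a = ⨆ n : ℕ, G a ⊓ (n : ℝ≥0∞)
  rw [← inf_iSup_eq, ENNReal.iSup_natCast, inf_top_eq]

theorem ofReal_le_ofReal_add_enorm_sub (a b : ℝ) :
    ENNReal.ofReal a ≤ ENNReal.ofReal b + ‖a - b‖ₑ := by
  rw [Real.enorm_eq_ofReal_abs]
  refine (ENNReal.ofReal_le_ofReal ?_).trans ENNReal.ofReal_add_le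
  linarith [le_abs_self (a - b)]

/-- Dynkin's formula needs bounded functions, so G is cut off at n. The dominating operator is
monotone, so its value at the cut-off is at most its value at G, and monotone convergence removes
the cut-off. -/
theorem lintegral_le_add_lintegral_domOp [Nontrivial (E d)] (hT : IsBirthDeathSemigroup b T)
    (hb : IsBoundedRate b c) (hΛ : Bornology.IsBounded Λ) (hm : MeasurableSet Λ)
    {G : Config d → ℝ≥0∞} (hGm : Measurable G) (hG : IsLocalOn Λ G) (ω : Config d) (t : ℝ≥0) :
    ∫⁻ η, G η ∂(T t ω) ≤ G ω +
      ∫⁻ u in Set.Ioc (0 : ℝ) t, ∫⁻ η, domOp c hΛ G η ∂(T u.toNNReal ω) := by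
  have := hT.isProbabilityMeasure t ω
  rw [lintegral_eq_iSup_min _ hGm]
  refine iSup_le fun n => ?_
  set F : Config d → ℝ := fun η => (min (G η) n).toReal with hFdef
  have hne : ∀ η, min (G η) n ≠ ∞ := fun η =>
    ((min_le_right _ _).trans_lt (ENNReal.natCast_lt_top n)).ne
  have hFm : Measurable F := (hGm.min measurable_const).ennreal_toReal
  have hFb : ∀ η, |F η| ≤ n := fun η => by
    rw [abs_of_nonneg ENNReal.toReal_nonneg]
    exact ENNReal.toReal_le_of_le_ofReal (by positivity) (by simp)
  have hFl : IsLocalOn Λ F := fun η => by simp only [hFdef, hG η]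
  have hFe : ∀ η, ‖F η‖ₑ = min (G η) n := fun η => by
    rw [Real.enorm_eq_ofReal ENNReal.toReal_nonneg, ENNReal.ofReal_toReal (hne η)]
  have hFi : Integrable F (T t ω) :=
    Integrable.of_bound hFm.aestronglyMeasurable n (Eventually.of_forall hFb)
  have h1 : ∫⁻ η, min (G η) n ∂(T t ω) = ENNReal.ofReal (∫ η, F η ∂(T t ω)) := by
    rw [ofReal_integral_eq_lintegral_ofReal hFi (Eventually.of_forall fun η =>
      ENNReal.toReal_nonneg)]
    exact lintegral_congr fun η => (ENNReal.ofReal_toReal (hne η)).symm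
  rw [h1]
  refine (ofReal_le_ofReal_add_enorm_sub _ (F ω)).trans ?_
  refine add_le_add ?_ ((enorm_integral_sub_le hT hb hΛ hm hFm ⟨n, hFb⟩ hFl ω t).trans ?_)
  · rw [ENNReal.ofReal_toReal (hne ω)]; exact min_le_left _ _
  · refine lintegral_mono fun u => lintegral_mono fun η => domOp_mono c hΛ (fun η => ?_) η
    rw [hFe]; exact min_le_left _ _

theorem isLocalOn_count (Λ : Set (E d)) : IsLocalOn Λ (count Λ) := fun η => by
  rw [count_restrict, Set.inter_self]

/-- Deaths do not increase the function, and a birth multiplies it by at most y. The one-sided bound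
is independent of M and drives the moment estimate; the absolute bound, which depends on M, only
provides integrability. -/
theorem generator_pow_min_count_le (hb : IsBoundedRate b c) (hΛ : Bornology.IsBounded Λ)
    {y : ℝ} (hy : 1 ≤ y) (M : ℕ) (η : Config d) :
    generator b (fun η => y ^ min (count Λ η) M) η ≤
      c * (volume Λ).toReal * (y - 1) * y ^ min (count Λ η) M ∧
    |generator b (fun η => y ^ min (count Λ η) M) η| ≤
      (c * (volume Λ).toReal * (y - 1) + M) * y ^ M := by
  have hy0 : 0 < y := one_pos.trans_le hy
  have hloc : ∀ η : Config d, y ^ min (count Λ (η.restrict Λ)) M = y ^ min (count Λ η) M := fun η => by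
    rw [isLocalOn_count Λ η]
  rw [generator_eq hΛ (F := fun η => y ^ min (count Λ η) M) hloc]
  set N := count Λ η with hN
  have hvol : volume Λ ≠ ∞ := hΛ.measure_lt_top.ne
  have hpM : y ^ min N M ≤ y ^ M := pow_le_pow_right₀ hy (min_le_right _ _)
  have hadd : ∀ x, 0 ≤ y ^ min (count Λ (η.add x)) M - y ^ min N M ∧
      y ^ min (count Λ (η.add x)) M - y ^ min N M ≤ (y - 1) * y ^ min N M := by
    intro x
    have h1 : N ≤ count Λ (η.add x) ∧ count Λ (η.add x) ≤ N + 1 := by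
      rw [count_add hΛ]; split_ifs <;> omega
    have h2 : y ^ min N M ≤ y ^ min (count Λ (η.add x)) M := pow_le_pow_right₀ hy (by omega)
    have h3 : y ^ min (count Λ (η.add x)) M ≤ y ^ (min N M + 1) := pow_le_pow_right₀ hy (by omega)
    rw [pow_succ] at h3
    constructor <;> nlinarith
  have hB0 : 0 ≤ ∫ x in Λ, b x η * (y ^ min (count Λ (η.add x)) M - y ^ min N M) :=
    integral_nonneg fun x => mul_nonneg (hb.nonneg _ _) (hadd x).1
  have hB1 : ∫ x in Λ, b x η * (y ^ min (count Λ (η.add x)) M - y ^ min N M) ≤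
      c * (volume Λ).toReal * (y - 1) * y ^ min N M := by
    have : IsFiniteMeasure (volume.restrict Λ) := ⟨by simpa using hvol.lt_top⟩
    calc _ ≤ ∫ x in Λ, c * ((y - 1) * y ^ min N M) := by
          refine integral_mono_of_nonneg (Eventually.of_forall fun x =>
            mul_nonneg (hb.nonneg _ _) (hadd x).1) (integrable_const _)
            (Eventually.of_forall fun x => ?_)
          exact mul_le_mul (hb.le _ _) (hadd x).2 (hadd x).1 c.coe_nonneg
      _ = _ := by
          rw [setIntegral_const, smul_eq_mul, measureReal_def]; ring
  have hrem : ∀ x ∈ η.points hΛ, count Λ (η.remove x) = N - 1 := by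
    intro x hx
    rw [count_remove hΛ, if_pos (mem_points.1 hx).symm]
  have hD : ∑ x ∈ η.points hΛ, (y ^ min (count Λ (η.remove x)) M - y ^ min N M) =
      N * (y ^ min (N - 1) M - y ^ min N M) := by
    rw [Finset.sum_congr rfl fun x hx => by rw [hrem x hx], Finset.sum_const, card_points,
      nsmul_eq_mul]
  have hD0 : N * (y ^ min (N - 1) M - y ^ min N M) ≤ 0 := by
    refine mul_nonpos_of_nonneg_of_nonpos (Nat.cast_nonneg _) ?_
    have : y ^ min (N - 1) M ≤ y ^ min N M := pow_le_pow_right₀ hy (by omega)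
    linarith
  -- For N > M a death does not change the truncated count, so the loss rate is effectively at most
  -- M.
  have hD1 : -(M * y ^ M) ≤ N * (y ^ min (N - 1) M - y ^ min N M) := by
    by_cases hNM : N ≤ M
    · have h1 : (0 : ℝ) ≤ y ^ min (N - 1) M := by positivity
      have h2 : (N : ℝ) ≤ M := by exact_mod_cast hNM
      have h3 : (N : ℝ) * y ^ min N M ≤ M * y ^ M := by gcongr
      nlinarith [mul_nonneg (Nat.cast_nonneg (α := ℝ) N) h1]
    · rw [show min (N - 1) M = M by omega, show min N M = M by omega, sub_self, mul_zero]
      have : 0 ≤ (M : ℝ) * y ^ M := by positivity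
      linarith
  have hB2 : c * (volume Λ).toReal * (y - 1) * y ^ min N M ≤
      c * (volume Λ).toReal * (y - 1) * y ^ M := by
    refine mul_le_mul_of_nonneg_left hpM ?_
    have := c.coe_nonneg
    have : 0 ≤ (volume Λ).toReal := ENNReal.toReal_nonneg
    have : 0 ≤ y - 1 := by linarith
    positivity
  rw [hD]
  refine ⟨by linarith, abs_le.2 ⟨?_, ?_⟩⟩
  · have h5 : 0 ≤ c * (volume Λ).toReal * (y - 1) * y ^ min N M := hB0.trans hB1
    nlinarith
  · have h5 : 0 ≤ (M : ℝ) * y ^ M := by positivity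
    nlinarith

theorem lintegral_pow_count_le [Nontrivial (E d)] (hT : IsBirthDeathSemigroup b T)
    (hb : IsBoundedRate b c) (hΛ : Bornology.IsBounded Λ) (hm : MeasurableSet Λ)
    {y : ℝ≥0} (hy : 1 ≤ y) {ε : ℝ≥0} (hε : (ε : ℝ) * (c * (volume Λ).toReal * (y - 1)) ≤ 1 / 2)
    {t : ℝ≥0} (ht : t ≤ ε) (ω : Config d) :
    ∫⁻ η, (y : ℝ≥0∞) ^ count Λ η ∂(T t ω) ≤ 2 * (y : ℝ≥0∞) ^ count Λ ω := by
  have hprob : ∀ t, IsProbabilityMeasure (T t ω) := fun t => hT.isProbabilityMeasure t ω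
  have hy1 : (1 : ℝ) ≤ y := by exact_mod_cast hy
  have hy0 : (0 : ℝ) < y := one_pos.trans_le hy1
  set a : ℝ := c * (volume Λ).toReal * (y - 1) with ha
  have ha0 : 0 ≤ a := by
    have : (0 : ℝ) ≤ y - 1 := by linarith
    have : 0 ≤ (volume Λ).toReal := ENNReal.toReal_nonneg
    have := c.coe_nonneg
    positivity
  have key : ∀ M : ℕ, ∀ t ≤ ε, ∫ η, (y : ℝ) ^ min (count Λ η) M ∂(T t ω) ≤
      2 * (y : ℝ) ^ min (count Λ ω) M := by
    intro M
    set V : Config d → ℝ := fun η => (y : ℝ) ^ min (count Λ η) M with hV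
    have hVm : Measurable V := (measurable_from_top (f := fun n : ℕ => (y : ℝ) ^ min n M)).comp
      (measurable_count hΛ hm)
    have hV0 : ∀ η, 0 ≤ V η := fun η => by positivity
    have hVM : ∀ η, V η ≤ (y : ℝ) ^ M := fun η => pow_le_pow_right₀ hy1 (min_le_right _ _)
    have hVb : ∀ η, |V η| ≤ (y : ℝ) ^ M := fun η => by rw [abs_of_nonneg (hV0 η)]; exact hVM η
    have hVl : IsLocalOn Λ V := fun η => by simp only [hV, isLocalOn_count Λ η]
    have hVi : ∀ t, Integrable V (T t ω) := fun t =>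
      Integrable.of_bound hVm.aestronglyMeasurable _ (Eventually.of_forall hVb)
    have hgm : Measurable (generator b V) := measurable_generator hb.measurable hΛ hm hVm hVl
    set B : ℝ := (a + M) * (y : ℝ) ^ M with hB
    have hgen := generator_pow_min_count_le hb hΛ hy1 M
    have hgb : ∀ η, ‖generator b V η‖ ≤ B := fun η => (hgen η).2
    have hgi : ∀ t, Integrable (generator b V) (T t ω) := fun t =>
      Integrable.of_bound hgm.aestronglyMeasurable _ (Eventually.of_forall hgb)
    have hfin : ∀ t : ℝ≥0, ∫⁻ u in Set.Ioc (0 : ℝ) t, ∫⁻ η, ‖generator b V η‖ₑ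
        ∂(T u.toNNReal ω) ≠ ∞ := by
      intro t
      have : ∫⁻ u in Set.Ioc (0 : ℝ) t, ∫⁻ η, ‖generator b V η‖ₑ ∂(T u.toNNReal ω) ≤
          ∫⁻ u in Set.Ioc (0 : ℝ) t, ENNReal.ofReal B := by
        refine lintegral_mono fun u => ?_
        calc _ ≤ ∫⁻ η, ENNReal.ofReal B ∂(T u.toNNReal ω) := by
              refine lintegral_mono fun η => ?_
              rw [← ofReal_norm]
              exact ENNReal.ofReal_le_ofReal (hgb η)
          _ = _ := by simp
      refine (this.trans_lt ?_).ne
      rw [setLIntegral_const, Real.volume_Ioc]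
      exact ENNReal.mul_lt_top ENNReal.ofReal_lt_top ENNReal.ofReal_lt_top
    set v : ℝ≥0 → ℝ := fun t => ∫ η, V η ∂(T t ω) with hv
    have hvM : ∀ t, v t ≤ (y : ℝ) ^ M := fun t => by
      calc v t ≤ ∫ η, (y : ℝ) ^ M ∂(T t ω) := integral_mono (hVi t) (integrable_const _) hVM
        _ = _ := by simp
    -- The smallness of ε makes the time integral at most S / 2. With S the supremum up to time ε,
    -- finite because of the cut-off M, this gives S ≤ V ω + S / 2, that is S ≤ 2 V ω, in place of
    -- Grönwall's inequality.
    have hstep : ∀ S : ℝ, 0 ≤ S → (∀ u ≤ ε, v u ≤ S) → ∀ t ≤ ε, v t ≤ V ω + S / 2 := by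
      intro S hS0 hS t ht
      obtain ⟨hii, heq⟩ := hT.dynkin ω (isBoundedLocal_of_isLocalOn hΛ hm hVm ⟨_, hVb⟩ hVl) hgm t
        (hfin t)
      have h1 : ∫ u in (0 : ℝ)..t, ∫ η, generator b V η ∂(T u.toNNReal ω) ≤
          ∫ u in (0 : ℝ)..t, a * S := by
        refine intervalIntegral.integral_mono_on t.coe_nonneg hii (by simp) fun u hu => ?_
        have hu' : u.toNNReal ≤ ε := by
          refine le_trans ?_ ht
          rw [Real.toNNReal_le_iff_le_coe]; exact hu.2
        calc _ ≤ ∫ η, a * V η ∂(T u.toNNReal ω) :=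
              integral_mono (hgi _) ((hVi _).const_mul _) fun η => (hgen η).1
          _ = a * v u.toNNReal := integral_const_mul _ _
          _ ≤ a * S := mul_le_mul_of_nonneg_left (hS _ hu') ha0
      rw [intervalIntegral.integral_const, smul_eq_mul, sub_zero] at h1
      have h2 : (t : ℝ) * (a * S) ≤ S / 2 := by
        have h3 : (t : ℝ) * a ≤ ε * a :=
          mul_le_mul_of_nonneg_right (by exact_mod_cast ht) ha0
        nlinarith
      have : v t - V ω ≤ S / 2 := by
        rw [hv]; simp only; rw [heq]; linarith
      linarith
    have hbdd : BddAbove (Set.range fun u : Set.Iic ε => v u.1) :=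
      ⟨(y : ℝ) ^ M, by rintro _ ⟨u, rfl⟩; exact hvM _⟩
    set S : ℝ := ⨆ u : Set.Iic ε, v u.1 with hS
    have hvS : ∀ u ≤ ε, v u ≤ S := fun u hu => le_ciSup hbdd ⟨u, hu⟩
    have hS0 : 0 ≤ S := (integral_nonneg (fun η => hV0 η)).trans (hvS 0 zero_le)
    have : Nonempty (Set.Iic ε) := ⟨⟨0, Set.mem_Iic.2 zero_le⟩⟩
    have hSle : S ≤ V ω + S / 2 := ciSup_le fun u => hstep S hS0 hvS u.1 u.2
    intro t ht
    calc v t ≤ S := hvS t ht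
      _ ≤ _ := by linarith
  have hcoe : ∀ (M : ℕ) (η : Config d), ENNReal.ofReal ((y : ℝ) ^ min (count Λ η) M) =
      (y : ℝ≥0∞) ^ min (count Λ η) M := fun M η => by
    rw [ENNReal.ofReal_pow hy0.le, ENNReal.ofReal_coe_nnreal]
  have hy' : (1 : ℝ≥0∞) ≤ y := by exact_mod_cast hy
  have hsup : ∀ η : Config d, (y : ℝ≥0∞) ^ count Λ η = ⨆ M : ℕ, (y : ℝ≥0∞) ^ min (count Λ η) M := by
    intro η
    refine le_antisymm ?_ (iSup_le fun M => pow_le_pow_right₀ hy' (min_le_left _ _))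
    exact le_iSup_of_le (count Λ η) (by rw [min_self])
  simp_rw [hsup]
  rw [lintegral_iSup (fun M => measurable_weight hΛ hm fun n => (y : ℝ≥0∞) ^ min n M)
    (fun i j hij η => pow_le_pow_right₀ hy' (min_le_min le_rfl hij))]
  refine iSup_le fun M => ?_
  have hVi : Integrable (fun η : Config d => (y : ℝ) ^ min (count Λ η) M) (T t ω) := by
    refine Integrable.of_bound ((measurable_from_top (f := fun n : ℕ => (y : ℝ) ^ min n M)).comp
      (measurable_count hΛ hm)).aestronglyMeasurable ((y : ℝ) ^ M) (Eventually.of_forall fun η => ?_)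
    rw [Real.norm_of_nonneg (by positivity)]
    exact pow_le_pow_right₀ hy1 (min_le_right _ _)
  calc ∫⁻ η, (y : ℝ≥0∞) ^ min (count Λ η) M ∂(T t ω)
      = ENNReal.ofReal (∫ η, (y : ℝ) ^ min (count Λ η) M ∂(T t ω)) := by
        rw [ofReal_integral_eq_lintegral_ofReal hVi (Eventually.of_forall fun η => by positivity)]
        exact lintegral_congr fun η => (hcoe M η).symm
    _ ≤ ENNReal.ofReal (2 * (y : ℝ) ^ min (count Λ ω) M) := ENNReal.ofReal_le_ofReal (key M t ht)
    _ = 2 * (y : ℝ≥0∞) ^ min (count Λ ω) M := by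
        rw [ENNReal.ofReal_mul (by norm_num), hcoe]; simp
    _ ≤ _ := by
        gcongr
        exact le_iSup (fun M : ℕ => (y : ℝ≥0∞) ^ min (count Λ ω) M) M

end Estimates

/-! ### Iterated Dynkin inequality and first-order estimate for events -/

/-- The coefficients of the exponential series. -/
noncomputable def expCoeff (t : ℝ≥0) (k : ℕ) : ℝ≥0∞ := (t : ℝ≥0∞) ^ k * (k.factorial : ℝ≥0∞)⁻¹

theorem expCoeff_zero (t : ℝ≥0) : expCoeff t 0 = 1 := by simp [expCoeff]

theorem expCoeff_mono {s t : ℝ≥0} (h : s ≤ t) (k : ℕ) : expCoeff s k ≤ expCoeff t k := by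
  unfold expCoeff; gcongr

theorem expCoeff_eq_ofReal (t : ℝ≥0) (k : ℕ) :
    expCoeff t k = ENNReal.ofReal ((t : ℝ) ^ k / k.factorial) := by
  rw [expCoeff, ENNReal.ofReal_div_of_pos (by positivity), ENNReal.ofReal_pow t.coe_nonneg,
    ENNReal.ofReal_coe_nnreal, ENNReal.ofReal_natCast, div_eq_mul_inv]

theorem measurable_expCoeff (k : ℕ) : Measurable fun u : ℝ => expCoeff u.toNNReal k := by
  unfold expCoeff; fun_prop

theorem lintegral_expCoeff (t : ℝ≥0) (k : ℕ) :
    ∫⁻ u in Set.Ioc (0 : ℝ) t, expCoeff u.toNNReal k = expCoeff t (k + 1) := by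
  have h1 : ∫⁻ u in Set.Ioc (0 : ℝ) t, expCoeff u.toNNReal k =
      ∫⁻ u in Set.Ioc (0 : ℝ) t, ENNReal.ofReal (u ^ k / k.factorial) := by
    refine setLIntegral_congr_fun measurableSet_Ioc fun u hu => ?_
    rw [expCoeff_eq_ofReal, Real.coe_toNNReal _ hu.1.le]
  have hi : IntervalIntegrable (fun u : ℝ => u ^ k / k.factorial) volume 0 t :=
    (Continuous.intervalIntegrable (by fun_prop) _ _)
  rw [h1, ← ofReal_integral_eq_lintegral_ofReal
    ((intervalIntegrable_iff_integrableOn_Ioc_of_le t.coe_nonneg).1 hi),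
    ← intervalIntegral.integral_of_le t.coe_nonneg, intervalIntegral.integral_div, integral_pow,
    expCoeff_eq_ofReal, Nat.factorial_succ]
  · congr 1
    push_cast
    rw [zero_pow (by omega), sub_zero]
    field_simp
  · filter_upwards [ae_restrict_mem measurableSet_Ioc] with u hu
    have := hu.1.le
    positivity

/-- Bound for the products of exponential coefficients and factorials. -/
theorem expCoeff_mul_factorial_succ_le (t : ℝ≥0) (k : ℕ) :
    expCoeff t k * (k + 1).factorial ≤ (2 * (t : ℝ≥0∞)) ^ k := by
  have h0 : (k.factorial : ℝ≥0∞) ≠ 0 := by exact_mod_cast k.factorial_ne_zero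
  have h1 : ((k + 1 : ℕ) : ℝ≥0∞) ≤ 2 ^ k := by exact_mod_cast Nat.succ_le_of_lt Nat.lt_two_pow_self
  rw [Nat.factorial_succ, Nat.cast_mul, expCoeff, mul_pow]
  calc _ = ((k + 1 : ℕ) : ℝ≥0∞) * (t : ℝ≥0∞) ^ k *
        ((k.factorial : ℝ≥0∞)⁻¹ * k.factorial) := by ring
    _ = ((k + 1 : ℕ) : ℝ≥0∞) * (t : ℝ≥0∞) ^ k := by
        rw [ENNReal.inv_mul_cancel h0 (ENNReal.natCast_ne_top _), mul_one]
    _ ≤ _ := by gcongr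

section Iteration

variable {b : E d → Config d → ℝ} {c : ℝ≥0} {T : ℝ≥0 → Kernel (Config d) (Config d)}
  {Λ : Set (E d)}

/-- The Taylor expansion of an exponential semigroup, as an inequality: the one-step bound is
applied to G, then to its image under the dominating operator, and so on. Integrating u^k/k! in time
produces the next coefficient. -/
theorem lintegral_le_sum_domOp_iterate [Nontrivial (E d)] (hT : IsBirthDeathSemigroup b T)
    (hb : IsBoundedRate b c) (hΛ : Bornology.IsBounded Λ) (hm : MeasurableSet Λ)
    (ω : Config d) {ε : ℝ≥0} {R : ℝ≥0∞} (n : ℕ) {G : Config d → ℝ≥0∞} (hGm : Measurable G)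
    (hG : IsLocalOn Λ G) (hR : ∀ u ≤ ε, ∫⁻ η, (domOp c hΛ)^[n] G η ∂(T u ω) ≤ R)
    {t : ℝ≥0} (ht : t ≤ ε) :
    ∫⁻ η, G η ∂(T t ω) ≤
      ∑ k ∈ Finset.range n, expCoeff t k * (domOp c hΛ)^[k] G ω + expCoeff t n * R := by
  induction n generalizing G t with
  | zero => simpa [expCoeff_zero] using hR t ht
  | succ n ih =>
    refine (lintegral_le_add_lintegral_domOp hT hb hΛ hm hGm hG ω t).trans ?_
    have hstep : ∀ u ∈ Set.Ioc (0 : ℝ) t, ∫⁻ η, domOp c hΛ G η ∂(T u.toNNReal ω) ≤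
        ∑ k ∈ Finset.range n, expCoeff u.toNNReal k * (domOp c hΛ)^[k + 1] G ω +
          expCoeff u.toNNReal n * R := by
      intro u hu
      have hu' : u.toNNReal ≤ ε := (Real.toNNReal_le_iff_le_coe.2 hu.2).trans ht
      exact ih (measurable_domOp c hΛ hm hGm) (domOp_restrict c hΛ hm hG) hR hu'
    calc _ ≤ G ω + ∫⁻ u in Set.Ioc (0 : ℝ) t,
          (∑ k ∈ Finset.range n, expCoeff u.toNNReal k * (domOp c hΛ)^[k + 1] G ω +
            expCoeff u.toNNReal n * R) := by
          gcongr G ω + ?_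
          exact setLIntegral_mono' measurableSet_Ioc hstep
      _ = G ω + (∑ k ∈ Finset.range n, expCoeff t (k + 1) * (domOp c hΛ)^[k + 1] G ω +
            expCoeff t (n + 1) * R) := by
          rw [lintegral_add_right _ ((measurable_expCoeff n).mul_const _), lintegral_finsetSum]
          · simp_rw [lintegral_mul_const _ (measurable_expCoeff _), lintegral_expCoeff]
          · exact fun k _ => (measurable_expCoeff k).mul_const _
      _ = _ := by
          rw [Finset.sum_range_succ', expCoeff_zero, Function.iterate_zero, id, one_mul]
          ring

/-- The series `∑ ε^k / k! K^{k+1} F` for the dominating operator `K`. -/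
noncomputable def domSeries (c : ℝ≥0) (hΛ : Bornology.IsBounded Λ) (ε : ℝ≥0)
    (F : Config d → ℝ≥0∞) (ω : Config d) : ℝ≥0∞ :=
  ∑' k : ℕ, expCoeff ε k * (domOp c hΛ)^[k + 1] F ω

/-- The remainder of the expansion vanishes as n → ∞ because F ≤ 1. The surviving bound is uniform
in t ≤ ε and still linear in F, which allows the duality with the Poisson process to act on it. -/
theorem lintegral_domOp_le_domSeries [Nontrivial (E d)] (hT : IsBirthDeathSemigroup b T)
    (hb : IsBoundedRate b c) (hΛ : Bornology.IsBounded Λ) (hm : MeasurableSet Λ)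
    {ε : ℝ≥0} (hε : 8 * (ε : ℝ≥0∞) * growthConst c (volume Λ) ≤ 1)
    (hε' : (ε : ℝ) * (c * (volume Λ).toReal) ≤ 1 / 2)
    {F : Config d → ℝ≥0∞} (hFm : Measurable F) (hF : IsLocalOn Λ F) (hF1 : ∀ η, F η ≤ 1)
    (ω : Config d) {t : ℝ≥0} (ht : t ≤ ε) :
    ∫⁻ η, domOp c hΛ F η ∂(T t ω) ≤ domSeries c hΛ ε F ω := by
  set a := growthConst c (volume Λ) with ha
  have hR : ∀ (n : ℕ) (u : ℝ≥0), u ≤ ε → ∫⁻ η, (domOp c hΛ)^[n] (domOp c hΛ F) η ∂(T u ω) ≤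
      a ^ (n + 1) * ((n + 1).factorial * 2 ^ (n + 1)) * (2 * 2 ^ count Λ ω) := by
    intro n u hu
    have h1 : ∀ η, (domOp c hΛ)^[n] (domOp c hΛ F) η ≤
        a ^ (n + 1) * ((n + 1).factorial * 2 ^ (n + 1)) * 2 ^ count Λ η := fun η =>
      (domOp_iterate_mono c hΛ hF1 (n + 1) η).trans (domOp_iterate_one_le c hΛ (n + 1) η)
    have h2 := lintegral_pow_count_le hT hb hΛ hm (y := 2) (by norm_num) (ε := ε)
      (by push_cast; linarith) hu ω
    calc _ ≤ ∫⁻ η, a ^ (n + 1) * ((n + 1).factorial * 2 ^ (n + 1)) * 2 ^ count Λ η ∂(T u ω) :=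
          lintegral_mono h1
      _ = a ^ (n + 1) * ((n + 1).factorial * 2 ^ (n + 1)) * ∫⁻ η, 2 ^ count Λ η ∂(T u ω) :=
          lintegral_const_mul _ (measurable_weight hΛ hm fun n => (2 : ℝ≥0∞) ^ n)
      _ ≤ _ := by gcongr; exact h2
  -- The factorials cancel up to n + 1 ≤ 2^n, leaving the ratio 4ta, which is at most 1/2 by the
  -- condition 8εa ≤ 1.
  have hrem : ∀ n : ℕ, expCoeff t n *
      (a ^ (n + 1) * ((n + 1).factorial * 2 ^ (n + 1)) * (2 * 2 ^ count Λ ω)) ≤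
      (4 * a * 2 ^ count Λ ω) * (1 / 2) ^ n := by
    intro n
    have h4 : 4 * (t : ℝ≥0∞) * a ≤ 1 / 2 := by
      rw [ENNReal.le_div_iff_mul_le (by simp) (by simp)]
      calc 4 * (t : ℝ≥0∞) * a * 2 = 8 * t * a := by ring
        _ ≤ 8 * ε * a := by gcongr
        _ ≤ 1 := hε
    calc _ = (expCoeff t n * (n + 1).factorial) * (2 * a) ^ n * (4 * a * 2 ^ count Λ ω) := by
          rw [mul_pow]; ring
      _ ≤ (2 * (t : ℝ≥0∞)) ^ n * (2 * a) ^ n * (4 * a * 2 ^ count Λ ω) := by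
          gcongr; exact expCoeff_mul_factorial_succ_le t n
      _ = (4 * a * 2 ^ count Λ ω) * (4 * t * a) ^ n := by
          rw [← mul_pow]; ring_nf
      _ ≤ _ := by gcongr
  have hle : ∀ n : ℕ, ∫⁻ η, domOp c hΛ F η ∂(T t ω) ≤
      domSeries c hΛ ε F ω + (4 * a * 2 ^ count Λ ω) * (1 / 2) ^ n := by
    intro n
    refine (lintegral_le_sum_domOp_iterate hT hb hΛ hm ω n (measurable_domOp c hΛ hm hFm)
      (domOp_restrict c hΛ hm hF) (hR n) ht).trans (add_le_add ?_ (hrem n))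
    refine le_trans ?_ (ENNReal.sum_le_tsum (Finset.range n))
    refine Finset.sum_le_sum fun k _ => ?_
    exact mul_le_mul' (expCoeff_mono ht k) le_rfl
  have hat : a ≠ ∞ := by
    have hv : volume Λ ≠ ∞ := hΛ.measure_lt_top.ne
    rw [ha, growthConst]
    simp [ENNReal.mul_ne_top, hv]
  have htend : Tendsto (fun n : ℕ => domSeries c hΛ ε F ω +
      (4 * a * 2 ^ count Λ ω) * (1 / 2) ^ n) atTop
      (𝓝 (domSeries c hΛ ε F ω + (4 * a * 2 ^ count Λ ω) * 0)) := by
    refine tendsto_const_nhds.add (ENNReal.Tendsto.const_mul ?_ (Or.inr ?_))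
    · exact ENNReal.tendsto_pow_atTop_nhds_zero_of_lt_one (by simp)
    · exact ENNReal.mul_ne_top (ENNReal.mul_ne_top (by simp) hat) (by simp)
  rw [mul_zero, add_zero] at htend
  exact ge_of_tendsto' htend hle

/-- First-order estimate for local events. -/
theorem measure_le_add_domSeries [Nontrivial (E d)] (hT : IsBirthDeathSemigroup b T)
    (hb : IsBoundedRate b c) (hΛ : Bornology.IsBounded Λ) (hm : MeasurableSet Λ)
    {ε : ℝ≥0} (hε : 8 * (ε : ℝ≥0∞) * growthConst c (volume Λ) ≤ 1)
    (hε' : (ε : ℝ) * (c * (volume Λ).toReal) ≤ 1 / 2)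
    {A : Set (Config d)} (hA : MeasurableSet A) (hAl : IsLocalOn Λ (A.indicator (1 : Config d → ℝ≥0∞)))
    (ω : Config d) {t : ℝ≥0} (ht : t ≤ ε) :
    T t ω A ≤ A.indicator 1 ω + t * domSeries c hΛ ε (A.indicator 1) ω ∧
    A.indicator 1 ω ≤ T t ω A + t * domSeries c hΛ ε (A.indicator 1) ω := by
  have := hT.isProbabilityMeasure t ω
  set G : Config d → ℝ≥0∞ := A.indicator 1 with hG
  set F : Config d → ℝ := A.indicator 1 with hFdef
  have hFm : Measurable F := measurable_one.indicator hA
  have hGm : Measurable G := measurable_one.indicator hA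
  have hFG : ∀ η, F η = (G η).toReal := fun η => by
    by_cases h : η ∈ A <;> simp [hFdef, hG, h]
  have hGe : ∀ η, ENNReal.ofReal (F η) = G η := fun η => by
    by_cases h : η ∈ A <;> simp [hFdef, hG, h]
  have hG1 : ∀ η, G η ≤ 1 := fun η => Set.indicator_le_self' (by simp) η
  have hFb : ∀ η, |F η| ≤ 1 := fun η => by
    by_cases h : η ∈ A <;> simp [hFdef, h]
  have hFl : IsLocalOn Λ F := fun η => by rw [hFG, hFG, hAl η]
  have hFe : (fun η => ‖F η‖ₑ) = G := by
    ext η; by_cases h : η ∈ A <;> simp [hFdef, hG, h]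
  have hTA : ENNReal.ofReal (∫ η, F η ∂(T t ω)) = T t ω A := by
    rw [hFdef, integral_indicator_one hA, ofReal_measureReal]
  have hbound : ‖∫ η, F η ∂(T t ω) - F ω‖ₑ ≤ t * domSeries c hΛ ε G ω := by
    refine (enorm_integral_sub_le hT hb hΛ hm hFm ⟨1, hFb⟩ hFl ω t).trans ?_
    rw [hFe]
    calc _ ≤ ∫⁻ u in Set.Ioc (0 : ℝ) t, domSeries c hΛ ε G ω := by
          refine setLIntegral_mono' measurableSet_Ioc fun u hu => ?_
          exact lintegral_domOp_le_domSeries hT hb hΛ hm hε hε' hGm hAl hG1 ω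
            ((Real.toNNReal_le_iff_le_coe.2 hu.2).trans ht)
      _ = _ := by
          rw [setLIntegral_const, Real.volume_Ioc, sub_zero, ENNReal.ofReal_coe_nnreal, mul_comm]
  constructor
  · rw [← hTA, ← hGe]
    exact (ofReal_le_ofReal_add_enorm_sub _ _).trans (add_le_add le_rfl hbound)
  · rw [← hTA, ← hGe]
    refine (ofReal_le_ofReal_add_enorm_sub _ (∫ η, F η ∂(T t ω))).trans (add_le_add le_rfl ?_)
    rwa [enorm_sub_rev]

end Iteration

/-! ### The evolved marginal stays close to the initial marginal -/

section Density

variable {b : E d → Config d → ℝ} {c : ℝ≥0} {T : ℝ≥0 → Kernel (Config d) (Config d)}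
  {Λ : Set (E d)}

theorem growthConst_ne_top (c : ℝ≥0) (hΛ : Bornology.IsBounded Λ) :
    growthConst c (volume Λ) ≠ ∞ := by
  have hv : volume Λ ≠ ∞ := hΛ.measure_lt_top.ne
  rw [growthConst]
  simp [ENNReal.mul_ne_top, hv]

theorem measurable_domSeries (c : ℝ≥0) (hΛ : Bornology.IsBounded Λ) (hm : MeasurableSet Λ)
    (ε : ℝ≥0) {F : Config d → ℝ≥0∞} (hF : Measurable F) : Measurable (domSeries c hΛ ε F) :=
  Measurable.tsum fun k => (measurable_domOp_iterate c hΛ hm hF (k + 1)).const_mul _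

theorem tsum_expCoeff_dualOp_le (c : ℝ≥0) (v : ℝ≥0∞) {ε z : ℝ≥0} (hz : 1 ≤ z)
    (hε : 8 * (ε : ℝ≥0∞) * (growthConst c v * z) ≤ 1) (n : ℕ) :
    ∑' k : ℕ, expCoeff ε k * (dualOp c v)^[k + 1] (fun n => (z : ℝ≥0∞) ^ n) n ≤
      4 * growthConst c v * z * (2 * (z : ℝ≥0∞)) ^ n := by
  set a := growthConst c v with ha
  have h4 : 4 * (ε : ℝ≥0∞) * (a * z) ≤ 2⁻¹ := by
    rw [← one_div, ENNReal.le_div_iff_mul_le (by simp) (by simp)]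
    calc 4 * (ε : ℝ≥0∞) * (a * z) * 2 = 8 * ε * (a * z) := by ring
      _ ≤ 1 := hε
  have hterm : ∀ k : ℕ, expCoeff ε k * (dualOp c v)^[k + 1] (fun n => (z : ℝ≥0∞) ^ n) n ≤
      (2 * a * z * (2 * (z : ℝ≥0∞)) ^ n) * 2⁻¹ ^ k := by
    intro k
    have h1 : (((n + 1).ascFactorial (k + 1) : ℕ) : ℝ≥0∞) ≤
        (k + 1).factorial * 2 ^ (n + (k + 1)) := by
      exact_mod_cast ascFactorial_le_factorial_mul_two_pow n (k + 1)
    calc _ ≤ expCoeff ε k * (a ^ (k + 1) * ((k + 1).factorial * 2 ^ (n + (k + 1))) *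
          (z : ℝ≥0∞) ^ (n + (k + 1))) := by
          gcongr
          exact (dualOp_iterate_pow_le c v hz (k + 1) n).trans (by gcongr)
      _ = (2 * a * z * (2 * (z : ℝ≥0∞)) ^ n) *
          ((expCoeff ε k * (k + 1).factorial) * (2 * a * z) ^ k) := by
          simp only [mul_pow, pow_add, pow_one]; ring
      _ ≤ (2 * a * z * (2 * (z : ℝ≥0∞)) ^ n) * ((2 * (ε : ℝ≥0∞)) ^ k * (2 * a * z) ^ k) := by
          gcongr; exact expCoeff_mul_factorial_succ_le ε k
      _ = (2 * a * z * (2 * (z : ℝ≥0∞)) ^ n) * (4 * (ε : ℝ≥0∞) * (a * z)) ^ k := by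
          rw [← mul_pow]; ring_nf
      _ ≤ _ := by gcongr
  refine (ENNReal.tsum_le_tsum hterm).trans ?_
  rw [ENNReal.tsum_mul_left, ENNReal.tsum_geometric, ENNReal.one_sub_inv_two, inv_inv]
  exact le_of_eq (by ring)

/-- Pass from μ_Λ to the Poisson process by the density bound, move the iterates onto z^{N_Λ} by
duality, sum the geometric series, and return to μ_Λ. The two changes of measure account for A² and
for the base 2z². -/
theorem lintegral_domSeries_le [NullSingletonClass (volume : Measure (E d))]
    (c : ℝ≥0) (hΛ : Bornology.IsBounded Λ) (hm : MeasurableSet Λ) {μ : Measure (Config d)}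
    {A z : ℝ≥0} (hμ : IsPoissonComparable Λ (marginal μ Λ) A z) {ε : ℝ≥0}
    (hε : 8 * (ε : ℝ≥0∞) * (growthConst c (volume Λ) * z) ≤ 1)
    {F : Config d → ℝ≥0∞} (hFm : Measurable F) (hF : IsLocalOn Λ F) :
    ∫⁻ ω, domSeries c hΛ ε F ω ∂μ ≤
      ∫⁻ η, (4 * A ^ 2 * growthConst c (volume Λ) * z) * (2 * (z : ℝ≥0∞) ^ 2) ^ count Λ η * F η
        ∂(marginal μ Λ) := by
  set a := growthConst c (volume Λ) with ha
  have hK := fun k => measurable_domOp_iterate c hΛ hm hFm k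
  have hw : ∀ W : ℕ → ℝ≥0∞, Measurable fun η : Config d => W (count Λ η) :=
    measurable_weight hΛ hm
  have h1 : ∀ k, ∫⁻ ω, (domOp c hΛ)^[k] F ω ∂μ ≤
      A * ∫⁻ η, (dualOp c (volume Λ))^[k] (fun n => (z : ℝ≥0∞) ^ n) (count Λ η) * F η
        ∂(poisson Λ) := by
    intro k
    calc _ = ∫⁻ ω, (domOp c hΛ)^[k] F (ω.restrict Λ) ∂μ := by
          refine lintegral_congr fun ω => ?_
          rw [domOp_iterate_restrict c hΛ hm hF]
      _ = ∫⁻ ω, (domOp c hΛ)^[k] F ω ∂(marginal μ Λ) := (lintegral_marginal hm μ (hK k)).symm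
      _ ≤ _ := hμ.le _ (hK k)
      _ = A * ∫⁻ η, (z : ℝ≥0∞) ^ count Λ η * (domOp c hΛ)^[k] F η ∂(poisson Λ) := by
          simp_rw [mul_assoc]
          exact lintegral_const_mul _ ((hw fun n => (z : ℝ≥0∞) ^ n).mul (hK k))
      _ = _ := by
          rw [lintegral_poisson_domOp_iterate c hΛ hm (fun n => (z : ℝ≥0∞) ^ n) hFm k]
  unfold domSeries
  rw [lintegral_tsum fun k => ((hK (k + 1)).const_mul _).aemeasurable]
  calc _ ≤ ∑' k, A * ∫⁻ η, expCoeff ε k *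
        ((dualOp c (volume Λ))^[k + 1] (fun n => (z : ℝ≥0∞) ^ n) (count Λ η)) * F η
          ∂(poisson Λ) := by
        refine ENNReal.tsum_le_tsum fun k => ?_
        rw [lintegral_const_mul _ (hK (k + 1))]
        simp_rw [mul_assoc]
        have hd : Measurable fun η => (dualOp c (volume Λ))^[k + 1] (fun n => (z : ℝ≥0∞) ^ n)
          (count Λ η) * F η := (hw _).mul hFm
        rw [lintegral_const_mul _ hd]
        calc _ ≤ expCoeff ε k * (A * ∫⁻ η, (dualOp c (volume Λ))^[k + 1]
                (fun n => (z : ℝ≥0∞) ^ n) (count Λ η) * F η ∂(poisson Λ)) := by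
                gcongr; exact h1 (k + 1)
          _ = _ := by ring
    _ = A * ∫⁻ η, ∑' k, expCoeff ε k *
        ((dualOp c (volume Λ))^[k + 1] (fun n => (z : ℝ≥0∞) ^ n) (count Λ η)) * F η
          ∂(poisson Λ) := by
        rw [ENNReal.tsum_mul_left, lintegral_tsum]
        exact fun k => (((hw _).const_mul _).mul hFm).aemeasurable
    _ ≤ A * ∫⁻ η, (4 * a * z) * (2 * (z : ℝ≥0∞)) ^ count Λ η * F η ∂(poisson Λ) := by
        gcongr with η
        rw [ENNReal.tsum_mul_right]
        gcongr
        exact tsum_expCoeff_dualOp_le c (volume Λ) hμ.one_le_base hε _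
    _ ≤ A * ∫⁻ η, (A * (z : ℝ≥0∞) ^ count Λ η) *
          ((4 * a * z) * (2 * (z : ℝ≥0∞)) ^ count Λ η * F η) ∂(marginal μ Λ) := by
        refine mul_le_mul' le_rfl ?_
        exact hμ.ge _ ((hw fun n => (4 * a * z) * (2 * (z : ℝ≥0∞)) ^ n).mul hFm)
    _ = _ := by
        rw [← lintegral_const_mul]
        · refine lintegral_congr fun η => ?_
          rw [mul_pow, mul_pow, ← pow_mul, mul_comm 2 (count Λ η), pow_mul]; ring
        · exact (hw fun n => (A * (z : ℝ≥0∞) ^ n)).mul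
            ((hw fun n => (4 * a * z) * (2 * (z : ℝ≥0∞)) ^ n).mul hFm)

theorem marginal_bind_apply (hm : MeasurableSet Λ) (μ : Measure (Config d)) (t : ℝ≥0)
    {A : Set (Config d)} (hA : MeasurableSet A) :
    marginal (μ.bind (T t)) Λ A = ∫⁻ ω, T t ω (Config.restrict Λ ⁻¹' A) ∂μ := by
  rw [marginal, Measure.map_apply (measurable_restrict hm) hA,
    Measure.bind_apply (measurable_restrict hm hA) (T t).measurable.aemeasurable]

/-- Valid for every event in Λ with one and the same weight, so it bounds the distance from 1 of the
density of the evolved marginal by t g y^{N_Λ}. -/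
theorem marginal_bind_le_add [Nontrivial (E d)] [NullSingletonClass (volume : Measure (E d))]
    (hT : IsBirthDeathSemigroup b T) (hb : IsBoundedRate b c) (hΛ : Bornology.IsBounded Λ)
    (hm : MeasurableSet Λ) {μ : Measure (Config d)} {A z : ℝ≥0}
    (hμ : IsPoissonComparable Λ (marginal μ Λ) A z) :
    ∃ ε > (0 : ℝ≥0), ∃ g y : ℝ≥0, ∀ t ≤ ε, ∀ B : Set (Config d), MeasurableSet B →
      marginal (μ.bind (T t)) Λ B ≤ marginal μ Λ B +
        t * ∫⁻ η in B, g * (y : ℝ≥0∞) ^ count Λ η ∂(marginal μ Λ) ∧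
      marginal μ Λ B ≤ marginal (μ.bind (T t)) Λ B +
        t * ∫⁻ η in B, g * (y : ℝ≥0∞) ^ count Λ η ∂(marginal μ Λ) := by
  have hat := growthConst_ne_top c hΛ
  obtain ⟨a, ha⟩ : ∃ a : ℝ≥0, (a : ℝ≥0∞) = growthConst c (volume Λ) :=
    ⟨_, ENNReal.coe_toNNReal hat⟩
  have ha2 : (1 : ℝ≥0∞) ≤ a := by
    rw [ha, growthConst]
    calc (1 : ℝ≥0∞) ≤ 2 := by norm_num
      _ ≤ _ := le_add_self
  have ha1 : 1 ≤ a := by exact_mod_cast ha2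
  have hz1 := hμ.one_le_base
  set v : ℝ≥0 := (volume Λ).toNNReal with hv
  have hpos : 0 < 8 * (a * z) + 2 * (c * v) := by positivity
  -- This horizon meets at once 8εaz ≤ 1, for the two series, and ε c |Λ| ≤ 1/2, for the moment
  -- bound with base 2.
  refine ⟨(8 * (a * z) + 2 * (c * v))⁻¹, inv_pos.2 hpos, 4 * A ^ 2 * a * z, 2 * z ^ 2, ?_⟩
  intro t ht B hB
  set ε : ℝ≥0 := (8 * (a * z) + 2 * (c * v))⁻¹ with hεd
  have hε0 : ε * (8 * (a * z) + 2 * (c * v)) = 1 := inv_mul_cancel₀ hpos.ne'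
  have hε1 : 8 * ε * (a * z) ≤ 1 := by
    rw [← hε0]
    calc 8 * ε * (a * z) = ε * (8 * (a * z)) := by ring
      _ ≤ _ := by gcongr; exact le_self_add
  have hεz : 8 * (ε : ℝ≥0∞) * (growthConst c (volume Λ) * z) ≤ 1 := by
    rw [← ha]; exact_mod_cast hε1
  have hεa : 8 * (ε : ℝ≥0∞) * growthConst c (volume Λ) ≤ 1 := by
    refine le_trans ?_ hεz
    gcongr
    calc growthConst c (volume Λ) = growthConst c (volume Λ) * 1 := (mul_one _).symm
      _ ≤ _ := by gcongr; exact_mod_cast hz1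
  have hεc : (ε : ℝ) * (c * (volume Λ).toReal) ≤ 1 / 2 := by
    have h1 : 2 * (ε * (c * v)) ≤ 1 := by
      rw [← hε0]
      calc 2 * (ε * (c * v)) = ε * (2 * (c * v)) := by ring
        _ ≤ _ := by gcongr; exact le_add_self
    have h2 : 2 * ((ε : ℝ) * (c * (v : ℝ))) ≤ 1 := by exact_mod_cast h1
    change (ε : ℝ) * (c * (v : ℝ)) ≤ 1 / 2
    linarith
  set B' : Set (Config d) := Config.restrict Λ ⁻¹' B with hB'
  have hB'm : MeasurableSet B' := measurable_restrict hm hB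
  set F : Config d → ℝ≥0∞ := B'.indicator 1 with hF
  have hFm : Measurable F := measurable_one.indicator hB'm
  have hFr : ∀ η : Config d, F η = B.indicator 1 (η.restrict Λ) := fun η => by
    by_cases h : η.restrict Λ ∈ B
    · rw [Set.indicator_of_mem h, hF, Set.indicator_of_mem (show η ∈ B' from h)]; rfl
    · rw [Set.indicator_of_notMem h, hF, Set.indicator_of_notMem (show η ∉ B' from h)]
  have hFl : IsLocalOn Λ F := fun η => by
    rw [hFr, hFr, restrict_restrict, Set.inter_self]
  have hpt := fun ω => measure_le_add_domSeries hT hb hΛ hm hεa hεc hB'm hFl ω ht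
  have hS : ∫⁻ ω, domSeries c hΛ ε F ω ∂μ ≤
      ∫⁻ η in B, ((4 * A ^ 2 * a * z : ℝ≥0) : ℝ≥0∞) * ((2 * z ^ 2 : ℝ≥0) : ℝ≥0∞) ^ count Λ η
        ∂(marginal μ Λ) := by
    have hWm : Measurable fun η : Config d =>
      ((4 * A ^ 2 * a * z : ℝ≥0) : ℝ≥0∞) * ((2 * z ^ 2 : ℝ≥0) : ℝ≥0∞) ^ count Λ η :=
      measurable_weight hΛ hm fun n =>
        ((4 * A ^ 2 * a * z : ℝ≥0) : ℝ≥0∞) * ((2 * z ^ 2 : ℝ≥0) : ℝ≥0∞) ^ n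
    refine (lintegral_domSeries_le c hΛ hm hμ hεz hFm hFl).trans (le_of_eq ?_)
    rw [← lintegral_indicator hB, lintegral_marginal hm _ (hWm.indicator hB), lintegral_marginal hm]
    · refine lintegral_congr fun η => ?_
      rw [hFl, hFr, ← ha]
      by_cases h : η.restrict Λ ∈ B <;> simp [h]
    · exact (measurable_weight hΛ hm fun n => (4 * A ^ 2 * growthConst c (volume Λ) * z) *
        (2 * (z : ℝ≥0∞) ^ 2) ^ n).mul hFm
  have hμB : marginal μ Λ B = ∫⁻ ω, F ω ∂μ := by
    rw [hF, lintegral_indicator_one hB'm, marginal, Measure.map_apply (measurable_restrict hm) hB]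
  have hSm := measurable_domSeries c hΛ hm ε hFm
  rw [marginal_bind_apply hm μ t hB, hμB]
  constructor
  · calc _ ≤ ∫⁻ ω, (F ω + t * domSeries c hΛ ε F ω) ∂μ := lintegral_mono fun ω => (hpt ω).1
      _ = ∫⁻ ω, F ω ∂μ + t * ∫⁻ ω, domSeries c hΛ ε F ω ∂μ := by
          rw [lintegral_add_left hFm, lintegral_const_mul _ hSm]
      _ ≤ _ := by gcongr
  · calc _ ≤ ∫⁻ ω, (T t ω B' + t * domSeries c hΛ ε F ω) ∂μ := lintegral_mono fun ω => (hpt ω).2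
      _ = ∫⁻ ω, T t ω B' ∂μ + t * ∫⁻ ω, domSeries c hΛ ε F ω ∂μ := by
          rw [lintegral_add_right _ (hSm.const_mul _), lintegral_const_mul _ hSm]
      _ ≤ _ := by gcongr

end Density

/-! ### Truncation and the second-order expansion in time -/

section Truncation

/-- Truncation of a real function at levels `-n` and `n`. -/
def truncate (n : ℕ) (r : ℝ) : ℝ := max (min r n) (-n)

theorem abs_truncate_le (n : ℕ) (r : ℝ) : |truncate n r| ≤ n := by
  have : (0 : ℝ) ≤ n := Nat.cast_nonneg n
  exact abs_le.2 ⟨le_max_right _ _, max_le (min_le_right _ _) (by linarith)⟩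

theorem abs_truncate_le_abs (n : ℕ) (r : ℝ) : |truncate n r| ≤ |r| := by
  have hn : (0 : ℝ) ≤ n := Nat.cast_nonneg n
  have h1 := neg_abs_le r
  have h2 := le_abs_self r
  have h3 := abs_nonneg r
  refine abs_le.2 ⟨?_, max_le ((min_le_left _ _).trans h2) (by linarith)⟩
  rcases le_total r n with h | h
  · rw [truncate, min_eq_left h]; exact h1.trans (le_max_left _ _)
  · rw [truncate, min_eq_right h]; exact le_trans (by linarith) (le_max_left _ _)

theorem truncate_eq {n : ℕ} {r : ℝ} (h : |r| ≤ n) : truncate n r = r := by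
  obtain ⟨h1, h2⟩ := abs_le.1 h
  rw [truncate, min_eq_left h2, max_eq_left h1]

theorem tendsto_truncate (r : ℝ) : Tendsto (fun n : ℕ => truncate n r) atTop (𝓝 r) := by
  obtain ⟨N, hN⟩ := exists_nat_ge |r|
  refine tendsto_const_nhds.congr' ?_
  filter_upwards [eventually_ge_atTop N] with n hn
  exact (truncate_eq (hN.trans (by exact_mod_cast hn))).symm

theorem measurable_truncate (n : ℕ) : Measurable (truncate n) := by
  unfold truncate; fun_prop

end Truncation

section SecondOrder

variable {b : E d → Config d → ℝ} {c : ℝ≥0} {T : ℝ≥0 → Kernel (Config d) (Config d)}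
  {Λ Λ' : Set (E d)}

/-- Exponential moments of the number of points in `Λ` at most double up to time `ε`. -/
def MomentBound (T : ℝ≥0 → Kernel (Config d) (Config d)) (Λ : Set (E d)) (y ε : ℝ≥0) : Prop :=
  ∀ t ≤ ε, ∀ ω, ∫⁻ η, (y : ℝ≥0∞) ^ count Λ η ∂(T t ω) ≤ 2 * (y : ℝ≥0∞) ^ count Λ ω

theorem exists_momentBound [Nontrivial (E d)] (hT : IsBirthDeathSemigroup b T)
    (hb : IsBoundedRate b c) (hΛ : Bornology.IsBounded Λ) (hm : MeasurableSet Λ)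
    {y : ℝ≥0} (hy : 1 ≤ y) : ∃ ε > (0 : ℝ≥0), MomentBound T Λ y ε := by
  set a : ℝ≥0 := c * (volume Λ).toNNReal * y with ha
  refine ⟨(2 * a + 1)⁻¹, by positivity, fun t ht ω =>
    lintegral_pow_count_le hT hb hΛ hm hy ?_ ht ω⟩
  have h1 : ((c : ℝ) * (volume Λ).toReal * (y - 1)) ≤ a := by
    rw [ha]; push_cast
    have h0 : 0 ≤ (c : ℝ) * (volume Λ).toReal := by positivity
    change _ ≤ (c : ℝ) * (volume Λ).toReal * y
    nlinarith
  have h2 : (0 : ℝ) < 2 * a + 1 := by positivity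
  push_cast
  rw [inv_mul_le_iff₀ h2]
  linarith

theorem MomentBound.mono {y ε ε' : ℝ≥0} (h : MomentBound T Λ y ε) (hε : ε' ≤ ε) :
    MomentBound T Λ y ε' := fun t ht ω => h t (ht.trans hε) ω

theorem enorm_le_pow_of_abs_le {A y : ℝ≥0} {r : ℝ} {n : ℕ} (h : |r| ≤ A * (y : ℝ) ^ n) :
    ‖r‖ₑ ≤ A * (y : ℝ≥0∞) ^ n := by
  rw [Real.enorm_eq_ofReal_abs]
  refine (ENNReal.ofReal_le_ofReal h).trans (le_of_eq ?_)
  rw [show (A : ℝ) * (y : ℝ) ^ n = ((A * y ^ n : ℝ≥0) : ℝ) by push_cast; rfl,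
    ENNReal.ofReal_coe_nnreal]
  push_cast; rfl

theorem abs_le_pow_of_enorm_le {A y : ℝ≥0} {r : ℝ} {n : ℕ} (h : ‖r‖ₑ ≤ A * (y : ℝ≥0∞) ^ n) :
    |r| ≤ A * (y : ℝ) ^ n := by
  rw [Real.enorm_eq_ofReal_abs] at h
  have h' : ENNReal.ofReal |r| ≤ ((A * y ^ n : ℝ≥0) : ℝ≥0∞) := by push_cast; exact h
  have := ENNReal.toReal_mono ENNReal.coe_ne_top h'
  rw [ENNReal.toReal_ofReal (abs_nonneg _)] at this
  simpa using this

theorem integrable_of_abs_le_pow {m : Measure (Config d)} {A y : ℝ≥0} {F : Config d → ℝ}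
    (hFm : Measurable F) (hF : ∀ η, |F η| ≤ A * (y : ℝ) ^ count Λ η)
    (hy : ∫⁻ η, (y : ℝ≥0∞) ^ count Λ η ∂m ≠ ∞) : Integrable F m := by
  refine ⟨hFm.aestronglyMeasurable, ?_⟩
  rw [hasFiniteIntegral_iff_enorm]
  calc _ ≤ ∫⁻ η, A * (y : ℝ≥0∞) ^ count Λ η ∂m :=
        lintegral_mono fun η => enorm_le_pow_of_abs_le (hF η)
    _ = A * ∫⁻ η, (y : ℝ≥0∞) ^ count Λ η ∂m := lintegral_const_mul' _ _ ENNReal.coe_ne_top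
    _ < ∞ := ENNReal.mul_lt_top ENNReal.coe_lt_top hy.lt_top

theorem MomentBound.ne_top {y ε : ℝ≥0} (h : MomentBound T Λ y ε) {t : ℝ≥0} (ht : t ≤ ε)
    (ω : Config d) : ∫⁻ η, (y : ℝ≥0∞) ^ count Λ η ∂(T t ω) ≠ ∞ :=
  ((h t ht ω).trans_lt (ENNReal.mul_lt_top (by simp)
    (ENNReal.pow_lt_top ENNReal.coe_lt_top))).ne

/-- The constant in the bound of `domOp` on exponential weights. -/
noncomputable def weightConst (c : ℝ≥0) (Λ : Set (E d)) (A y : ℝ≥0) : ℝ≥0 :=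
  A * (c * (volume Λ).toNNReal * (y + 1) + 2)

theorem domOp_pow_le_weightConst (c : ℝ≥0) (hΛ : Bornology.IsBounded Λ) {A y : ℝ≥0} (hy : 1 ≤ y)
    {F : Config d → ℝ≥0∞} (hF : ∀ η, F η ≤ A * (y : ℝ≥0∞) ^ count Λ η) (η : Config d) :
    domOp c hΛ F η ≤ weightConst c Λ A y * ((2 * y : ℝ≥0) : ℝ≥0∞) ^ count Λ η := by
  refine (domOp_mono c hΛ hF η).trans ((domOp_pow_count_le c hΛ hy η).trans (le_of_eq ?_))
  rw [weightConst]
  push_cast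
  rw [ENNReal.coe_toNNReal hΛ.measure_lt_top.ne]

theorem abs_truncate_comp_le {A y : ℝ≥0} {F : Config d → ℝ}
    (hF : ∀ η, |F η| ≤ A * (y : ℝ) ^ count Λ η) (n : ℕ) (η : Config d) :
    |truncate n (F η)| ≤ A * (y : ℝ) ^ count Λ η :=
  (abs_truncate_le_abs n _).trans (hF η)

theorem tendsto_integral_truncate {m : Measure (Config d)} {F : Config d → ℝ}
    (hF : Integrable F m) (hFm : Measurable F) :
    Tendsto (fun n : ℕ => ∫ η, truncate n (F η) ∂m) atTop (𝓝 (∫ η, F η ∂m)) :=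
  tendsto_integral_of_dominated_convergence (fun η => |F η|)
    (fun n => ((measurable_truncate n).comp hFm).aestronglyMeasurable) hF.abs
    (fun n => Eventually.of_forall fun η => abs_truncate_le_abs n (F η))
    (Eventually.of_forall fun η => tendsto_truncate (F η))

/-- First-order estimate for local functions of exponential growth. -/
theorem enorm_integral_sub_le_of_abs_le_pow [Nontrivial (E d)] (hT : IsBirthDeathSemigroup b T)
    (hb : IsBoundedRate b c) (hΛ : Bornology.IsBounded Λ) (hm : MeasurableSet Λ)
    {A y ε : ℝ≥0} (hy : 1 ≤ y) (h1 : MomentBound T Λ y ε) (h2 : MomentBound T Λ (2 * y) ε)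
    {F : Config d → ℝ} (hFm : Measurable F) (hFl : IsLocalOn Λ F)
    (hF : ∀ η, |F η| ≤ A * (y : ℝ) ^ count Λ η) (ω : Config d) {t : ℝ≥0} (ht : t ≤ ε) :
    ‖∫ η, F η ∂(T t ω) - F ω‖ₑ ≤
      t * (2 * weightConst c Λ A y * ((2 * y : ℝ≥0) : ℝ≥0∞) ^ count Λ ω) := by
  have hFi := integrable_of_abs_le_pow hFm hF (h1.ne_top ht ω)
  have hbound : ∀ n : ℕ, ‖∫ η, truncate n (F η) ∂(T t ω) - truncate n (F ω)‖ₑ ≤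
      t * (2 * weightConst c Λ A y * ((2 * y : ℝ≥0) : ℝ≥0∞) ^ count Λ ω) := by
    intro n
    -- Dynkin's formula is available for bounded functions only, so it is applied to the
    -- truncations. The bound does not depend on the level n and passes to the limit.
    refine (enorm_integral_sub_le hT hb hΛ hm ((measurable_truncate n).comp hFm)
      ⟨n, fun η => abs_truncate_le n _⟩ (fun η => by simp only [Function.comp, hFl η]) ω t).trans ?_
    calc _ ≤ ∫⁻ u in Set.Ioc (0 : ℝ) t,
          (2 * weightConst c Λ A y * ((2 * y : ℝ≥0) : ℝ≥0∞) ^ count Λ ω) := by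
          refine setLIntegral_mono' measurableSet_Ioc fun u hu => ?_
          have hu' : u.toNNReal ≤ ε := (Real.toNNReal_le_iff_le_coe.2 hu.2).trans ht
          calc _ ≤ ∫⁻ η, weightConst c Λ A y * ((2 * y : ℝ≥0) : ℝ≥0∞) ^ count Λ η
                ∂(T u.toNNReal ω) := lintegral_mono fun η =>
                  domOp_pow_le_weightConst c hΛ hy
                    (fun η => enorm_le_pow_of_abs_le (abs_truncate_comp_le hF n η)) η
            _ = weightConst c Λ A y * ∫⁻ η, ((2 * y : ℝ≥0) : ℝ≥0∞) ^ count Λ η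
                ∂(T u.toNNReal ω) := lintegral_const_mul' _ _ ENNReal.coe_ne_top
            _ ≤ weightConst c Λ A y * (2 * ((2 * y : ℝ≥0) : ℝ≥0∞) ^ count Λ ω) := by
                gcongr; exact h2 _ hu' ω
            _ = _ := by ring
      _ = _ := by
          rw [setLIntegral_const, Real.volume_Ioc, sub_zero, ENNReal.ofReal_coe_nnreal, mul_comm]
  exact le_of_tendsto' (((tendsto_integral_truncate hFi hFm).sub (tendsto_truncate (F ω))).enorm)
    hbound

/-- The birth rates in Λ look at Λ', so the generator of a Λ-local function is local on Λ' only.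
This is why the second-order estimate needs moments on the larger set. -/
theorem generator_restrict (hm : MeasurableSet Λ) (hΛ : Bornology.IsBounded Λ) (hsub : Λ ⊆ Λ')
    (hloc : ∀ x ∈ Λ, ∀ η : Config d, b x (η.restrict Λ') = b x η)
    {F : Config d → ℝ} (hF : IsLocalOn Λ F) : IsLocalOn Λ' (generator b F) := by
  have hF' : ∀ η : Config d, F (η.restrict Λ') = F η := fun η => by
    rw [← hF, restrict_restrict, Set.inter_eq_right.2 hsub, hF]
  intro η
  rw [generator_eq hΛ hF, generator_eq hΛ hF]
  congr 1
  · refine setIntegral_congr_fun hm fun x hx => ?_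
    rw [hloc x hx, hF', ← restrict_add_of_mem (hsub hx), hF']
  · have : (η.restrict Λ').points hΛ = η.points hΛ := by
      ext x; simp only [mem_points, carrier_restrict, Set.mem_inter_iff]
      constructor
      · tauto
      · rintro ⟨h, h'⟩; exact ⟨⟨h, hsub h'⟩, h'⟩
    rw [this]
    exact Finset.sum_congr rfl fun x _ => by rw [← restrict_remove, hF', hF']

theorem abs_generator_le (hb : IsBoundedRate b c) (hΛ : Bornology.IsBounded Λ)
    {A y : ℝ≥0} (hy : 1 ≤ y) {F : Config d → ℝ} (hFm : Measurable F) (hFl : IsLocalOn Λ F)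
    (hF : ∀ η, |F η| ≤ A * (y : ℝ) ^ count Λ η) (η : Config d) :
    |generator b F η| ≤ weightConst c Λ A y * ((2 * y : ℝ≥0) : ℝ) ^ count Λ η :=
  abs_le_pow_of_enorm_le ((enorm_generator_le hΛ hb.nonneg hb.le hFm hFl η).trans
    (domOp_pow_le_weightConst c hΛ hy (fun η => enorm_le_pow_of_abs_le (hF η)) η))

theorem count_mono_set (hΛ' : Bornology.IsBounded Λ') (hsub : Λ ⊆ Λ') (η : Config d) :
    count Λ η ≤ count Λ' η :=
  Set.ncard_le_ncard (Set.inter_subset_inter_right _ hsub) (η.finite_inter Λ' hΛ')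

/-- At a fixed ω the generator evaluates F only at configurations with at most N_Λ(ω) + 1 points in
Λ, where F is bounded. A high truncation level has no effect there. -/
theorem generator_truncate_eventuallyEq (hΛ : Bornology.IsBounded Λ) {A y : ℝ≥0} (hy : 1 ≤ y)
    {F : Config d → ℝ} (hF : ∀ η, |F η| ≤ A * (y : ℝ) ^ count Λ η) (ω : Config d) :
    ∀ᶠ n : ℕ in atTop, generator b (fun η => truncate n (F η)) ω = generator b F ω := by
  obtain ⟨N, hN⟩ := exists_nat_ge ((A : ℝ) * (y : ℝ) ^ (count Λ ω + 1))
  filter_upwards [eventually_ge_atTop N] with n hn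
  have hy1 : (1 : ℝ) ≤ y := by exact_mod_cast hy
  have key : ∀ η : Config d, count Λ η ≤ count Λ ω + 1 → truncate n (F η) = F η := fun η hη => by
    refine truncate_eq ((hF η).trans (le_trans ?_ (hN.trans (by exact_mod_cast hn))))
    exact mul_le_mul_of_nonneg_left (pow_le_pow_right₀ hy1 hη) A.coe_nonneg
  have k0 : truncate n (F ω) = F ω := key ω (by omega)
  have k1 : ∀ x, truncate n (F (ω.add x)) = F (ω.add x) := fun x => key _ (by
    rw [count_add hΛ]; split_ifs <;> omega)
  have k2 : ∀ x, truncate n (F (ω.remove x)) = F (ω.remove x) := fun x => key _ (by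
    rw [count_remove hΛ]; split_ifs <;> omega)
  simp only [generator, birthTerm, k0, k1, k2]

/-- Second-order estimate for local functions of exponential growth. -/
theorem enorm_integral_sub_sub_generator_le [Nontrivial (E d)] (hT : IsBirthDeathSemigroup b T)
    (hb : IsBoundedRate b c) (hΛ : Bornology.IsBounded Λ) (hm : MeasurableSet Λ)
    (hΛ' : Bornology.IsBounded Λ') (hm' : MeasurableSet Λ') (hsub : Λ ⊆ Λ')
    (hloc : ∀ x ∈ Λ, ∀ η : Config d, b x (η.restrict Λ') = b x η)
    {A y ε : ℝ≥0} (hy : 1 ≤ y) (h1 : MomentBound T Λ y ε) (h2 : MomentBound T Λ' (2 * y) ε)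
    (h4 : MomentBound T Λ' (2 * (2 * y)) ε)
    {F : Config d → ℝ} (hFm : Measurable F) (hFl : IsLocalOn Λ F)
    (hF : ∀ η, |F η| ≤ A * (y : ℝ) ^ count Λ η) (ω : Config d) {t : ℝ≥0} (ht : t ≤ ε) :
    ‖∫ η, F η ∂(T t ω) - F ω - t * generator b F ω‖ₑ ≤
      t * (t * (2 * weightConst c Λ' (weightConst c Λ A y) (2 * y) *
        ((2 * (2 * y) : ℝ≥0) : ℝ≥0∞) ^ count Λ' ω)) := by
  set D : ℝ≥0∞ := 2 * weightConst c Λ' (weightConst c Λ A y) (2 * y) *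
        ((2 * (2 * y) : ℝ≥0) : ℝ≥0∞) ^ count Λ' ω with hD
  have hy2 : 1 ≤ 2 * y := by
    calc (1 : ℝ≥0) ≤ y := hy
      _ ≤ 2 * y := le_mul_of_one_le_left zero_le (by norm_num)
  have hFi := integrable_of_abs_le_pow hFm hF (h1.ne_top ht ω)
  have hbdd : ∀ G : Config d → ℝ, Measurable G → IsLocalOn Λ G →
      (∀ η, |G η| ≤ A * (y : ℝ) ^ count Λ η) → (∃ C : ℝ, ∀ η, |G η| ≤ C) →
      ‖∫ η, G η ∂(T t ω) - G ω - t * generator b G ω‖ₑ ≤ t * (t * D) := by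
    intro G hGm hGl hG hGb
    have hgm := measurable_generator hb.measurable hΛ hm hGm hGl
    have hgl := generator_restrict hm hΛ hsub hloc hGl
    have hg : ∀ η, |generator b G η| ≤
        weightConst c Λ A y * ((2 * y : ℝ≥0) : ℝ) ^ count Λ' η := fun η => by
      refine (abs_generator_le hb hΛ hy hGm hGl hG η).trans ?_
      refine mul_le_mul_of_nonneg_left (pow_le_pow_right₀ ?_ (count_mono_set hΛ' hsub η))
        (NNReal.coe_nonneg _)
      exact_mod_cast hy2
    -- The first-order estimate is applied to the generator of G itself, as a function on Λ'.
    -- Integrating its error u D ≤ t D over u ≤ t gives the quadratic error.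
    have hfo : ∀ u ≤ ε, ‖∫ η, generator b G η ∂(T u ω) - generator b G ω‖ₑ ≤ u * D :=
      fun u hu => enorm_integral_sub_le_of_abs_le_pow hT hb hΛ' hm' hy2 h2 h4 hgm hgl hg ω hu
    have hu' : ∀ u ∈ Set.Ioc (0 : ℝ) t, u.toNNReal ≤ t := fun u hu =>
      Real.toNNReal_le_iff_le_coe.2 hu.2
    have hfin : ∫⁻ u in Set.Ioc (0 : ℝ) t, ∫⁻ η, ‖generator b G η‖ₑ ∂(T u.toNNReal ω) ≠ ∞ := by
      have : ∫⁻ u in Set.Ioc (0 : ℝ) t, ∫⁻ η, ‖generator b G η‖ₑ ∂(T u.toNNReal ω) ≤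
          ∫⁻ u in Set.Ioc (0 : ℝ) t, (weightConst c Λ A y *
            (2 * ((2 * y : ℝ≥0) : ℝ≥0∞) ^ count Λ' ω)) := by
        refine setLIntegral_mono' measurableSet_Ioc fun u hu => ?_
        calc _ ≤ ∫⁻ η, weightConst c Λ A y * ((2 * y : ℝ≥0) : ℝ≥0∞) ^ count Λ' η
              ∂(T u.toNNReal ω) := lintegral_mono fun η => enorm_le_pow_of_abs_le (hg η)
          _ = weightConst c Λ A y * ∫⁻ η, ((2 * y : ℝ≥0) : ℝ≥0∞) ^ count Λ' η
              ∂(T u.toNNReal ω) := lintegral_const_mul' _ _ ENNReal.coe_ne_top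
          _ ≤ _ := by gcongr; exact h2 _ ((hu' u hu).trans ht) ω
      refine (this.trans_lt ?_).ne
      rw [setLIntegral_const, Real.volume_Ioc]
      exact ENNReal.mul_lt_top (ENNReal.mul_lt_top ENNReal.coe_lt_top (ENNReal.mul_lt_top (by simp)
        (ENNReal.pow_lt_top ENNReal.coe_lt_top))) ENNReal.ofReal_lt_top
    obtain ⟨hii, heq⟩ := hT.dynkin ω (isBoundedLocal_of_isLocalOn hΛ hm hGm hGb hGl) hgm t hfin
    have hconst : (t : ℝ) * generator b G ω = ∫ _u in (0 : ℝ)..t, generator b G ω := by simp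
    rw [heq, hconst, ← intervalIntegral.integral_sub hii (by simp),
      intervalIntegral.integral_of_le t.coe_nonneg]
    refine (enorm_integral_le_lintegral_enorm _).trans ?_
    calc _ ≤ ∫⁻ u in Set.Ioc (0 : ℝ) t, t * D := by
          refine setLIntegral_mono' measurableSet_Ioc fun u hu => ?_
          refine (hfo _ ((hu' u hu).trans ht)).trans ?_
          gcongr
          exact hu' u hu
      _ = _ := by
          rw [setLIntegral_const, Real.volume_Ioc, sub_zero, ENNReal.ofReal_coe_nnreal, mul_comm]
  have hn : ∀ n : ℕ, ‖∫ η, truncate n (F η) ∂(T t ω) - truncate n (F ω) -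
      t * generator b (fun η => truncate n (F η)) ω‖ₑ ≤ t * (t * D) := fun n =>
    hbdd _ ((measurable_truncate n).comp hFm) (fun η => by simp only [hFl η])
      (abs_truncate_comp_le hF n) ⟨n, fun η => abs_truncate_le n _⟩
  have hgen : Tendsto (fun n : ℕ => generator b (fun η => truncate n (F η)) ω) atTop
      (𝓝 (generator b F ω)) :=
    tendsto_const_nhds.congr' ((generator_truncate_eventuallyEq hΛ hy hF ω).mono fun n h => h.symm)
  exact le_of_tendsto' (((tendsto_integral_truncate hFi hFm).sub
    (tendsto_truncate (F ω))).sub (hgen.const_mul (t : ℝ))).enorm hn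

end SecondOrder

/-! ### Evolution of expectations under an initial measure -/

section Evolution

variable {b : E d → Config d → ℝ} {c : ℝ≥0} {T : ℝ≥0 → Kernel (Config d) (Config d)}
  {Λ Λ' : Set (E d)}

theorem IsPoissonComparable.lintegral_pow_count_ne_top
    [NullSingletonClass (volume : Measure (E d))] (hΛ : Bornology.IsBounded Λ)
    (hm : MeasurableSet Λ) {m : Measure (Config d)} {A z : ℝ≥0} (h : IsPoissonComparable Λ m A z)
    (y : ℝ≥0) : ∫⁻ η, (y : ℝ≥0∞) ^ count Λ η ∂m ≠ ∞ := by
  refine ((h.le _ (measurable_weight hΛ hm fun n => (y : ℝ≥0∞) ^ n)).trans_lt ?_).ne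
  calc _ = ∫⁻ η, A * ((z * y : ℝ≥0) : ℝ≥0∞) ^ count Λ η ∂(poisson Λ) := by
        refine lintegral_congr fun η => ?_
        push_cast; rw [mul_pow]; ring
    _ = A * ∫⁻ η, ((z * y : ℝ≥0) : ℝ≥0∞) ^ count Λ η ∂(poisson Λ) :=
        lintegral_const_mul' _ _ ENNReal.coe_ne_top
    _ < ∞ := ENNReal.mul_lt_top ENNReal.coe_lt_top (lintegral_poisson_pow_count_lt_top hΛ hm _)

theorem lintegral_pow_count_marginal (hΛ : Bornology.IsBounded Λ) (hm : MeasurableSet Λ)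
    (μ : Measure (Config d)) (y : ℝ≥0∞) :
    ∫⁻ η, y ^ count Λ η ∂(marginal μ Λ) = ∫⁻ η, y ^ count Λ η ∂μ := by
  rw [lintegral_marginal hm μ (measurable_weight hΛ hm fun n => y ^ n)]
  exact lintegral_congr fun η => by rw [isLocalOn_count Λ η]

theorem integral_bind_of_integrable {μ : Measure (Config d)} {κ : Kernel (Config d) (Config d)}
    {F : Config d → ℝ} (hF : Integrable F (μ.bind κ)) :
    Integrable (fun ω => ∫ η, F η ∂(κ ω)) μ ∧
      ∫ η, F η ∂(μ.bind κ) = ∫ ω, ∫ η, F η ∂(κ ω) ∂μ := by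
  rw [Measure.comp_eq_comp_const_apply] at hF ⊢
  have h1 := hF.integral_comp
  have h2 := Kernel.integral_comp hF
  simp only [Kernel.const_apply] at h1 h2
  exact ⟨h1, h2⟩

theorem MomentBound.lintegral_bind_ne_top (hΛ : Bornology.IsBounded Λ) (hm : MeasurableSet Λ)
    {y ε : ℝ≥0} (h : MomentBound T Λ y ε) {t : ℝ≥0} (ht : t ≤ ε) {μ : Measure (Config d)}
    (hμ : ∫⁻ η, (y : ℝ≥0∞) ^ count Λ η ∂μ ≠ ∞) :
    ∫⁻ η, (y : ℝ≥0∞) ^ count Λ η ∂(μ.bind (T t)) ≠ ∞ := by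
  rw [Measure.lintegral_bind (T t).measurable.aemeasurable
    (measurable_weight hΛ hm fun n => (y : ℝ≥0∞) ^ n).aemeasurable]
  refine ((lintegral_mono fun ω => h t ht ω).trans_lt ?_).ne
  rw [lintegral_const_mul' _ _ (by simp)]
  exact ENNReal.mul_lt_top (by simp) hμ.lt_top

/-- The evolution of the expectation of a local function of exponential growth, to second
order. -/
theorem exists_abs_integral_bind_sub_le [Nontrivial (E d)] (hT : IsBirthDeathSemigroup b T)
    (hb : IsBoundedRate b c) (hΛ : Bornology.IsBounded Λ) (hm : MeasurableSet Λ)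
    (hΛ' : Bornology.IsBounded Λ') (hm' : MeasurableSet Λ') (hsub : Λ ⊆ Λ')
    (hloc : ∀ x ∈ Λ, ∀ η : Config d, b x (η.restrict Λ') = b x η)
    {μ : Measure (Config d)} (hμ : ∀ y : ℝ≥0, ∫⁻ η, (y : ℝ≥0∞) ^ count Λ' η ∂μ ≠ ∞)
    {A y : ℝ≥0} (hy : 1 ≤ y) {F : Config d → ℝ} (hFm : Measurable F) (hFl : IsLocalOn Λ F)
    (hF : ∀ η, |F η| ≤ A * (y : ℝ) ^ count Λ η) :
    Integrable F μ ∧ Integrable (generator b F) μ ∧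
    ∃ ε > (0 : ℝ≥0), ∃ B : ℝ, ∀ t ≤ ε, Integrable F (μ.bind (T t)) ∧
      |∫ η, F η ∂(μ.bind (T t)) - ∫ η, F η ∂μ - t * ∫ η, generator b F η ∂μ| ≤ B * (t : ℝ) ^ 2 := by
  have hy2 : 1 ≤ 2 * y := by
    calc (1 : ℝ≥0) ≤ y := hy
      _ ≤ 2 * y := le_mul_of_one_le_left zero_le (by norm_num)
  have hy4 : 1 ≤ 2 * (2 * y) := by
    calc (1 : ℝ≥0) ≤ 2 * y := hy2
      _ ≤ 2 * (2 * y) := le_mul_of_one_le_left zero_le (by norm_num)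
  have hμΛ : ∀ y : ℝ≥0, 1 ≤ y → ∫⁻ η, (y : ℝ≥0∞) ^ count Λ η ∂μ ≠ ∞ := fun y hy =>
    ((lintegral_mono fun η => pow_le_pow_right₀ (ENNReal.one_le_coe_iff.2 hy)
      (count_mono_set hΛ' hsub η)).trans_lt (hμ y).lt_top).ne
  have hFi := integrable_of_abs_le_pow hFm hF (hμΛ y hy)
  have hgi : Integrable (generator b F) μ :=
    integrable_of_abs_le_pow (measurable_generator hb.measurable hΛ hm hFm hFl)
      (abs_generator_le hb hΛ hy hFm hFl hF) (hμΛ _ hy2)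
  refine ⟨hFi, hgi, ?_⟩
  obtain ⟨ε1, hε1, h1⟩ := exists_momentBound hT hb hΛ hm hy
  obtain ⟨ε2, hε2, h2⟩ := exists_momentBound hT hb hΛ' hm' hy2
  obtain ⟨ε4, hε4, h4⟩ := exists_momentBound hT hb hΛ' hm' hy4
  set ε := min ε1 (min ε2 ε4) with hε
  have h1' : MomentBound T Λ y ε := h1.mono (min_le_left _ _)
  have h2' : MomentBound T Λ' (2 * y) ε := h2.mono ((min_le_right _ _).trans (min_le_left _ _))
  have h4' : MomentBound T Λ' (2 * (2 * y)) ε :=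
    h4.mono ((min_le_right _ _).trans (min_le_right _ _))
  set D : ℝ≥0∞ := 2 * weightConst c Λ' (weightConst c Λ A y) (2 * y) *
    ∫⁻ ω, ((2 * (2 * y) : ℝ≥0) : ℝ≥0∞) ^ count Λ' ω ∂μ with hD
  have hDt : D ≠ ∞ := ENNReal.mul_ne_top (ENNReal.mul_ne_top (by simp) ENNReal.coe_ne_top) (hμ _)
  refine ⟨ε, lt_min hε1 (lt_min hε2 hε4), D.toReal, fun t ht => ?_⟩
  have hFb : Integrable F (μ.bind (T t)) :=
    integrable_of_abs_le_pow hFm hF (h1'.lintegral_bind_ne_top hΛ hm ht (hμΛ y hy))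
  obtain ⟨hTi, hTe⟩ := integral_bind_of_integrable hFb
  refine ⟨hFb, ?_⟩
  have heq : ∫ η, F η ∂(μ.bind (T t)) - ∫ η, F η ∂μ - t * ∫ η, generator b F η ∂μ =
      ∫ ω, (∫ η, F η ∂(T t ω) - F ω - t * generator b F ω) ∂μ := by
    have hTF : Integrable (fun ω => ∫ η, F η ∂(T t ω) - F ω) μ := hTi.sub hFi
    rw [integral_sub hTF (hgi.const_mul _), integral_sub hTi hFi, integral_const_mul, hTe]
  have hen : ‖∫ η, F η ∂(μ.bind (T t)) - ∫ η, F η ∂μ - t * ∫ η, generator b F η ∂μ‖ₑ ≤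
      t * (t * D) := by
    rw [heq]
    refine (enorm_integral_le_lintegral_enorm _).trans ((lintegral_mono fun ω =>
      enorm_integral_sub_sub_generator_le hT hb hΛ hm hΛ' hm' hsub hloc hy h1' h2' h4' hFm hFl hF
        ω ht).trans (le_of_eq ?_))
    rw [lintegral_const_mul' _ _ ENNReal.coe_ne_top, lintegral_const_mul' _ _ ENNReal.coe_ne_top,
      lintegral_const_mul' _ _ (ENNReal.mul_ne_top (by simp) ENNReal.coe_ne_top)]
  have hfin : (t : ℝ≥0∞) * (t * D) ≠ ∞ :=
    ENNReal.mul_ne_top ENNReal.coe_ne_top (ENNReal.mul_ne_top ENNReal.coe_ne_top hDt)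
  have := ENNReal.toReal_mono hfin hen
  rw [toReal_enorm, Real.norm_eq_abs] at this
  refine this.trans (le_of_eq ?_)
  simp only [ENNReal.toReal_mul, ENNReal.coe_toReal]
  ring

end Evolution

/-! ### Relative entropy: quadratic bound and chain rule -/

section Entropy

open InformationTheory

variable {α : Type*} [MeasurableSpace α]

theorem klFun_le_sq {x : ℝ} (hx : 0 ≤ x) : klFun x ≤ (x - 1) ^ 2 := by
  rcases hx.eq_or_lt with rfl | h
  · simp [klFun_zero]
  · rw [klFun_apply]
    nlinarith [mul_le_mul_of_nonneg_left (Real.log_le_sub_one_of_pos h) h.le]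

theorem ofReal_sq_sub_one_le {r G : ℝ≥0∞} (hr : r ≤ 1 + G) (hG : 1 ≤ r + G) (hfin : G ≠ ∞) :
    ENNReal.ofReal ((r.toReal - 1) ^ 2) ≤ G ^ 2 := by
  have hrt : r ≠ ∞ := (hr.trans_lt (ENNReal.add_lt_top.2 ⟨by simp, hfin.lt_top⟩)).ne
  lift r to ℝ≥0 using hrt
  lift G to ℝ≥0 using hfin
  have h1 : (r : ℝ) ≤ 1 + G := by exact_mod_cast hr
  have h2 : (1 : ℝ) ≤ r + G := by exact_mod_cast hG
  have h3 : ((r : ℝ) - 1) ^ 2 ≤ (G : ℝ) ^ 2 := sq_le_sq' (by linarith) (by linarith)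
  rw [ENNReal.coe_toReal]
  refine (ENNReal.ofReal_le_ofReal h3).trans (le_of_eq ?_)
  rw [ENNReal.ofReal_pow (by positivity), ENNReal.ofReal_coe_nnreal]

/-- Two measures that differ on each set by at most the integral of `G` have relative entropy
at most the integral of `G ^ 2`. -/
theorem klDiv_le_lintegral_sq {m m₀ : Measure α} [IsFiniteMeasure m] [IsFiniteMeasure m₀]
    {G : α → ℝ≥0∞} (hGm : Measurable G) (hG : ∀ a, G a ≠ ∞)
    (hle : ∀ B, MeasurableSet B → m B ≤ m₀ B + ∫⁻ a in B, G a ∂m₀)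
    (hge : ∀ B, MeasurableSet B → m₀ B ≤ m B + ∫⁻ a in B, G a ∂m₀) :
    m ≪ m₀ ∧ klDiv m m₀ ≤ ∫⁻ a, G a ^ 2 ∂m₀ := by
  have hac : m ≪ m₀ := by
    refine Measure.AbsolutelyContinuous.mk fun B hB h0 => ?_
    have := hle B hB
    rw [h0, setLIntegral_measure_zero B _ h0, add_zero] at this
    exact le_antisymm this zero_le
  have hr := Measure.measurable_rnDeriv m m₀
  -- The setwise inequalities localise to r ≤ 1 + G and 1 ≤ r + G for the density r, that is |r - 1|
  -- ≤ G almost everywhere.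
  have h1 : m.rnDeriv m₀ ≤ᵐ[m₀] fun a => 1 + G a := by
    refine ae_le_of_forall_setLIntegral_le_of_sigmaFinite hr fun B hB _ => ?_
    rw [Measure.setLIntegral_rnDeriv hac, lintegral_add_right _ hGm, setLIntegral_one]
    exact hle B hB
  have h2 : (fun _ => 1) ≤ᵐ[m₀] fun a => m.rnDeriv m₀ a + G a := by
    refine ae_le_of_forall_setLIntegral_le_of_sigmaFinite measurable_const fun B hB _ => ?_
    rw [lintegral_add_right _ hGm, Measure.setLIntegral_rnDeriv hac, setLIntegral_one]
    exact hge B hB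
  refine ⟨hac, ?_⟩
  rw [klDiv_eq_lintegral_klFun_of_ac hac]
  refine lintegral_mono_ae ?_
  filter_upwards [h1, h2] with a ha1 ha2
  exact (ENNReal.ofReal_le_ofReal (klFun_le_sq ENNReal.toReal_nonneg)).trans
    (ofReal_sq_sub_one_le ha1 ha2 (hG a))

/-- The chain rule for the relative entropy with respect to a third measure. -/
theorem toReal_klDiv_eq_add {m m₀ n : Measure α} [IsProbabilityMeasure m]
    [IsProbabilityMeasure m₀] [IsProbabilityMeasure n] (hm : m ≪ m₀) (hn : m₀ ≪ n)
    (hkl : klDiv m m₀ ≠ ∞) (hint : Integrable (llr m₀ n) m) :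
    klDiv m n ≠ ∞ ∧ (klDiv m n).toReal = (klDiv m m₀).toReal + ∫ a, llr m₀ n a ∂m := by
  have hi := (klDiv_ne_top_iff.1 hkl).2
  have hac := hm.trans hn
  -- The densities multiply; their positivity and finiteness m-almost everywhere allow the logarithm
  -- of the product to be split.
  have heq : llr m n =ᵐ[m] fun a => llr m m₀ a + llr m₀ n a := by
    filter_upwards [hac (Measure.rnDeriv_mul_rnDeriv hm), Measure.rnDeriv_pos hm,
      hm (Measure.rnDeriv_pos hn), hm (Measure.rnDeriv_lt_top m m₀),
      hac (Measure.rnDeriv_lt_top m₀ n)] with a h1 h2 h3 h4 h5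
    rw [llr_def, llr_def, llr_def]
    simp only
    rw [← h1, Pi.mul_apply, ENNReal.toReal_mul, Real.log_mul]
    · exact (ENNReal.toReal_pos h2.ne' h4.ne).ne'
    · exact (ENNReal.toReal_pos h3.ne' h5.ne).ne'
  refine ⟨klDiv_ne_top hac ((hi.add hint).congr heq.symm), ?_⟩
  rw [toReal_klDiv_of_measure_eq hac (by simp), toReal_klDiv_of_measure_eq hm (by simp),
    integral_congr_ae heq, integral_add hi hint]

end Entropy

/-! ### The entropy relative to the initial measure is of second order -/

section EntropyEvolution

open InformationTheory

variable {b : E d → Config d → ℝ} {c : ℝ≥0} {T : ℝ≥0 → Kernel (Config d) (Config d)}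
  {Λ : Set (E d)}

theorem IsBirthDeathSemigroup.isProbabilityMeasure_bind (hT : IsBirthDeathSemigroup b T)
    {μ : Measure (Config d)} [IsProbabilityMeasure μ] (t : ℝ≥0) :
    IsProbabilityMeasure (μ.bind (T t)) := by
  refine ⟨?_⟩
  rw [Measure.bind_apply MeasurableSet.univ (T t).measurable.aemeasurable]
  have : ∀ ω, T t ω Set.univ = 1 := fun ω =>
    (hT.isProbabilityMeasure t ω).measure_univ
  simp [this]

theorem isProbabilityMeasure_marginal (hm : MeasurableSet Λ) (μ : Measure (Config d))
    [IsProbabilityMeasure μ] : IsProbabilityMeasure (marginal μ Λ) :=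
  Measure.isProbabilityMeasure_map (measurable_restrict hm).aemeasurable

/-- The local relative entropy of the evolved measure with respect to the initial one is of
second order in time. -/
theorem exists_klDiv_marginal_bind_le [Nontrivial (E d)]
    [NullSingletonClass (volume : Measure (E d))]
    (hT : IsBirthDeathSemigroup b T) (hb : IsBoundedRate b c) (hΛ : Bornology.IsBounded Λ)
    (hm : MeasurableSet Λ) {μ : Measure (Config d)} [IsProbabilityMeasure μ] {A z : ℝ≥0}
    (hμ : IsPoissonComparable Λ (marginal μ Λ) A z) :
    ∃ ε > (0 : ℝ≥0), ∃ D : ℝ≥0, ∀ t ≤ ε,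
      marginal (μ.bind (T t)) Λ ≪ marginal μ Λ ∧
      klDiv (marginal (μ.bind (T t)) Λ) (marginal μ Λ) ≤ D * (t : ℝ≥0∞) ^ 2 := by
  obtain ⟨ε, hε, g, y, h⟩ := marginal_bind_le_add hT hb hΛ hm hμ
  have hfin := hμ.lintegral_pow_count_ne_top hΛ hm (y ^ 2)
  have hD : (g : ℝ≥0∞) ^ 2 * ∫⁻ η, ((y ^ 2 : ℝ≥0) : ℝ≥0∞) ^ count Λ η ∂(marginal μ Λ) ≠ ∞ :=
    ENNReal.mul_ne_top (by simp) hfin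
  obtain ⟨D, hDe⟩  : ∃ D : ℝ≥0, (D : ℝ≥0∞) = _ := ⟨_, ENNReal.coe_toNNReal hD⟩
  refine ⟨ε, hε, D, fun t ht => ?_⟩
  rw [hDe]
  have := hT.isProbabilityMeasure_bind (μ := μ) t
  have := isProbabilityMeasure_marginal hm μ
  have := isProbabilityMeasure_marginal hm (μ.bind (T t))
  have hG : Measurable fun η : Config d => (t : ℝ≥0∞) * (g * (y : ℝ≥0∞) ^ count Λ η) :=
    measurable_weight hΛ hm fun n => (t : ℝ≥0∞) * (g * (y : ℝ≥0∞) ^ n)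
  -- Applied with G = t g y^{N_Λ}; its square is t² g² (y²)^{N_Λ}, whose integral is finite because
  -- μ_Λ has all exponential moments.
  obtain ⟨h1, h2⟩ := klDiv_le_lintegral_sq (m := marginal (μ.bind (T t)) Λ)
    (m₀ := marginal μ Λ) hG (fun η => by
      exact ENNReal.mul_ne_top (by simp) (ENNReal.mul_ne_top (by simp) (by simp)))
    (fun B hB => by
      rw [lintegral_const_mul' _ _ (by simp)]; exact (h t ht B hB).1)
    (fun B hB => by
      rw [lintegral_const_mul' _ _ (by simp)]; exact (h t ht B hB).2)
  refine ⟨h1, h2.trans (le_of_eq ?_)⟩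
  rw [← lintegral_const_mul' _ _ (by simp), ← lintegral_mul_const' _ _ (by simp)]
  refine lintegral_congr fun η => ?_
  push_cast
  ring

end EntropyEvolution

/-! ### Growth of the logarithmic density -/

section Density

variable {Λ : Set (E d)} {m n μ ν : Measure (Config d)} {a a' z z' : ℝ≥0}

theorem IsPoissonComparable.absolutelyContinuous (h : IsPoissonComparable Λ m a z) :
    m ≪ poisson Λ := by
  refine Measure.AbsolutelyContinuous.mk fun B hB h0 => le_antisymm ?_ zero_le
  have := h.le (B.indicator 1) (measurable_one.indicator hB)
  rw [lintegral_indicator_one hB] at this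
  refine this.trans (le_of_eq ?_)
  rw [lintegral_congr_ae (g := fun _ => 0), lintegral_zero]
  filter_upwards [measure_eq_zero_iff_ae_notMem.1 h0] with η hη
  simp [hη]

theorem IsPoissonComparable.absolutelyContinuous_poisson (h : IsPoissonComparable Λ m a z) :
    poisson Λ ≪ m := by
  refine Measure.AbsolutelyContinuous.mk fun B hB h0 => le_antisymm ?_ zero_le
  have := h.ge (B.indicator 1) (measurable_one.indicator hB)
  rw [lintegral_indicator_one hB] at this
  refine this.trans (le_of_eq ?_)
  rw [lintegral_congr_ae (g := fun _ => 0), lintegral_zero]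
  filter_upwards [measure_eq_zero_iff_ae_notMem.1 h0] with η hη
  simp [hη]

/-- The Poisson process is the intermediary: the bound on m by it and the bound on it by n are
composed on indicators. -/
theorem IsPoissonComparable.rnDeriv_le [IsFiniteMeasure m] [IsFiniteMeasure n]
    (hΛ : Bornology.IsBounded Λ) (hΛm : MeasurableSet Λ) (hm : IsPoissonComparable Λ m a z)
    (hn : IsPoissonComparable Λ n a' z') :
    ∀ᵐ η ∂n, m.rnDeriv n η ≤ ((a * a' : ℝ≥0) : ℝ≥0∞) * ((z * z' : ℝ≥0) : ℝ≥0∞) ^ count Λ η := by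
  have hac : m ≪ n := hm.absolutelyContinuous.trans hn.absolutelyContinuous_poisson
  refine ae_le_of_forall_setLIntegral_le_of_sigmaFinite (Measure.measurable_rnDeriv m n)
    fun B hB _ => ?_
  rw [Measure.setLIntegral_rnDeriv hac, ← lintegral_indicator hB, ← lintegral_indicator_one hB]
  have hI : Measurable (B.indicator (1 : Config d → ℝ≥0∞)) := measurable_one.indicator hB
  refine (hm.le _ hI).trans ((hn.ge _
    ((measurable_weight hΛ hΛm fun k => (a : ℝ≥0∞) * (z : ℝ≥0∞) ^ k).mul hI)).trans
    (le_of_eq (lintegral_congr fun η => ?_)))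
  by_cases hη : η ∈ B
  · simp only [Pi.mul_apply, Set.indicator_of_mem hη, Pi.one_apply, mul_one]
    push_cast
    rw [mul_pow]
    ring
  · simp [hη]

theorem abs_log_toReal_le {r : ℝ≥0∞} {K Z : ℝ≥0} {N : ℕ} (hK : 1 ≤ K) (hZ : 1 ≤ Z)
    (h1 : r ≤ (K : ℝ≥0∞) * (Z : ℝ≥0∞) ^ N) (h2 : r⁻¹ ≤ (K : ℝ≥0∞) * (Z : ℝ≥0∞) ^ N) :
    |Real.log r.toReal| ≤ ((K + Z : ℝ≥0) : ℝ) * ((2 : ℝ≥0) : ℝ) ^ N := by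
  have hfin : (K : ℝ≥0∞) * (Z : ℝ≥0∞) ^ N ≠ ∞ := ENNReal.mul_ne_top (by simp) (by simp)
  have hrt : r ≠ ∞ := (h1.trans_lt hfin.lt_top).ne
  have hr0 : r ≠ 0 := fun h => (h2.trans_lt hfin.lt_top).ne (by simp [h])
  have hpos : 0 < r.toReal := ENNReal.toReal_pos hr0 hrt
  have hK' : (1 : ℝ) ≤ K := by exact_mod_cast hK
  have hZ' : (1 : ℝ) ≤ Z := by exact_mod_cast hZ
  have h1' : r.toReal ≤ K * (Z : ℝ) ^ N := by
    simpa using ENNReal.toReal_mono hfin h1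
  have h2' : r.toReal⁻¹ ≤ K * (Z : ℝ) ^ N := by
    simpa using ENNReal.toReal_mono hfin h2
  have hlog : Real.log (K * (Z : ℝ) ^ N) ≤ ((K + Z : ℝ≥0) : ℝ) * ((2 : ℝ≥0) : ℝ) ^ N := by
    rw [Real.log_mul (by positivity) (by positivity), Real.log_pow]
    have hN : (N : ℝ) ≤ 2 ^ N := by exact_mod_cast Nat.lt_two_pow_self.le
    have hN1 : (1 : ℝ) ≤ 2 ^ N := one_le_pow₀ (by norm_num)
    have hKl : Real.log K ≤ K := Real.log_le_self (by positivity)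
    have hZl : Real.log Z ≤ Z := Real.log_le_self (by positivity)
    push_cast
    calc Real.log K + N * Real.log Z ≤ K * 1 + N * Z := by
          rw [mul_one]
          exact add_le_add hKl (mul_le_mul_of_nonneg_left hZl (Nat.cast_nonneg N))
      _ ≤ K * 2 ^ N + 2 ^ N * Z := by gcongr
      _ = _ := by ring
  refine abs_le.2 ⟨?_, (Real.log_le_log hpos h1').trans hlog⟩
  have := (Real.log_le_log (inv_pos.2 hpos) h2').trans hlog
  rw [Real.log_inv] at this
  linarith

theorem measurable_logDensity (hm : MeasurableSet Λ) : Measurable (logDensity Λ μ ν) :=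
  Real.measurable_log.comp
    (((Measure.measurable_rnDeriv _ _).comp (measurable_restrict hm)).ennreal_toReal)

theorem isLocalOn_logDensity (Λ : Set (E d)) (μ ν : Measure (Config d)) :
    IsLocalOn Λ (logDensity Λ μ ν) := fun η => by
  rw [logDensity, logDensity, restrict_restrict, Set.inter_self]

theorem ae_restrict_eq (hm : MeasurableSet Λ) {P : Config d → Prop}
    (h : ∀ᵐ η ∂(marginal μ Λ), P η) : ∀ᵐ η ∂μ, P (η.restrict Λ) :=
  ae_of_ae_map (measurable_restrict hm).aemeasurable h

/-- The logarithmic density of two measures comparable to the Poisson process grows at most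
exponentially in the number of points. -/
theorem exists_abs_logDensity_le [IsProbabilityMeasure μ] [IsProbabilityMeasure ν]
    (hΛ : Bornology.IsBounded Λ) (hΛm : MeasurableSet Λ)
    (hm : IsPoissonComparable Λ (marginal μ Λ) a z)
    (hn : IsPoissonComparable Λ (marginal ν Λ) a' z') :
    ∃ A : ℝ≥0, ∀ᵐ η ∂(poisson Λ), |logDensity Λ μ ν η| ≤ A * ((2 : ℝ≥0) : ℝ) ^ count Λ η := by
  have := isProbabilityMeasure_marginal hΛm μ
  have := isProbabilityMeasure_marginal hΛm ν
  refine ⟨a * a' + z * z', ?_⟩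
  have hac : marginal μ Λ ≪ marginal ν Λ :=
    hm.absolutelyContinuous.trans hn.absolutelyContinuous_poisson
  have h1 : ∀ᵐ η ∂(marginal μ Λ),
      |Real.log ((marginal μ Λ).rnDeriv (marginal ν Λ) η).toReal| ≤
        ((a * a' + z * z' : ℝ≥0) : ℝ) * ((2 : ℝ≥0) : ℝ) ^ count Λ η := by
    filter_upwards [hac (hm.rnDeriv_le hΛ hΛm hn), hn.rnDeriv_le hΛ hΛm hm,
      Measure.inv_rnDeriv hac] with η h1 h2 h3
    refine abs_log_toReal_le (one_le_mul hm.one_le_const hn.one_le_const)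
      (one_le_mul hm.one_le_base hn.one_le_base) h1 ?_
    -- The lower bound on the density is the upper bound on its reciprocal, the density with the two
    -- measures exchanged.
    rw [← Pi.inv_apply, h3, mul_comm a, mul_comm z]
    exact h2
  have h2 : ∀ᵐ η ∂μ, |logDensity Λ μ ν η| ≤
      ((a * a' + z * z' : ℝ≥0) : ℝ) * ((2 : ℝ≥0) : ℝ) ^ count Λ η := by
    filter_upwards [ae_restrict_eq hΛm h1] with η hη
    rwa [isLocalOn_count Λ η] at hη
  refine hm.absolutelyContinuous_poisson ?_
  have hmeas : MeasurableSet {η : Config d | |logDensity Λ μ ν η| ≤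
      ((a * a' + z * z' : ℝ≥0) : ℝ) * ((2 : ℝ≥0) : ℝ) ^ count Λ η} :=
    measurableSet_le (measurable_logDensity hΛm).abs
      (measurable_const.mul (measurable_const.pow (measurable_count hΛ hΛm)))
  refine (ae_map_iff (measurable_restrict hΛm).aemeasurable hmeas).2 ?_
  filter_upwards [h2] with η hη
  rwa [isLocalOn_logDensity Λ μ ν η, isLocalOn_count Λ η]

end Density

/-! ### Changing a local function on a null set -/

section Modification

variable {b : E d → Config d → ℝ} {Λ : Set (E d)} {μ : Measure (Config d)} {a z : ℝ≥0}

/-- By duality the integral of the left-hand side is at most a weighted Poisson integral of 1_B,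
which vanishes. So for almost every configuration, adding almost any point of Λ or removing any
point of Λ avoids the null set B. -/
theorem ae_domOp_indicator_eq_zero [NullSingletonClass (volume : Measure (E d))]
    (hΛ : Bornology.IsBounded Λ) (hm : MeasurableSet Λ) {m : Measure (Config d)}
    (hμ : IsPoissonComparable Λ m a z) {B : Set (Config d)} (hB : MeasurableSet B)
    (h0 : poisson Λ B = 0) : ∀ᵐ η ∂m, domOp 1 hΛ (B.indicator 1) η = 0 := by
  have hI : Measurable (B.indicator (1 : Config d → ℝ≥0∞)) := measurable_one.indicator hB
  have hD := measurable_domOp 1 hΛ hm hI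
  refine (lintegral_eq_zero_iff hD).1 (le_antisymm ((hμ.le _ hD).trans (le_of_eq ?_)) zero_le)
  rw [lintegral_poisson_domOp 1 hΛ hm (fun k => (a : ℝ≥0∞) * (z : ℝ≥0∞) ^ k) hI,
    lintegral_congr_ae (g := fun _ => 0), lintegral_zero]
  filter_upwards [measure_eq_zero_iff_ae_notMem.1 h0] with η hη
  simp [hη]

/-- The generator is insensitive to changing a local function on a null set. -/
theorem ae_generator_eq [NullSingletonClass (volume : Measure (E d))]
    (hΛ : Bornology.IsBounded Λ) (hm : MeasurableSet Λ)
    (hμ : IsPoissonComparable Λ (marginal μ Λ) a z) {F G : Config d → ℝ} (hFm : Measurable F)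
    (hGm : Measurable G) (hF : IsLocalOn Λ F) (hG : IsLocalOn Λ G) (h : F =ᵐ[poisson Λ] G) :
    ∀ᵐ η ∂μ, F η = G η ∧ birthTerm b F η =ᵐ[volume] birthTerm b G η ∧
      generator b F η = generator b G η := by
  set B : Set (Config d) := {η | F η ≠ G η} with hBdef
  have hB : MeasurableSet B := (measurableSet_eq_fun hFm hGm).compl
  have hBl : ∀ η : Config d, B.indicator (1 : Config d → ℝ≥0∞) (η.restrict Λ) =
      B.indicator 1 η := fun η => by
    simp only [hBdef, Set.indicator_apply, Set.mem_ofPred_eq, hF η, hG η, Pi.one_apply]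
  have hzero : ∀ η, B.indicator (1 : Config d → ℝ≥0∞) η = 0 → F η = G η := fun η hη => by
    by_contra hne
    rw [Set.indicator_of_mem (show η ∈ B from hne)] at hη
    exact one_ne_zero hη
  filter_upwards [ae_restrict_eq hm (hμ.absolutelyContinuous h),
    ae_restrict_eq hm (ae_domOp_indicator_eq_zero hΛ hm hμ hB h)] with η h1 h2
  rw [hF η, hG η] at h1
  rw [domOp_restrict 1 hΛ hm hBl, domOp, add_eq_zero, add_eq_zero] at h2
  obtain ⟨⟨h3, h4⟩, -⟩ := h2
  have hadd : ∀ᵐ x : E d, F (η.add x) = G (η.add x) := by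
    have hI : Measurable fun x : E d => B.indicator (1 : Config d → ℝ≥0∞) (η.add x) :=
      (measurable_one.indicator hB).comp (Config.measurable_add.comp measurable_prodMk_left)
    rw [ENNReal.coe_one, one_mul, lintegral_eq_zero_iff hI] at h3
    filter_upwards [(ae_restrict_iff' hm).1 h3] with x hx
    by_cases hxΛ : x ∈ Λ
    · exact hzero _ (hx hxΛ)
    · rw [local_add_of_notMem hF hxΛ, local_add_of_notMem hG hxΛ, h1]
  have hrem : ∀ x, x ∈ η.carrier → F (η.remove x) = G (η.remove x) := fun x hx => by
    by_cases hxΛ : x ∈ Λ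
    · exact hzero _ ((Finset.sum_eq_zero_iff.1 h4) x (mem_points.2 ⟨hx, hxΛ⟩))
    · rw [local_remove_of_notMem hF hxΛ, local_remove_of_notMem hG hxΛ, h1]
  have hbt : birthTerm b F η =ᵐ[volume] birthTerm b G η := by
    filter_upwards [hadd] with x hx
    rw [birthTerm, birthTerm, hx, h1]
  refine ⟨h1, hbt, ?_⟩
  rw [generator, generator, integral_congr_ae hbt]
  congr 1
  exact tsum_congr fun x => by rw [hrem x.1 x.2, h1]

theorem integrable_birthTerm {c : ℝ≥0} (hb : IsBoundedRate b c) (hΛ : Bornology.IsBounded Λ)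
    {A y : ℝ≥0} (hy : 1 ≤ y) {F : Config d → ℝ} (hFm : Measurable F) (hFl : IsLocalOn Λ F)
    (hF : ∀ η, |F η| ≤ A * (y : ℝ) ^ count Λ η) (η : Config d) :
    Integrable (birthTerm b F η) := by
  have hbm : Measurable (birthTerm b F η) :=
    (hb.measurable.comp measurable_prodMk_left).mul
      ((hFm.comp (Config.measurable_add.comp measurable_prodMk_left)).sub measurable_const)
  have hsupp : Function.support (birthTerm b F η) ⊆ Λ := fun x hx => by
    by_contra hxΛ
    exact hx (by rw [birthTerm, local_add_of_notMem hFl hxΛ, sub_self, mul_zero])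
  rw [← integrableOn_iff_integrable_of_support_subset hsupp]
  refine Measure.integrableOn_of_bounded (M := c * (A * (y : ℝ) ^ (count Λ η + 1) +
    A * (y : ℝ) ^ (count Λ η + 1))) hΛ.measure_lt_top.ne hbm.aestronglyMeasurable
    (Eventually.of_forall fun x => ?_)
  have hy' : (1 : ℝ) ≤ y := by exact_mod_cast hy
  have hcount : count Λ (η.add x) ≤ count Λ η + 1 := by
    rw [count_add hΛ]; split_ifs <;> omega
  have h1 : |F (η.add x)| ≤ A * (y : ℝ) ^ (count Λ η + 1) :=
    (hF _).trans (mul_le_mul_of_nonneg_left (pow_le_pow_right₀ hy' hcount) A.2)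
  have h2 : |F η| ≤ A * (y : ℝ) ^ (count Λ η + 1) :=
    (hF _).trans (mul_le_mul_of_nonneg_left (pow_le_pow_right₀ hy' (Nat.le_succ _)) A.2)
  rw [birthTerm, Real.norm_eq_abs, abs_mul, abs_of_nonneg (hb.nonneg x η)]
  exact mul_le_mul (hb.le x η) ((abs_sub _ _).trans (add_le_add h1 h2)) (abs_nonneg _) c.2

/-- Truncation of a function at the levels `-A 2^{N_Λ}` and `A 2^{N_Λ}`. -/
noncomputable def clamp (Λ : Set (E d)) (A : ℝ≥0) (F : Config d → ℝ) (η : Config d) : ℝ :=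
  max (min (F η) (A * ((2 : ℝ≥0) : ℝ) ^ count Λ η)) (-(A * ((2 : ℝ≥0) : ℝ) ^ count Λ η))

theorem abs_clamp_le (A : ℝ≥0) (F : Config d → ℝ) (η : Config d) :
    |clamp Λ A F η| ≤ A * ((2 : ℝ≥0) : ℝ) ^ count Λ η := by
  have : (0 : ℝ) ≤ A * ((2 : ℝ≥0) : ℝ) ^ count Λ η := by positivity
  exact abs_le.2 ⟨le_max_right _ _, max_le (min_le_right _ _) (by linarith)⟩

theorem clamp_eq {A : ℝ≥0} {F : Config d → ℝ} {η : Config d}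
    (h : |F η| ≤ A * ((2 : ℝ≥0) : ℝ) ^ count Λ η) : clamp Λ A F η = F η := by
  obtain ⟨h1, h2⟩ := abs_le.1 h
  rw [clamp, min_eq_left h2, max_eq_left h1]

theorem measurable_clamp (hΛ : Bornology.IsBounded Λ) (hm : MeasurableSet Λ) (A : ℝ≥0)
    {F : Config d → ℝ} (hF : Measurable F) : Measurable (clamp Λ A F) := by
  have : Measurable fun η : Config d => (A : ℝ) * ((2 : ℝ≥0) : ℝ) ^ count Λ η :=
    measurable_const.mul (measurable_const.pow (measurable_count hΛ hm))
  exact (hF.min this).max this.neg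

theorem IsLocalOn.clamp {F : Config d → ℝ} (hF : IsLocalOn Λ F) (A : ℝ≥0) :
    IsLocalOn Λ (clamp Λ A F) := fun η => by
  rw [BirthDeath.clamp, BirthDeath.clamp, hF η, isLocalOn_count Λ η]

end Modification

theorem hasDerivWithinAt_of_abs_sub_le {f : ℝ → ℝ} {a L C ε : ℝ} (hε : 0 < ε)
    (h : ∀ t, 0 ≤ t → t ≤ ε → |f t - a - t * L| ≤ C * t ^ 2) :
    HasDerivWithinAt f L (Set.Ici 0) 0 := by
  -- The quadratic bound at t = 0 identifies the value of f there.
  have h0 : f 0 = a := by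
    have := h 0 le_rfl hε.le
    simp only [zero_mul, sub_zero, ne_eq, OfNat.ofNat_ne_zero, not_false_eq_true, zero_pow,
      mul_zero, abs_nonpos_iff] at this
    linarith
  rw [hasDerivWithinAt_iff_isLittleO]
  have hO : (fun t => f t - f 0 - (t - 0) • L) =O[𝓝[≥] 0] fun t : ℝ => t ^ 2 := by
    refine Asymptotics.IsBigO.of_bound C ?_
    filter_upwards [Icc_mem_nhdsGE hε] with t ht
    rw [h0, sub_zero, smul_eq_mul, Real.norm_eq_abs, Real.norm_eq_abs, abs_of_nonneg (sq_nonneg t)]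
    exact h t ht.1 ht.2
  refine hO.trans_isLittleO ?_
  have : (fun t : ℝ => t ^ 2) =o[𝓝 0] fun t => t - 0 := by
    simpa using Asymptotics.isLittleO_pow_id (𝕜 := ℝ) one_lt_two
  exact this.mono nhdsWithin_le_nhds

/-! ### The derivative of the local entropy -/

section EntropyProduction

open InformationTheory

variable {b : E d → Config d → ℝ} {c : ℝ≥0} {T : ℝ≥0 → Kernel (Config d) (Config d)}
  {Λ Λ' : Set (E d)} {μ ν : Measure (Config d)} {a a' z z' : ℝ≥0}

/-- The local entropy in terms of the one relative to a reference measure. -/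
theorem toReal_localEntropy_eq_add {ρ : Measure (Config d)} [IsProbabilityMeasure ρ]
    [IsProbabilityMeasure μ] [IsProbabilityMeasure ν] (hm : MeasurableSet Λ)
    (hρ : marginal ρ Λ ≪ marginal μ Λ) (hμ : marginal μ Λ ≪ marginal ν Λ)
    (hkl : klDiv (marginal ρ Λ) (marginal μ Λ) ≠ ∞) (hint : Integrable (logDensity Λ μ ν) ρ) :
    localEntropy Λ ρ ν ≠ ∞ ∧ (localEntropy Λ ρ ν).toReal =
      (klDiv (marginal ρ Λ) (marginal μ Λ)).toReal + ∫ η, logDensity Λ μ ν η ∂ρ := by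
  have := isProbabilityMeasure_marginal hm ρ
  have := isProbabilityMeasure_marginal hm μ
  have := isProbabilityMeasure_marginal hm ν
  have hr := (measurable_restrict hm).aemeasurable (μ := ρ)
  have hs : AEStronglyMeasurable (llr (marginal μ Λ) (marginal ν Λ)) (ρ.map (restrict Λ)) :=
    (stronglyMeasurable_llr _ _).aestronglyMeasurable
  obtain ⟨h1, h2⟩ := toReal_klDiv_eq_add hρ hμ hkl ((integrable_map_measure hs hr).2 hint)
  refine ⟨h1, h2.trans ?_⟩
  rw [marginal, integral_map hr hs]
  rfl

/-- The local entropy of the evolved measure, to second order in time. -/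
theorem exists_abs_toReal_localEntropy_sub_le [Nontrivial (E d)]
    [NullSingletonClass (volume : Measure (E d))] [IsProbabilityMeasure μ] [IsProbabilityMeasure ν]
    (hT : IsBirthDeathSemigroup b T) (hb : IsBoundedRate b c) (hΛ : Bornology.IsBounded Λ)
    (hm : MeasurableSet Λ) (hΛ' : Bornology.IsBounded Λ') (hm' : MeasurableSet Λ') (hsub : Λ ⊆ Λ')
    (hloc : ∀ x ∈ Λ, ∀ η : Config d, b x (η.restrict Λ') = b x η)
    (hμ' : ∀ y : ℝ≥0, ∫⁻ η, (y : ℝ≥0∞) ^ count Λ' η ∂μ ≠ ∞)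
    (hμ : IsPoissonComparable Λ (marginal μ Λ) a z)
    (hν : IsPoissonComparable Λ (marginal ν Λ) a' z') :
    (∀ᵐ η ∂μ, Integrable (birthTerm b (logDensity Λ μ ν) η)) ∧
    Integrable (generator b (logDensity Λ μ ν)) μ ∧
    ∃ ε > (0 : ℝ≥0), ∃ C : ℝ, ∀ t ≤ ε, localEntropy Λ (μ.bind (T t)) ν ≠ ∞ ∧
      |(localEntropy Λ (μ.bind (T t)) ν).toReal - ∫ η, logDensity Λ μ ν η ∂μ -
        t * ∫ η, generator b (logDensity Λ μ ν) η ∂μ| ≤ C * (t : ℝ) ^ 2 := by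
  obtain ⟨A, hA⟩ := exists_abs_logDensity_le hΛ hm hμ hν
  set φ := logDensity Λ μ ν with hφdef
  have hφm : Measurable φ := measurable_logDensity hm
  have hφl : IsLocalOn Λ φ := isLocalOn_logDensity Λ μ ν
  -- The bound on the logarithmic density holds only almost everywhere, whereas the estimates for
  -- the process started from a given ω need it everywhere. The clamped version satisfies it
  -- everywhere and agrees with φ off a Poisson-null set.
  set ψ := clamp Λ A φ with hψdef
  have hψm : Measurable ψ := measurable_clamp hΛ hm A hφm
  have hψl : IsLocalOn Λ ψ := hφl.clamp A
  have hψ : ∀ η, |ψ η| ≤ A * ((2 : ℝ≥0) : ℝ) ^ count Λ η := abs_clamp_le A φ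
  have hφψ : φ =ᵐ[poisson Λ] ψ := hA.mono fun η hη => (clamp_eq hη).symm
  have hae := ae_generator_eq (b := b) hΛ hm hμ hφm hψm hφl hψl hφψ
  have hφψμ : φ =ᵐ[μ] ψ := hae.mono fun η hη => hη.1
  have hgen : generator b φ =ᵐ[μ] generator b ψ := hae.mono fun η hη => hη.2.2
  obtain ⟨-, hgi, ε₁, hε₁, B, hev⟩ := exists_abs_integral_bind_sub_le hT hb hΛ hm hΛ' hm' hsub
    hloc hμ' one_le_two hψm hψl hψ
  obtain ⟨ε₂, hε₂, D, hent⟩ := exists_klDiv_marginal_bind_le hT hb hΛ hm hμ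
  refine ⟨hae.mono fun η hη => (integrable_birthTerm hb hΛ one_le_two hψm hψl hψ η).congr
    hη.2.1.symm, hgi.congr hgen.symm, min ε₁ ε₂, lt_min hε₁ hε₂, D + B, fun t ht => ?_⟩
  obtain ⟨hint, hbound⟩ := hev t (ht.trans (min_le_left _ _))
  obtain ⟨hac, hkl⟩ := hent t (ht.trans (min_le_right _ _))
  have := hT.isProbabilityMeasure_bind (μ := μ) t
  have hDt : (D : ℝ≥0∞) * (t : ℝ≥0∞) ^ 2 ≠ ∞ := ENNReal.mul_ne_top (by simp) (by simp)
  -- The evolved marginal is absolutely continuous with respect to μ_Λ, so the process started from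
  -- μ does not charge the exceptional set at time t.
  have hφψt : φ =ᵐ[μ.bind (T t)] ψ := by
    filter_upwards [ae_restrict_eq hm (hac (hμ.absolutelyContinuous hφψ))] with η hη
    rwa [hφl η, hψl η] at hη
  obtain ⟨h1, h2⟩ := toReal_localEntropy_eq_add hm hac
    (hμ.absolutelyContinuous.trans hν.absolutelyContinuous_poisson)
    (hkl.trans_lt hDt.lt_top).ne (hint.congr hφψt.symm)
  refine ⟨h1, ?_⟩
  rw [h2, integral_congr_ae hφψt, integral_congr_ae hφψμ, integral_congr_ae hgen]
  have h3 : (klDiv (marginal (μ.bind (T t)) Λ) (marginal μ Λ)).toReal ≤ D * (t : ℝ) ^ 2 := by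
    simpa using ENNReal.toReal_mono hDt hkl
  -- The entropy relative to μ is at most D t², and the expectation of ψ differs from its
  -- first-order expansion by at most B t².
  rw [add_sub_assoc, add_sub_assoc, add_mul]
  refine (abs_add_le _ _).trans (add_le_add ?_ hbound)
  rwa [abs_of_nonneg ENNReal.toReal_nonneg]

end EntropyProduction

end BirthDeath

theorem mainTheorem3 {d : ℕ} (hd : 1 ≤ d)
    (H : Finset (BirthDeath.E d) → ℝ) (hH : BirthDeath.IsAdmissible H)
    (T : ℝ≥0 → Kernel (BirthDeath.Config d) (BirthDeath.Config d))
    (hT : BirthDeath.IsBirthDeathSemigroup (BirthDeath.birthRate H) T)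
    (ν : Measure (BirthDeath.Config d)) (hν : BirthDeath.IsGibbs H ν)
    (μ : Measure (BirthDeath.Config d)) [IsProbabilityMeasure μ] (hμ : BirthDeath.IsRegular μ)
    (Λ : Set (BirthDeath.E d)) (hΛ : Bornology.IsBounded Λ) (hΛm : MeasurableSet Λ) :
    -- the density `dμ_Λ/dν_Λ` exists and is positive and finite almost everywhere
    (BirthDeath.marginal μ Λ ≪ BirthDeath.marginal ν Λ ∧
      BirthDeath.marginal ν Λ ≪ BirthDeath.marginal μ Λ) ∧
    -- the right-hand side `μ[𝓛 log (dμ_Λ/dν_Λ)]` is well defined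
    (∀ᵐ η ∂μ, Integrable
      (BirthDeath.birthTerm (BirthDeath.birthRate H) (BirthDeath.logDensity Λ μ ν) η)) ∧
    Integrable
      (BirthDeath.generator (BirthDeath.birthRate H) (BirthDeath.logDensity Λ μ ν)) μ ∧
    -- the local relative entropy is finite for small times
    (∀ᶠ t in 𝓝[≥] (0 : ℝ), BirthDeath.localEntropy Λ (BirthDeath.evolve μ T t) ν ≠ ∞) ∧
    -- and its (one-sided) derivative at time `0` is the right-hand side
    HasDerivWithinAt
      (fun t : ℝ => (BirthDeath.localEntropy Λ (BirthDeath.evolve μ T t) ν).toReal)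
      (∫ η, BirthDeath.generator (BirthDeath.birthRate H) (BirthDeath.logDensity Λ μ ν) η ∂μ)
      (Set.Ici 0) 0 := by
  -- Positive dimension enters here: the space is nontrivial and Lebesgue measure has no atoms.
  have : Nonempty (Fin d) := ⟨⟨0, hd⟩⟩
  have : Nontrivial (BirthDeath.E d) := inferInstance
  have : NullSingletonClass (volume : Measure (BirthDeath.E d)) := inferInstance
  have := hν.isProbabilityMeasure
  obtain ⟨c, hc⟩ := BirthDeath.exists_birthRate_le hH
  obtain ⟨R, hR, hloc⟩ := BirthDeath.exists_birthRate_restrict hH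
  have hb : BirthDeath.IsBoundedRate (BirthDeath.birthRate H) c :=
    ⟨BirthDeath.measurable_birthRate hH, fun x η => (BirthDeath.birthRate_pos x η).le, hc⟩
  -- The closed R-neighbourhood of Λ contains all points that influence birth rates in Λ. Regularity
  -- of μ on it supplies the exponential moments there.
  have hΛ' : Bornology.IsBounded (Metric.cthickening R Λ) := hΛ.cthickening
  have hm' : MeasurableSet (Metric.cthickening R Λ) := Metric.isClosed_cthickening.measurableSet
  obtain ⟨a, z, hcμ⟩ := hμ.exists_isPoissonComparable hΛ hΛm
  obtain ⟨a', z', hcμ'⟩ := hμ.exists_isPoissonComparable hΛ' hm'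
  obtain ⟨k, w, hcν⟩ := hν.exists_isPoissonComparable hH hΛ hΛm
  obtain ⟨hbirth, hgen, ε, hε, C, h⟩ := BirthDeath.exists_abs_toReal_localEntropy_sub_le hT hb hΛ
    hΛm hΛ' hm' (Metric.self_subset_cthickening Λ) (hloc Λ)
    (fun y => by
      rw [← BirthDeath.lintegral_pow_count_marginal hΛ' hm' μ]
      exact hcμ'.lintegral_pow_count_ne_top hΛ' hm' y) hcμ hcν
  have hsmall : ∀ t : ℝ, t ≤ ε → t.toNNReal ≤ ε := fun t ht => Real.toNNReal_le_iff_le_coe.2 ht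
  refine ⟨⟨hcμ.absolutelyContinuous.trans hcν.absolutelyContinuous_poisson,
    hcν.absolutelyContinuous.trans hcμ.absolutelyContinuous_poisson⟩, hbirth, hgen, ?_, ?_⟩
  · filter_upwards [Icc_mem_nhdsGE (NNReal.coe_pos.2 hε)] with t ht
    exact (h _ (hsmall t ht.2)).1
  · refine BirthDeath.hasDerivWithinAt_of_abs_sub_le (NNReal.coe_pos.2 hε)
      (a := ∫ η, BirthDeath.logDensity Λ μ ν η ∂μ) (C := C) fun t ht0 ht => ?_
    have := (h _ (hsmall t ht)).2
    rwa [Real.coe_toNNReal t ht0] at this
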